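/- **Conventions.** All rings and algebras are commutative and unital. Let $\mathscr C$ be either $\mathrm{Ab}^{\mathrm A}$, the category of complete normed Abelian groups and bounded homomorphisms, or $\mathrm{Ab}^{\mathrm{nA}}$, its full subcategory of groups with ultrametric norm. A *Banach ring* in $\mathscr C$ is a ring $A$ whose additive group is an object of $\mathscr C$ and whose multiplication is bounded ($\|xy\|\le C\|x\|\|y\|$ for some $C$); a *Banach $A$-module* is an $A$-module $M\in\mathscr C$ with $\|am\|\le C\|a\|\|m\|$ for some $C$, and a *Banach $A$-algebra* is a Banach ring in $\mathscr C$ which is an $A$-algebra and a Banach $A$-module. With the bounded homomorphisms they form categories $\mathrm{Mod}_{\mathscr C}(A)$ and $\mathrm{Alg}_{\mathscr C}(A)$. $\widehat\otimes_A$ is the completion of $\otimes_A$ for the seminorm $\|t\|=\inf\sum_k\|a_k\|\prod_i\|m_{k,i}\|$ (with $\max_k$ in place of $\sum_k$ if $\mathscr C=\mathrm{Ab}^{\mathrm{nA}}$), the infimum being over all expressions $t=\sum_k a_k\bigotimes_i m_{k,i}$. A morphism $f:M\to N$ of $\mathrm{Mod}_{\mathscr C}(A)$ is *strict* if the canonical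 map from $M/\ker f$, with the quotient norm, to $\overline{f(M)}$ is bijective with bounded inverse. A complex is *strictly exact* if at each term the closure of the image of the incoming differential is the kernel of the outgoing one, and the incoming differential is strict. A *quasi-isomorphism* is a morphism of complexes with strictly exact mapping cone, and $\mathrm{Der}^-_{\mathscr C}(A)$ is the localisation of the category of bounded above complexes in $\mathrm{Mod}_{\mathscr C}(A)$ at the quasi-isomorphisms. For a Banach $A$-module $M$ let $\ell(M,A)$ be the completed direct sum over $m\in M$ of copies of $A$ with norm rescaled by $\|m\|$ (the $\ell^1$-sum, respectively the sum with supremum norm if $\mathscr C=\mathrm{Ab}^{\mathrm{nA}}$), and let $P(M)$ be the resolution of $M$ with $P(M)_0=\ell(M,A)\to M$ and each further term $\ell(Z,A)$, where $Z$ is the kernel of the preceding map. The derived tensor product $\widehat\otimes^{\mathbb L}_A$ of finitely many Banach modules $M_i$ is $\mathrm{Tot}\bigl(\widehat\bigotimes_i P(M_i)\bigr)$. Let $R$ be a Banach ring in $\mathscr C$, $A$ a Banach $R$-algebra in $\mathscr C$ and $\mathcal S$ a set of Banach $A$-algebras in $\mathscr C$. * $\mathcal S$ is a *non-derived cover* of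 $A$ if each structure morphism $A\to B$, $B\in\mathcal S$, is an epimorphism in $\mathrm{Alg}_{\mathscr C}(R)$, and there are finitely many distinct $B_1,\dots,B_m\in\mathcal S$ whose augmented alternating Tate–Čech complex $$0\to A\to\prod_{i}B_i\to\prod_{i<j}B_i\widehat\otimes_AB_j\to\prod_{i<j<k}B_i\widehat\otimes_AB_j\widehat\otimes_AB_k\to\cdots$$ is strictly exact. * $\mathcal S$ is a *derived cover* of $A$ if each structure morphism $A\to B$, $B\in\mathcal S$, is a homotopy epimorphism, i.e. the multiplication $B\widehat\otimes^{\mathbb L}_AB\to B$ is an isomorphism in $\mathrm{Der}^-_{\mathscr C}(A)$, and there are finitely many distinct $B_1,\dots,B_m\in\mathcal S$ such that the total complex of the corresponding complex with $\widehat\otimes^{\mathbb L}_A$ in place of $\widehat\otimes_A$ is strictly exact. The triple $(\mathscr C,X,R)$, with $X$ a compact Hausdorff space, is *admissible* if either $\mathscr C=\mathrm{Ab}^{\mathrm A}$ and $R$ is $\mathbb R$ or $\mathbb C$ with the usual absolute value, or $\mathscr C=\mathrm{Ab}^{\mathrm{nA}}$, $R$ is a finite field with the trivial absolute value or a non-Archimedean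 local field, and $X$ is totally disconnected. For compact Hausdorff $Y$, let $\iota_Y:Y\to\beta_{\mathscr C}(Y)$ be the identity of $Y$ if $\mathscr C=\mathrm{Ab}^{\mathrm A}$, and the canonical map to the Banaschewski compactification (the reflection of $Y$ into totally disconnected compact Hausdorff spaces) if $\mathscr C=\mathrm{Ab}^{\mathrm{nA}}$. A set $S$ of compact Hausdorff spaces $j:K\to X$ over $X$ is a *$\mathscr C$-cover* of $X$ if each $\beta_{\mathscr C}(j)$ is a homeomorphism onto its image and there is a finite $S_0\subset S$ such that $\bigsqcup_{(K,j)\in S_0}K\to X\xrightarrow{\iota_X}\beta_{\mathscr C}(X)$ is surjective. For $Y$ compact Hausdorff, $\mathrm C(Y,R)$ is the ring of continuous functions $Y\to R$ with the supremum norm. **Theorem.** Let $(\mathscr C,X,R)$ be an admissible triple and let $S$ be a set of closed immersions $j:K\hookrightarrow X$ of compact Hausdorff spaces (i.e. homeomorphisms onto closed subsets of $X$). Regard each $\mathrm C(K,R)$ as a Banach $\mathrm C(X,R)$-algebra by composition with $j$. Then the following are equivalent: 1. $S$ is a $\mathscr C$-cover of $X$. 2. There is a finite subset $S_0\subset S$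 with $\bigcup_{(K,j)\in S_0}j(K)=X$. 3. The set $\{\mathrm C(K,R):(K,j)\in S\}$ is a non-derived cover of $\mathrm C(X,R)$. 4. The set $\{\mathrm C(K,R):(K,j)\in S\}$ is a derived cover of $\mathrm C(X,R)$. -/

import Mathlib

universe u

open CategoryTheory CategoryTheory.Limits

set_option linter.unusedSectionVars false

/-- The two ambient categories of Banach Abelian groups: `BanKind.arch` is the category `Ab^A` of
all Banach Abelian groups, `BanKind.nonarch` is the category `Ab^nA` of non-Archimedean
(i.e. ultrametric) ones; morphisms are the bounded group homomorphisms in both cases. -/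
inductive BanKind : Type
  | arch
  | nonarch

/-- A (complete normed) Abelian group is an object of the category `c`. -/
class IsBanObj (c : BanKind) (M : Type*) [SeminormedAddCommGroup M] : Prop where
  ultra : c = BanKind.nonarch → IsUltrametricDist M

/-- The objects of `Mod_c(A)`: Banach `A`-modules. -/
structure BanMod (c : BanKind) (A : Type u) [NormedCommRing A] : Type (u + 1) where
  carrier : Type u
  [grp : NormedAddCommGroup carrier]
  [complete : CompleteSpace carrier]
  [mod : Module A carrier]
  [obj : IsBanObj c carrier]
  smul_bdd : ∃ C : ℝ, ∀ (a : A) (m : carrier), ‖a • m‖ ≤ C * ‖a‖ * ‖m‖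

namespace BanMod

variable {c : BanKind} {A : Type u} [NormedCommRing A]

instance : CoeSort (BanMod c A) (Type u) := ⟨BanMod.carrier⟩

attribute [instance] BanMod.grp BanMod.complete BanMod.mod BanMod.obj

/-- Morphisms of `Mod_c(A)`: bounded `A`-linear homomorphisms. -/
@[ext]
structure Hom (M N : BanMod c A) where
  lin : M →ₗ[A] N
  bdd : ∃ C : ℝ, ∀ x, ‖lin x‖ ≤ C * ‖x‖

theorem exists_nonneg_bound {M N : Type*} [SeminormedAddCommGroup M] [Norm N] {f : M → N}
    (h : ∃ C : ℝ, ∀ x, ‖f x‖ ≤ C * ‖x‖) : ∃ C : ℝ, 0 ≤ C ∧ ∀ x, ‖f x‖ ≤ C * ‖x‖ := by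
  obtain ⟨C, hC⟩ := h
  exact ⟨max C 0, le_max_right _ _, fun x => (hC x).trans
    (mul_le_mul_of_nonneg_right (le_max_left _ _) (norm_nonneg _))⟩

theorem exists_smul_bound (M : BanMod c A) :
    ∃ C : ℝ, 0 ≤ C ∧ ∀ (a : A) (m : M), ‖a • m‖ ≤ C * ‖a‖ * ‖m‖ := by
  obtain ⟨C, hC⟩ := M.smul_bdd
  refine ⟨max C 0, le_max_right _ _, fun a m => (hC a m).trans ?_⟩
  gcongr
  exact le_max_left _ _

instance : Category.{u} (BanMod c A) where
  Hom M N := Hom M N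
  id M := ⟨LinearMap.id, 1, fun x => by simp⟩
  comp f g := ⟨g.lin.comp f.lin, by
    obtain ⟨C, hC⟩ := f.bdd
    obtain ⟨D, hD0, hD⟩ := exists_nonneg_bound g.bdd
    refine ⟨D * C, fun x => (hD _).trans ?_⟩
    rw [mul_assoc]
    exact mul_le_mul_of_nonneg_left (hC x) hD0⟩

@[ext]
theorem hom_ext {M N : BanMod c A} {f g : M ⟶ N} (h : ∀ x, f.lin x = g.lin x) : f = g :=
  Hom.ext (LinearMap.ext h)

@[simp] theorem id_lin (M : BanMod c A) (x : M) : (𝟙 M : M ⟶ M).lin x = x := rfl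

@[simp] theorem comp_lin {M N P : BanMod c A} (f : M ⟶ N) (g : N ⟶ P) (x : M) :
    (f ≫ g).lin x = g.lin (f.lin x) := rfl

section

variable {M N : BanMod c A}

theorem Hom.continuous (f : M ⟶ N) : Continuous f.lin := by
  obtain ⟨C, hC⟩ := f.bdd
  exact AddMonoidHomClass.continuous_of_bound f.lin C hC

instance : Zero (M ⟶ N) := ⟨⟨0, 0, fun x => by simp⟩⟩
instance : Add (M ⟶ N) := ⟨fun f g => ⟨f.lin + g.lin, by
  obtain ⟨C, hC⟩ := f.bdd
  obtain ⟨D, hD⟩ := g.bdd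
  exact ⟨C + D, fun x => (norm_add_le _ _).trans (by rw [add_mul]; exact add_le_add (hC x) (hD x))⟩⟩⟩
instance : Neg (M ⟶ N) := ⟨fun f => ⟨-f.lin, by
  obtain ⟨C, hC⟩ := f.bdd
  exact ⟨C, fun x => by simpa using hC x⟩⟩⟩

@[simp] theorem zero_lin (x : M) : (0 : M ⟶ N).lin x = 0 := rfl
@[simp] theorem add_lin (f g : M ⟶ N) (x : M) : (f + g).lin x = f.lin x + g.lin x := rfl
@[simp] theorem neg_lin (f : M ⟶ N) (x : M) : (-f).lin x = -f.lin x := rfl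

instance : AddCommGroup (M ⟶ N) where
  add_assoc f g h := by ext x; simp [add_assoc]
  zero_add f := by ext x; simp
  add_zero f := by ext x; simp
  add_comm f g := by ext x; simp [add_comm]
  neg_add_cancel f := by ext x; simp
  nsmul := nsmulRec
  zsmul := zsmulRec

instance : Preadditive (BanMod c A) where
  add_comp _ _ _ f f' g := by ext x; simp
  comp_add _ _ _ f g g' := by ext x; simp

/-- The evaluation of morphisms at an element is additive. -/
def evalHom (x : M) : (M ⟶ N) →+ N where
  toFun f := f.lin x
  map_zero' := rfl
  map_add' _ _ := rfl

@[simp] theorem sum_lin {ι : Type*} (s : Finset ι) (f : ι → (M ⟶ N)) (x : M) :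
    (∑ i ∈ s, f i).lin x = ∑ i ∈ s, (f i).lin x :=
  map_sum (evalHom x) f s

@[simp] theorem zsmul_lin (n : ℤ) (f : M ⟶ N) (x : M) : (n • f).lin x = n • f.lin x :=
  map_zsmul (evalHom x) n f

/-- The product of a finite family of Banach modules, with the supremum norm. -/
def pi {ι : Type} [Fintype ι] (M : ι → BanMod c A) : BanMod c A where
  carrier := ∀ i, M i
  obj := ⟨fun h => by
    have := fun i => (M i).obj.ultra h
    infer_instance⟩
  smul_bdd := by
    choose C hC0 hC using fun i => (M i).exists_smul_bound
    refine ⟨∑ i, C i, fun a m => ?_⟩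
    have h0 : 0 ≤ ∑ i, C i := Finset.sum_nonneg fun i _ => hC0 i
    refine (pi_norm_le_iff_of_nonneg (by positivity)).2 fun i => (hC i a (m i)).trans ?_
    gcongr
    · exact Finset.single_le_sum (f := C) (fun i _ => hC0 i) (Finset.mem_univ i)
    · exact norm_le_pi_norm m i

/-- The projections of a finite product. -/
def proj {ι : Type} [Fintype ι] (M : ι → BanMod c A) (i : ι) : pi M ⟶ M i :=
  ⟨LinearMap.proj i, 1, fun x => by rw [one_mul]; exact norm_le_pi_norm (show ∀ i, M i from x) i⟩

/-- The morphism to a finite product with given components. -/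
def piLift {ι : Type} [Fintype ι] {M : ι → BanMod c A} (f : ∀ i, N ⟶ M i) : N ⟶ pi M :=
  ⟨LinearMap.pi fun i => (f i).lin, by
    choose C hC0 hC using fun i => exists_nonneg_bound (f i).bdd
    have h0 : 0 ≤ ∑ i, C i := Finset.sum_nonneg fun i _ => hC0 i
    refine ⟨∑ i, C i, fun x => (pi_norm_le_iff_of_nonneg (by positivity)).2 fun i =>
      (hC i x).trans ?_⟩
    gcongr
    exact Finset.single_le_sum (f := C) (fun i _ => hC0 i) (Finset.mem_univ i)⟩

@[simp] theorem proj_lin {ι : Type} [Fintype ι] (M : ι → BanMod c A) (i : ι) (x : pi M) :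
    (proj M i).lin x = (show ∀ i, M i from x) i := rfl

@[simp]
theorem piLift_proj {ι : Type} [Fintype ι] {M : ι → BanMod c A} (f : ∀ i, N ⟶ M i) (i : ι) :
    piLift f ≫ proj M i = f i := rfl

theorem pi_hom_ext {ι : Type} [Fintype ι] {M : ι → BanMod c A} {f g : N ⟶ pi M}
    (h : ∀ i, f ≫ proj M i = g ≫ proj M i) : f = g := by
  ext x
  funext i
  exact congrArg (fun k : N ⟶ M i => k.lin x) (h i)

end

/-- The zero Banach module. -/
def zero (c : BanKind) (A : Type u) [NormedCommRing A] : BanMod c A where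
  carrier := PUnit
  obj := ⟨fun _ => ⟨fun _ _ _ => by simp⟩⟩
  smul_bdd := ⟨0, fun a m => by simp⟩

theorem isZero_of_subsingleton (M : BanMod c A) [Subsingleton M] : IsZero M := by
  rw [IsZero.iff_id_eq_zero]
  ext x
  exact Subsingleton.elim _ _

instance : HasZeroObject (BanMod c A) :=
  ⟨zero c A, by
    have : Subsingleton (zero c A) := inferInstanceAs (Subsingleton PUnit)
    exact isZero_of_subsingleton _⟩

/-- The direct sum of two Banach modules, with the supremum norm. -/
def prod (M N : BanMod c A) : BanMod c A where
  carrier := M × N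
  obj := ⟨fun h => by
    have := M.obj.ultra h
    have := N.obj.ultra h
    refine ⟨fun x y z => ?_⟩
    simp only [Prod.dist_eq]
    refine max_le ?_ ?_
    · exact (dist_triangle_max x.1 y.1 z.1).trans (max_le_max (le_max_left _ _) (le_max_left _ _))
    · exact (dist_triangle_max x.2 y.2 z.2).trans (max_le_max (le_max_right _ _) (le_max_right _ _))⟩
  smul_bdd := by
    obtain ⟨C, hC0, hC⟩ := M.exists_smul_bound
    obtain ⟨D, hD0, hD⟩ := N.exists_smul_bound
    refine ⟨C + D, fun a m => ?_⟩
    rw [Prod.norm_def]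
    refine max_le ((hC a m.1).trans ?_) ((hD a m.2).trans ?_)
    · gcongr
      · linarith
      · exact norm_fst_le m
    · gcongr
      · linarith
      · exact norm_snd_le m

instance : HasBinaryBiproducts (BanMod c A) where
  has_binary_biproduct M N := HasBinaryBiproduct.mk
    { bicone :=
        { pt := prod M N
          fst := ⟨LinearMap.fst A M N, 1, fun x => by
            rw [one_mul]; exact norm_fst_le (show M × N from x)⟩
          snd := ⟨LinearMap.snd A M N, 1, fun x => by
            rw [one_mul]; exact norm_snd_le (show M × N from x)⟩
          inl := ⟨LinearMap.inl A M N, 1, fun x => by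
            rw [one_mul]; exact (Prod.norm_mk x (0 : N)).trans_le (by simp)⟩
          inr := ⟨LinearMap.inr A M N, 1, fun x => by
            rw [one_mul]; exact (Prod.norm_mk (0 : M) x).trans_le (by simp)⟩
          inl_fst := rfl
          inl_snd := rfl
          inr_fst := rfl
          inr_snd := rfl }
      isBilimit := isBinaryBilimitOfTotal _ (by
        ext x
        exact Prod.ext (add_zero _) (zero_add _)) }


/-! ### Completions of seminormed modules -/

/-- An `A`-module `V` with a seminorm which is compatible with the action of `A`, and which is
non-Archimedean if `c` is. -/
structure ModSeminorm (c : BanKind) (A : Type u) [NormedCommRing A] (V : Type u) [AddCommGroup V]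
    [Module A V] where
  toFun : V → ℝ
  map_zero : toFun 0 = 0
  add_le : ∀ x y, toFun (x + y) ≤ toFun x + toFun y
  add_le_max : c = BanKind.nonarch → ∀ x y, toFun (x + y) ≤ max (toFun x) (toFun y)
  map_neg : ∀ x, toFun (-x) = toFun x
  smul_le : ∀ (a : A) x, toFun (a • x) ≤ ‖a‖ * toFun x

/-- The module `V`, regarded as a seminormed group by means of `p`. -/
def ModSeminorm.Space {V : Type u} [AddCommGroup V] [Module A V] (_p : ModSeminorm c A V) :
    Type u := V

section completion

variable {V : Type u} [AddCommGroup V] [Module A V] (p : ModSeminorm c A V)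

instance : SeminormedAddCommGroup p.Space :=
  letI : AddCommGroup p.Space := inferInstanceAs (AddCommGroup V)
  AddGroupSeminorm.toSeminormedAddCommGroup
    { toFun := p.toFun
      map_zero' := p.map_zero
      add_le' := p.add_le
      neg' := p.map_neg }

instance : Module A p.Space := inferInstanceAs (Module A V)

theorem norm_space (x : p.Space) : ‖x‖ = p.toFun x := rfl

instance : IsBoundedSMul A p.Space :=
  IsBoundedSMul.of_norm_smul_le fun a x => p.smul_le a x

theorem completion_norm_smul_le (a : A) (x : UniformSpace.Completion p.Space) :
    ‖a • x‖ ≤ ‖a‖ * ‖x‖ := by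
  induction x using UniformSpace.Completion.induction_on with
  | hp =>
    exact isClosed_le (continuous_norm.comp (continuous_const_smul a))
      (continuous_const.mul continuous_norm)
  | ih x =>
    rw [← UniformSpace.Completion.coe_smul, UniformSpace.Completion.norm_coe,
      UniformSpace.Completion.norm_coe]
    exact p.smul_le a x

/-- The (Hausdorff) completion of a seminormed module. -/
noncomputable def completion : BanMod c A where
  carrier := UniformSpace.Completion p.Space
  obj := ⟨fun h => by
    refine IsUltrametricDist.isUltrametricDist_of_forall_norm_add_le_max_norm fun x y => ?_
    induction x, y using UniformSpace.Completion.induction_on₂ with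
    | hp => exact isClosed_le (by fun_prop) (by fun_prop)
    | ih x y =>
      rw [← UniformSpace.Completion.coe_add]
      simp only [UniformSpace.Completion.norm_coe]
      exact p.add_le_max h x y⟩
  smul_bdd := ⟨1, fun a x => by rw [one_mul]; exact completion_norm_smul_le p a x⟩

/-- The canonical map to the completion. -/
noncomputable def completionMk : V →ₗ[A] completion p where
  toFun v := ((show p.Space from v : p.Space) : UniformSpace.Completion p.Space)
  map_add' x y := UniformSpace.Completion.coe_add (α := p.Space) x y
  map_smul' a x := UniformSpace.Completion.coe_smul (X := p.Space) a x

theorem norm_completionMk (v : V) : ‖completionMk p v‖ = p.toFun v :=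
  UniformSpace.Completion.norm_coe (E := p.Space) v

theorem completion_hom_ext {p : ModSeminorm c A V} {N : BanMod c A} {f g : completion p ⟶ N}
    (h : ∀ v, f.lin (completionMk p v) = g.lin (completionMk p v)) : f = g := by
  ext x
  exact UniformSpace.Completion.induction_on (α := p.Space) x
    (isClosed_eq (Hom.continuous f) (Hom.continuous g)) h

/-- The extension to the completion of a bounded linear map with values in a Banach module. -/
noncomputable def completionLift {p : ModSeminorm c A V} {N : BanMod c A} (f : V →ₗ[A] N)
    (hf : ∃ C : ℝ, ∀ v, ‖f v‖ ≤ C * p.toFun v) : completion p ⟶ N := by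
  let g : NormedAddGroupHom p.Space N :=
    ⟨fun v => f v, fun x y => f.map_add x y, hf⟩
  have hg (x : p.Space) : g.extension (x : UniformSpace.Completion p.Space) = f x :=
    NormedAddGroupHom.extension_coe g x
  exact
    ⟨{ toFun := g.extension
       map_add' := g.extension.map_add'
       map_smul' := fun a x => by
        obtain ⟨C, hC⟩ := N.smul_bdd
        have hcont : Continuous fun y : N => a • y :=
          AddMonoidHomClass.continuous_of_bound (DistribSMul.toAddMonoidHom N a) (C * ‖a‖)
            fun y => hC a y
        refine UniformSpace.Completion.induction_on (α := p.Space) x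
          (isClosed_eq (g.extension.continuous.comp
            (continuous_const_smul (T := UniformSpace.Completion p.Space) a))
            (hcont.comp g.extension.continuous)) fun x => ?_
        have := hg (a • x)
        rw [UniformSpace.Completion.coe_smul] at this
        exact this.trans ((f.map_smul a x).trans (congrArg (a • ·) (hg x).symm)) },
      g.extension.bound'⟩

@[simp] theorem completionLift_mk {p : ModSeminorm c A V} {N : BanMod c A} (f : V →ₗ[A] N)
    (hf : ∃ C : ℝ, ∀ v, ‖f v‖ ≤ C * p.toFun v) (v : V) :
    (completionLift f hf).lin (completionMk p v) = f v :=
  NormedAddGroupHom.extension_coe (G := p.Space) _ v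

end completion

/-! ### Completed tensor products -/

section tensor

variable {ι : Type} [Fintype ι]

/-- The way norms are combined in finite sums: by addition for Banach groups in general, and by
taking the maximum in the non-Archimedean setting. -/
def combine : BanKind → List ℝ → ℝ
  | .arch, l => l.sum
  | .nonarch, l => l.foldr max 0

theorem combine_nonneg (c : BanKind) (l : List ℝ) (h : ∀ r ∈ l, 0 ≤ r) : 0 ≤ combine c l := by
  cases c with
  | arch => exact List.sum_nonneg h
  | nonarch =>
    cases l with
    | nil => exact le_rfl
    | cons r l => exact (h r (by simp)).trans (le_max_left _ _)

theorem combine_append_le (c : BanKind) (l l' : List ℝ) (h : ∀ r ∈ l, 0 ≤ r)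
    (h' : ∀ r ∈ l', 0 ≤ r) : combine c (l ++ l') ≤ combine c l + combine c l' := by
  cases c with
  | arch => simp [combine]
  | nonarch =>
    induction l with
    | nil => simp [combine]
    | cons r l ih =>
      have ih := ih fun x hx => h x (by simp [hx])
      have h1 := combine_nonneg .nonarch l' h'
      simp only [combine, List.cons_append, List.foldr_cons] at ih h1 ⊢
      refine max_le ?_ (ih.trans ?_)
      · linarith [le_max_left r (List.foldr max 0 l)]
      · linarith [le_max_right r (List.foldr max 0 l)]

theorem combine_append_le_max (l l' : List ℝ) :
    combine .nonarch (l ++ l') ≤ max (combine .nonarch l) (combine .nonarch l') := by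
  induction l with
  | nil => simp [combine]
  | cons r l ih =>
    simp only [combine, List.cons_append, List.foldr_cons] at ih ⊢
    rw [max_assoc]
    exact max_le_max le_rfl ih

theorem combine_mul (c : BanKind) (a : ℝ) (ha : 0 ≤ a) (l : List ℝ) :
    combine c (l.map (a * ·)) = a * combine c l := by
  cases c with
  | arch => exact List.sum_map_mul_left l (fun x => x) a |>.trans (by simp [combine])
  | nonarch =>
    induction l with
    | nil => simp [combine]
    | cons r l ih =>
      simp only [combine, List.map_cons, List.foldr_cons] at ih ⊢
      rw [ih, mul_max_of_nonneg _ _ ha]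

theorem norm_list_sum_le {X : Type*} (N : BanMod c A) (l : List X) (f : X → N) (r : X → ℝ)
    (D : ℝ) (h : ∀ x ∈ l, ‖f x‖ ≤ D * r x) (hD : 0 ≤ D) :
    ‖(l.map f).sum‖ ≤ D * combine c (l.map r) := by
  induction l with
  | nil => cases c <;> simp [combine]
  | cons x l ih =>
    have ih := ih fun y hy => h y (by simp [hy])
    have hx := h x (by simp)
    simp only [List.map_cons, List.sum_cons]
    cases c with
    | arch =>
      simp only [combine, List.sum_cons, mul_add] at ih ⊢
      exact (norm_add_le _ _).trans (add_le_add hx ih)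
    | nonarch =>
      have := N.obj.ultra rfl
      simp only [combine, List.foldr_cons] at ih ⊢
      rw [mul_max_of_nonneg _ _ hD]
      exact (IsUltrametricDist.norm_add_le_max _ _).trans (max_le_max hx ih)

variable (M : ι → BanMod c A)

open scoped TensorProduct

/-- The size of the formal expression `∑ₖ aₖ • (⨂ᵢ mₖᵢ)`. -/
noncomputable def tensorCost (l : List (A × ∀ i, M i)) : ℝ :=
  combine c (l.map fun x => ‖x.1‖ * ∏ i, ‖x.2 i‖)

/-- The expressions `∑ₖ aₖ • (⨂ᵢ mₖᵢ)` of a given tensor. -/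
abbrev TensorRep (t : ⨂[A] i, M i) : Type u :=
  {l : List (A × ∀ i, M i) // (l.map fun x => x.1 • PiTensorProduct.tprod A x.2).sum = t}

instance (t : ⨂[A] i, M i) : Nonempty (TensorRep M t) := by
  obtain ⟨p, hp⟩ := PiTensorProduct.nonempty_lifts t
  exact ⟨p.toList, (PiTensorProduct.mem_lifts_iff t p).1 hp⟩

theorem tensorCost_nonneg (l : List (A × ∀ i, M i)) : 0 ≤ tensorCost M l := by
  refine combine_nonneg _ _ fun r hr => ?_
  obtain ⟨x, -, rfl⟩ := List.mem_map.1 hr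
  positivity

/-- The tensor seminorm: the infimum of the sizes of all expressions of a given tensor. -/
noncomputable def tensorNorm (t : ⨂[A] i, M i) : ℝ := ⨅ l : TensorRep M t, tensorCost M l.1

theorem tensorNorm_le {t : ⨂[A] i, M i} (l : List (A × ∀ i, M i))
    (h : (l.map fun x => x.1 • PiTensorProduct.tprod A x.2).sum = t) :
    tensorNorm M t ≤ tensorCost M l :=
  ciInf_le (f := fun l : TensorRep M t => tensorCost M l.1)
    ⟨0, by rintro _ ⟨l, rfl⟩; exact tensorCost_nonneg M l.1⟩ ⟨l, h⟩

theorem exists_tensorRep_lt (t : ⨂[A] i, M i) {ε : ℝ} (hε : 0 < ε) :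
    ∃ l : List (A × ∀ i, M i), (l.map fun x => x.1 • PiTensorProduct.tprod A x.2).sum = t ∧
      tensorCost M l < tensorNorm M t + ε := by
  obtain ⟨l, hl⟩ := exists_lt_of_ciInf_lt (lt_add_of_pos_right (tensorNorm M t) hε)
  exact ⟨l.1, l.2, hl⟩

theorem tensorNorm_nonneg (t : ⨂[A] i, M i) : 0 ≤ tensorNorm M t :=
  le_ciInf fun l => tensorCost_nonneg M l.1

theorem tensorNorm_smul_le (a : A) (t : ⨂[A] i, M i) :
    tensorNorm M (a • t) ≤ ‖a‖ * tensorNorm M t := by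
  rw [tensorNorm, tensorNorm, Real.mul_iInf_of_nonneg (norm_nonneg _)]
  refine le_ciInf fun l => ?_
  refine (tensorNorm_le M (l.1.map fun x => (a * x.1, x.2)) ?_).trans ?_
  · refine Eq.trans ?_ (congrArg (a • ·) l.2)
    simp [List.smul_sum, List.map_map, Function.comp_def, mul_smul]
  · rw [tensorCost, tensorCost, ← combine_mul _ _ (norm_nonneg _), List.map_map, List.map_map]
    have key : ∀ l : List (A × ∀ i, M i),
        combine c (l.map fun x => ‖a * x.1‖ * ∏ i, ‖x.2 i‖) ≤
        combine c (l.map fun x => ‖a‖ * (‖x.1‖ * ∏ i, ‖x.2 i‖)) := by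
      intro l
      have hx (x : A × ∀ i, M i) :
          ‖a * x.1‖ * ∏ i, ‖x.2 i‖ ≤ ‖a‖ * (‖x.1‖ * ∏ i, ‖x.2 i‖) := by
        rw [← mul_assoc]
        gcongr
        exact norm_mul_le _ _
      cases c with
      | arch => exact List.sum_le_sum fun x _ => hx x
      | nonarch =>
        induction l with
        | nil => exact le_rfl
        | cons x l ih => exact max_le_max (hx x) ih
    exact key l.1

/-- The tensor seminorm on the algebraic tensor product of a finite family of Banach modules. -/
noncomputable def tensorSeminorm : ModSeminorm c A (⨂[A] i, M i) where
  toFun := tensorNorm M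
  map_zero := le_antisymm
    ((tensorNorm_le M [] (by simp)).trans (by cases c <;> simp [tensorCost, combine]))
    (tensorNorm_nonneg M 0)
  add_le x y := by
    refine le_of_forall_pos_le_add fun ε hε => ?_
    obtain ⟨l, hl, hl'⟩ := exists_tensorRep_lt M x (half_pos hε)
    obtain ⟨k, hk, hk'⟩ := exists_tensorRep_lt M y (half_pos hε)
    refine (tensorNorm_le M (l ++ k) (by simp [hl, hk])).trans ?_
    have : tensorCost M (l ++ k) ≤ tensorCost M l + tensorCost M k := by
      rw [tensorCost, List.map_append]
      refine combine_append_le _ _ _ ?_ ?_ <;>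
      · intro r hr
        obtain ⟨x, -, rfl⟩ := List.mem_map.1 hr
        positivity
    linarith
  add_le_max hc x y := by
    refine le_of_forall_pos_le_add fun ε hε => ?_
    obtain ⟨l, hl, hl'⟩ := exists_tensorRep_lt M x hε
    obtain ⟨k, hk, hk'⟩ := exists_tensorRep_lt M y hε
    refine (tensorNorm_le M (l ++ k) (by simp [hl, hk])).trans ?_
    have : tensorCost M (l ++ k) ≤ max (tensorCost M l) (tensorCost M k) := by
      subst hc
      rw [tensorCost, List.map_append]
      exact combine_append_le_max _ _
    rw [max_add]
    exact this.trans (max_le_max hl'.le hk'.le)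
  map_neg x := by
    have h (y : ⨂[A] i, M i) : tensorNorm M (-y) ≤ tensorNorm M y := by
      refine le_ciInf fun l => (tensorNorm_le M (l.1.map fun x => (-x.1, x.2)) ?_).trans ?_
      · refine Eq.trans ?_ (congrArg (- ·) l.2)
        simp [List.sum_neg, List.map_map, Function.comp_def]
      · simp [tensorCost, Function.comp_def]
    exact le_antisymm (h x) (by simpa using h (-x))
  smul_le := tensorNorm_smul_le M

/-- The completed tensor product over `A` of a finite family of Banach `A`-modules. For the empty
family this is `A`, and for a family with one member it is that member (up to isomorphism). -/
noncomputable def tensor : BanMod c A := completion (tensorSeminorm M)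

variable {M} {N : BanMod c A}

/-- Pure tensors. -/
noncomputable def tmk (m : ∀ i, M i) : tensor M :=
  completionMk (tensorSeminorm M) (PiTensorProduct.tprod A m)

theorem tensor_hom_ext {f g : tensor M ⟶ N} (h : ∀ m, f.lin (tmk m) = g.lin (tmk m)) : f = g := by
  refine completion_hom_ext fun v => ?_
  have : f.lin.comp (completionMk (tensorSeminorm M)) =
      g.lin.comp (completionMk (tensorSeminorm M)) := by
    ext m
    exact h m
  exact LinearMap.congr_fun this v

/-- The morphism induced by a bounded multilinear map. -/
noncomputable def tensorLift (f : MultilinearMap A (fun i => M i) N)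
    (hf : ∃ C : ℝ, ∀ m, ‖f m‖ ≤ C * ∏ i, ‖m i‖) : tensor M ⟶ N :=
  completionLift (PiTensorProduct.lift f) (by
    obtain ⟨C, hC⟩ := hf
    obtain ⟨D, hD0, hD⟩ := N.exists_smul_bound
    have hC' (m : ∀ i, M i) : ‖f m‖ ≤ max C 0 * ∏ i, ‖m i‖ :=
      (hC m).trans (mul_le_mul_of_nonneg_right (le_max_left _ _)
        (Finset.prod_nonneg fun i _ => norm_nonneg _))
    have hE : 0 ≤ D * max C 0 := mul_nonneg hD0 (le_max_right _ _)
    refine ⟨D * max C 0, fun t => ?_⟩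
    change _ ≤ _ * tensorNorm M t
    rw [tensorNorm, Real.mul_iInf_of_nonneg hE]
    refine le_ciInf fun l => ?_
    have := norm_list_sum_le N l.1 (fun x => x.1 • f x.2) (fun x => ‖x.1‖ * ∏ i, ‖x.2 i‖)
      (D * max C 0) (fun x _ => by
        refine (hD x.1 (f x.2)).trans ?_
        calc D * ‖x.1‖ * ‖f x.2‖ ≤ D * ‖x.1‖ * (max C 0 * ∏ i, ‖x.2 i‖) := by
              gcongr
              exact hC' x.2
          _ = _ := by ring) hE
    refine le_of_eq_of_le (congrArg norm ?_) this
    refine (congrArg (PiTensorProduct.lift f) l.2).symm.trans ?_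
    rw [map_list_sum, List.map_map]
    simp [Function.comp_def])

@[simp] theorem tensorLift_tmk (f : MultilinearMap A (fun i => M i) N)
    (hf : ∃ C : ℝ, ∀ m, ‖f m‖ ≤ C * ∏ i, ‖m i‖) (m : ∀ i, M i) :
    (tensorLift f hf).lin (tmk m) = f m := by
  exact (completionLift_mk _ _ _).trans (PiTensorProduct.lift.tprod m)

theorem norm_tmk_le (m : ∀ i, M i) : ‖tmk m‖ ≤ ‖(1 : A)‖ * ∏ i, ‖m i‖ := by
  refine (norm_completionMk (tensorSeminorm M) (PiTensorProduct.tprod A m)).trans_le ?_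
  refine (tensorNorm_le M [(1, m)] (by simp)).trans ?_
  have : 0 ≤ ‖(1 : A)‖ * ∏ i, ‖m i‖ := by positivity
  cases c <;> simp [tensorCost, combine, this]

variable (M) in
/-- The universal multilinear map. -/
noncomputable def tmkMultilinear : MultilinearMap A (fun i => M i) (tensor M) :=
  (completionMk (tensorSeminorm M)).compMultilinearMap (PiTensorProduct.tprod A)

theorem tmkMultilinear_apply (m : ∀ i, M i) : tmkMultilinear M m = tmk m := rfl

/-- Functoriality of the completed tensor product. -/
noncomputable def tensorMap {M' : ι → BanMod c A} (f : ∀ i, M i ⟶ M' i) : tensor M ⟶ tensor M' :=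
  tensorLift ((tmkMultilinear M').compLinearMap fun i => (f i).lin) (by
    choose C hC0 hC using fun i => exists_nonneg_bound (f i).bdd
    refine ⟨‖(1 : A)‖ * ∏ i, C i, fun m => (norm_tmk_le _).trans ?_⟩
    rw [mul_assoc, ← Finset.prod_mul_distrib]
    gcongr with i
    exact hC i (m i))

@[simp] theorem tensorMap_tmk {M' : ι → BanMod c A} (f : ∀ i, M i ⟶ M' i) (m : ∀ i, M i) :
    (tensorMap f).lin (tmk m) = tmk fun i => (f i).lin (m i) := by
  rw [tensorMap, tensorLift_tmk]
  rfl

theorem tensorMap_comp {M' M'' : ι → BanMod c A} (f : ∀ i, M i ⟶ M' i) (g : ∀ i, M' i ⟶ M'' i) :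
    tensorMap f ≫ tensorMap g = tensorMap fun i => f i ≫ g i :=
  tensor_hom_ext fun m => by simp

theorem tmk_eq_zero {m : ∀ i, M i} (i : ι) (h : m i = 0) : tmk m = 0 :=
  (tmkMultilinear M).map_coord_zero i h

theorem tensorMap_eq_zero {M' : ι → BanMod c A} (f : ∀ i, M i ⟶ M' i) (i : ι) (h : f i = 0) :
    tensorMap f = 0 :=
  tensor_hom_ext fun m => by
    rw [tensorMap_tmk, tmk_eq_zero i (by rw [h]; rfl)]
    rfl

end tensor

/-! ### Free Banach modules on normed sets and functorial projective resolutions -/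

section free

open scoped NNReal

variable {X : Type u} (w : X → ℝ≥0)

/-- The norm on the algebraic direct sum over `x : X` of copies of `A` rescaled by `w x`: the
`ℓ¹`-norm, respectively the supremum norm in the non-Archimedean setting. -/
noncomputable def freeNorm (c : BanKind) (f : X →₀ A) : ℝ≥0 :=
  match c with
  | .arch => ∑ x ∈ f.support, ‖f x‖₊ * w x
  | .nonarch => f.support.sup fun x => ‖f x‖₊ * w x

theorem freeNorm_arch {f : X →₀ A} {s : Finset X} (h : f.support ⊆ s) :
    freeNorm w .arch f = ∑ x ∈ s, ‖f x‖₊ * w x :=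
  Finset.sum_subset h fun x _ hx => by simp [Finsupp.notMem_support_iff.1 hx]

theorem freeNorm_nonarch_le {f : X →₀ A} {r : ℝ≥0} :
    freeNorm w .nonarch f ≤ r ↔ ∀ x, ‖f x‖₊ * w x ≤ r := by
  refine Finset.sup_le_iff.trans ⟨fun h x => ?_, fun h x _ => h x⟩
  by_cases hx : x ∈ f.support
  · exact h x hx
  · simp [Finsupp.notMem_support_iff.1 hx]

theorem le_freeNorm_nonarch (f : X →₀ A) (x : X) : ‖f x‖₊ * w x ≤ freeNorm w .nonarch f :=
  (freeNorm_nonarch_le w).1 le_rfl x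

variable (c A) in
/-- `freeNorm` as a seminorm. Note that the copies of `A` with `w x = 0` die in the
Hausdorff completion. -/
noncomputable def freeSeminorm [IsBanObj c A] : ModSeminorm c A (X →₀ A) where
  toFun f := freeNorm w c f
  map_zero := by cases c <;> simp [freeNorm]
  add_le f g := by
    classical
    norm_cast
    cases c with
    | arch =>
      rw [freeNorm_arch w (Finsupp.support_add (g₁ := f) (g₂ := g)),
        freeNorm_arch w (Finset.subset_union_left (s₂ := g.support)),
        freeNorm_arch w (Finset.subset_union_right (s₁ := f.support)), ← Finset.sum_add_distrib]
      refine Finset.sum_le_sum fun x _ => ?_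
      rw [← add_mul]
      exact mul_le_mul_left (nnnorm_add_le _ _) _
    | nonarch =>
      refine (freeNorm_nonarch_le w).2 fun x => ?_
      refine (mul_le_mul_left (nnnorm_add_le (f x) (g x)) (w x)).trans ?_
      rw [add_mul]
      exact add_le_add (le_freeNorm_nonarch w f x) (le_freeNorm_nonarch w g x)
  add_le_max hc f g := by
    subst hc
    have := IsBanObj.ultra (c := BanKind.nonarch) (M := A) rfl
    norm_cast
    refine (freeNorm_nonarch_le w).2 fun x => ?_
    have h : ‖f x + g x‖₊ ≤ max ‖f x‖₊ ‖g x‖₊ := IsUltrametricDist.nnnorm_add_le_max _ _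
    refine (mul_le_mul_left h (w x)).trans ?_
    rw [max_mul]
    exact max_le_max (le_freeNorm_nonarch w f x) (le_freeNorm_nonarch w g x)
  map_neg f := by cases c <;> simp [freeNorm]
  smul_le a f := by
    rw [← coe_nnnorm]
    norm_cast
    cases c with
    | arch =>
      rw [freeNorm_arch w (Finsupp.support_smul (b := a) (g := f)),
        freeNorm_arch w (Finset.Subset.refl f.support), Finset.mul_sum]
      refine Finset.sum_le_sum fun x _ => ?_
      rw [← mul_assoc]
      exact mul_le_mul_left (nnnorm_mul_le _ _) _
    | nonarch =>
      refine (freeNorm_nonarch_le w).2 fun x => ?_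
      refine (mul_le_mul_left (nnnorm_mul_le a (f x)) (w x)).trans ?_
      rw [mul_assoc]
      exact mul_le_mul_right (le_freeNorm_nonarch w f x) _

variable [IsBanObj c A]

variable (c A) in
/-- The free Banach module `ℓ(X, A)` on the normed set `(X, w)`: the completion of the algebraic
direct sum of the rescaled modules `A_{w x}`. -/
noncomputable def free : BanMod c A := completion (freeSeminorm c A w)

variable (c A) in
/-- The basis vector of the free Banach module which belongs to an element of `X`. -/
noncomputable def freeSingle (x : X) : free c A w :=
  completionMk (freeSeminorm c A w) (Finsupp.single x 1)

/-- The morphism from a free Banach module given by a bounded map `(X, w) → N`. -/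
noncomputable def freeLift {w : X → ℝ≥0} {N : BanMod c A} (g : X → N)
    (hg : ∃ C : ℝ, ∀ x, ‖g x‖ ≤ C * w x) : free c A w ⟶ N :=
  completionLift (Finsupp.linearCombination A g) (by
    obtain ⟨C, hC⟩ := hg
    obtain ⟨D, hD0, hD⟩ := N.exists_smul_bound
    have hE : 0 ≤ D * max C 0 := mul_nonneg hD0 (le_max_right _ _)
    have hx (f : X →₀ A) (x : X) : ‖f x • g x‖ ≤ D * max C 0 * (‖f x‖₊ * w x : ℝ≥0) := by
      refine (hD _ _).trans ?_
      have : ‖g x‖ ≤ max C 0 * w x :=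
        (hC x).trans (mul_le_mul_of_nonneg_right (le_max_left _ _) (w x).2)
      calc D * ‖f x‖ * ‖g x‖ ≤ D * ‖f x‖ * (max C 0 * w x) := by gcongr
        _ = _ := by push_cast; ring
    refine ⟨D * max C 0, fun f => ?_⟩
    change ‖∑ x ∈ f.support, f x • g x‖ ≤ _ * (freeNorm w c f : ℝ)
    cases c with
    | arch =>
      refine (norm_sum_le _ _).trans ?_
      rw [freeNorm]
      push_cast
      rw [Finset.mul_sum]
      exact Finset.sum_le_sum fun x _ => by simpa using hx f x
    | nonarch =>
      have := N.obj.ultra rfl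
      refine IsUltrametricDist.norm_sum_le_of_forall_le_of_nonneg (by positivity) fun x _ => ?_
      refine (hx f x).trans (mul_le_mul_of_nonneg_left ?_ hE)
      exact_mod_cast le_freeNorm_nonarch w f x)

@[simp] theorem freeLift_single {w : X → ℝ≥0} {N : BanMod c A} (g : X → N)
    (hg : ∃ C : ℝ, ∀ x, ‖g x‖ ≤ C * w x) (x : X) :
    (freeLift g hg).lin (freeSingle c A w x) = g x :=
  (completionLift_mk _ _ _).trans (by simp)

/-- The free Banach module on the normed set underlying a Banach module. -/
noncomputable def freeOn (M : BanMod c A) : BanMod c A := free c A fun m : M => ‖m‖₊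

/-- The counit `ℓ(M, A) → M`. -/
noncomputable def counit (M : BanMod c A) : freeOn M ⟶ M :=
  freeLift (fun m => m) ⟨1, fun m => by simp⟩

end free

section kernel

/-- The kernel of a morphism. -/
def ker {M N : BanMod c A} (f : M ⟶ N) : BanMod c A where
  carrier := LinearMap.ker f.lin
  complete := (isClosed_eq (Hom.continuous f) continuous_const).completeSpace_coe
  obj := ⟨fun h => by
    have := M.obj.ultra h
    exact inferInstanceAs (IsUltrametricDist {x : M // x ∈ LinearMap.ker f.lin})⟩
  smul_bdd := by
    obtain ⟨C, hC⟩ := M.smul_bdd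
    exact ⟨C, fun a m => hC a m.1⟩

/-- The inclusion of the kernel. -/
def kerι {M N : BanMod c A} (f : M ⟶ N) : ker f ⟶ M :=
  ⟨(LinearMap.ker f.lin).subtype, 1, fun x => by rw [one_mul]; exact le_rfl⟩

theorem kerι_comp {M N : BanMod c A} (f : M ⟶ N) : kerι f ≫ f = 0 := by
  ext x
  exact x.2

end kernel

section resolution

variable [IsBanObj c A]

/-- The projection from a free Banach module to the kernel of `f`, followed by the inclusion. -/
noncomputable def coverKer {M N : BanMod c A} (f : M ⟶ N) : freeOn (ker f) ⟶ M :=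
  counit (ker f) ≫ kerι f

theorem coverKer_comp {M N : BanMod c A} (f : M ⟶ N) : coverKer f ≫ f = 0 := by
  rw [coverKer, Category.assoc, kerι_comp, comp_zero]

/-- The functorial projective resolution `P(M)` of `M`, without the augmentation: `P(M)₀` is
`ℓ(M, A)`, `P(M)₁` is `ℓ(ker (P(M)₀ → M), A)`, and `P(M)ₙ₊₂` is `ℓ(ker (P(M)ₙ₊₁ → P(M)ₙ), A)`. -/
noncomputable def resolution (M : BanMod c A) : ChainComplex (BanMod c A) ℕ :=
  ChainComplex.mk' (freeOn M) (freeOn (ker (counit M))) (coverKer (counit M))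
    fun f => ⟨freeOn (ker f), coverKer f, coverKer_comp f⟩

/-- The augmentation `P(M)₀ → M`. -/
noncomputable def augmentation (M : BanMod c A) : (resolution M).X 0 ⟶ M := counit M

theorem resolution_d_augmentation (M : BanMod c A) :
    (resolution M).d 1 0 ≫ augmentation M = 0 := by
  have h : (resolution M).d 1 0 = coverKer (counit M) := ChainComplex.mk'_d_1_0 _ _ _ _
  rw [h]
  exact coverKer_comp _

/-- The element of `P(M)₀` which lifts `m : M` in the tautological way. -/
noncomputable def resolutionLift (M : BanMod c A) (m : M) : (resolution M).X 0 :=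
  freeSingle c A (fun m : M => ‖m‖₊) m

end resolution

/-! ### The total complex of the tensor product of a finite family of chain complexes -/

section tensorTot

/-- The multi-indices of total degree `n`. -/
abbrev TotIdx (ι : Type) [Fintype ι] (n : ℕ) : Type := {q : ι → ℕ // ∑ i, q i = n}

noncomputable instance (ι : Type) [Fintype ι] (n : ℕ) : Fintype (TotIdx ι n) := by
  classical
  exact Fintype.subtype (Finset.piAntidiag Finset.univ n) fun q => by simp

variable {ι : Type} [Fintype ι] (K : ι → ChainComplex (BanMod c A) ℕ)

/-- The completed tensor product of the components of multi-degree `q`. -/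
noncomputable abbrev tensorAt (q : ι → ℕ) : BanMod c A := tensor fun i => (K i).X (q i)

/-- The component of degree `n` of the total complex. -/
noncomputable abbrev totX (n : ℕ) : BanMod c A := pi fun q : TotIdx ι n => tensorAt K q.1

/-- The projection to the component of multi-degree `q` (zero if `q` is not of degree `n`). -/
noncomputable def totProj (n : ℕ) (q : ι → ℕ) : totX K n ⟶ tensorAt K q :=
  if h : ∑ i, q i = n then proj (fun q : TotIdx ι n => tensorAt K q.1) ⟨q, h⟩ else 0

theorem totProj_eq {n : ℕ} (q : TotIdx ι n) :
    proj (fun q : TotIdx ι n => tensorAt K q.1) q = totProj K n q.1 := by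
  rw [totProj, dif_pos q.2]

theorem tot_hom_ext {N : BanMod c A} {n : ℕ} {f g : N ⟶ totX K n}
    (h : ∀ q : TotIdx ι n, f ≫ totProj K n q.1 = g ≫ totProj K n q.1) : f = g :=
  pi_hom_ext fun q => by rw [totProj_eq]; exact h q

/-- The identity of `L.X a` if `a = b`, and zero otherwise. -/
noncomputable def idOrZero (L : ChainComplex (BanMod c A) ℕ) (a b : ℕ) : L.X a ⟶ L.X b :=
  if h : a = b then eqToHom (congrArg L.X h) else 0

theorem idOrZero_self (L : ChainComplex (BanMod c A) ℕ) (a : ℕ) : idOrZero L a a = 𝟙 _ := by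
  simp [idOrZero]

theorem idOrZero_comp_d (L : ChainComplex (BanMod c A) ℕ) {a b : ℕ} (h : a = b) (k : ℕ) :
    idOrZero L a b ≫ L.d b k = L.d a k := by
  subst h
  rw [idOrZero_self, Category.id_comp]

theorem d_comp_idOrZero (L : ChainComplex (BanMod c A) ℕ) {a b : ℕ} (h : a = b) (k : ℕ) :
    L.d k a ≫ idOrZero L a b = L.d k b := by
  subst h
  rw [idOrZero_self, Category.comp_id]

variable [LinearOrder ι]

/-- The multi-index `q` increased by one at `i`. -/
def bump (q : ι → ℕ) (i : ι) : ι → ℕ := Function.update q i (q i + 1)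

@[simp] theorem bump_self (q : ι → ℕ) (i : ι) : bump q i i = q i + 1 := by simp [bump]

theorem bump_ne (q : ι → ℕ) {i j : ι} (h : j ≠ i) : bump q i j = q j := by simp [bump, h]

theorem sum_bump (q : ι → ℕ) (i : ι) : ∑ j, bump q i j = ∑ j, q j + 1 := by
  have h : bump q i = q + Pi.single i 1 := by
    funext j
    by_cases hj : j = i
    · subst hj; simp
    · simp [bump_ne q hj, hj]
  rw [h]
  simp [Finset.sum_add_distrib]

theorem bump_comm (q : ι → ℕ) {i k : ι} (h : i ≠ k) : bump (bump q i) k = bump (bump q k) i := by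
  funext j
  by_cases hj : j = i
  · subst hj; rw [bump_ne _ h, bump_self, bump_self, bump_ne _ h]
  · by_cases hk : j = k
    · subst hk; rw [bump_self, bump_ne _ h.symm, bump_ne _ h.symm, bump_self]
    · rw [bump_ne _ hk, bump_ne _ hj, bump_ne _ hj, bump_ne _ hk]

/-- The tensor product of the differential in the factor `i` and of the identities in the other
factors, as a map from multi-degree `q'` to multi-degree `q`. -/
noncomputable def tensorD (i : ι) (q' q : ι → ℕ) : tensorAt K q' ⟶ tensorAt K q :=
  tensorMap fun j => if j = i then (K j).d (q' j) (q j) else idOrZero (K j) (q' j) (q j)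

theorem tensorD_sq (i : ι) (q'' q' q : ι → ℕ) : tensorD K i q'' q' ≫ tensorD K i q' q = 0 := by
  rw [tensorD, tensorD, tensorMap_comp]
  exact tensorMap_eq_zero _ i (by simp)

theorem tensorD_comm {i k : ι} (h : i ≠ k) (q r : ι → ℕ) (hr : r = bump (bump q i) k) :
    tensorD K k r (bump q i) ≫ tensorD K i (bump q i) q =
      tensorD K i r (bump q k) ≫ tensorD K k (bump q k) q := by
  simp only [tensorD, tensorMap_comp]
  congr 1
  funext j
  by_cases hi : j = i
  · subst hi
    have h1 : r j = bump q j j := by rw [hr, bump_ne _ h]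
    simp only [h, if_true, if_false]
    rw [idOrZero_comp_d _ h1, d_comp_idOrZero _ (bump_ne q h)]
  · by_cases hk : j = k
    · subst hk
      have h1 : r j = bump q j j := by rw [hr, bump_comm _ h, bump_ne _ h.symm]
      simp only [h.symm, if_true, if_false]
      rw [idOrZero_comp_d _ h1, d_comp_idOrZero _ (bump_ne q h.symm)]
    · have h1 : r j = q j := by rw [hr, bump_ne _ hk, bump_ne _ hi]
      have h2 : bump q i j = q j := bump_ne _ hi
      have h3 : bump q k j = q j := bump_ne _ hk
      simp only [hi, hk, if_false]
      rw [h1, h2, h3]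

/-- The Koszul sign of the differential in the factor `i` at multi-degree `q`. -/
def koszulSign (q : ι → ℕ) (i : ι) : ℤ := (-1) ^ ∑ j with j < i, q j

theorem koszulSign_bump_of_le (q : ι → ℕ) {i k : ι} (h : k ≤ i) :
    koszulSign (bump q i) k = koszulSign q k := by
  rw [koszulSign, koszulSign]
  congr 1
  refine Finset.sum_congr rfl fun j hj => bump_ne _ ?_
  exact (lt_of_lt_of_le (Finset.mem_filter.1 hj).2 h).ne

theorem koszulSign_bump_of_lt (q : ι → ℕ) {i k : ι} (h : i < k) :
    koszulSign (bump q i) k = -koszulSign q k := by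
  have hi : i ∈ Finset.univ.filter (· < k) := by simp [h]
  rw [koszulSign, koszulSign, ← Finset.add_sum_erase _ _ hi, ← Finset.add_sum_erase _ q hi,
    bump_self, Finset.sum_congr rfl fun j hj => bump_ne q (Finset.ne_of_mem_erase hj)]
  ring

/-- The differential of the total complex. -/
noncomputable def totD (n : ℕ) : totX K (n + 1) ⟶ totX K n :=
  piLift fun q => ∑ i, koszulSign q.1 i • (totProj K (n + 1) (bump q.1 i) ≫
    tensorD K i (bump q.1 i) q.1)

theorem totD_proj (n : ℕ) (q : ι → ℕ) :
    totD K n ≫ totProj K n q =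
      ∑ i, koszulSign q i • (totProj K (n + 1) (bump q i) ≫ tensorD K i (bump q i) q) := by
  by_cases h : ∑ i, q i = n
  · have := totProj_eq K (n := n) ⟨q, h⟩
    rw [← this, totD, piLift_proj]
  · rw [totProj, dif_neg h, comp_zero]
    refine (Finset.sum_eq_zero fun i _ => ?_).symm
    rw [totProj, dif_neg (by rw [sum_bump]; omega), zero_comp, smul_zero]

theorem totD_sq (n : ℕ) : totD K (n + 1) ≫ totD K n = 0 := by
  refine tot_hom_ext K fun q => ?_
  rw [Category.assoc, totD_proj, zero_comp, Preadditive.comp_sum]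
  simp only [Preadditive.comp_zsmul, ← Category.assoc, totD_proj, Preadditive.sum_comp,
    Preadditive.zsmul_comp, Finset.smul_sum]
  rw [← Finset.sum_product']
  refine Finset.sum_involution (fun x _ => (x.2, x.1)) ?_ ?_ (by simp) (by simp)
  · rintro ⟨i, k⟩ -
    dsimp only
    by_cases h : i = k
    · subst h
      simp only [Category.assoc, tensorD_sq, comp_zero, smul_zero, add_zero]
    · have key : (totProj K (n + 1 + 1) (bump (bump q.1 i) k) ≫
            tensorD K k (bump (bump q.1 i) k) (bump q.1 i)) ≫ tensorD K i (bump q.1 i) q.1 =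
          (totProj K (n + 1 + 1) (bump (bump q.1 k) i) ≫
            tensorD K i (bump (bump q.1 k) i) (bump q.1 k)) ≫ tensorD K k (bump q.1 k) q.1 := by
        rw [Category.assoc, Category.assoc, tensorD_comm K h q.1 _ rfl, bump_comm q.1 h]
      rw [key, smul_smul, smul_smul, ← add_smul]
      rcases lt_or_gt_of_ne h with h | h
      · rw [koszulSign_bump_of_lt _ h, koszulSign_bump_of_le _ h.le]
        ring_nf
        simp
      · rw [koszulSign_bump_of_le _ h.le, koszulSign_bump_of_lt _ h]
        ring_nf
        simp
  · rintro ⟨i, k⟩ - hne heq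
    obtain rfl : k = i := congrArg Prod.fst heq
    exact hne (by simp only [Category.assoc, tensorD_sq, comp_zero, smul_zero])

/-- The total complex of the completed tensor product of a finite family of chain complexes. -/
noncomputable def tensorTot : ChainComplex (BanMod c A) ℕ :=
  ChainComplex.of (totX K) (totD K) (totD_sq K)

theorem tensorTot_d (n : ℕ) : (tensorTot K).d (n + 1) n = totD K n :=
  ChainComplex.of_d (totX K) (totD K) n

end tensorTot

/-! ### Insertion of distinguished elements into tensor products -/

section insertion

variable {I : Type} {s t v : Finset I}

section

variable [DecidableEq I]

/-- The family indexed by `t` which extends a family indexed by `s` by distinguished elements. -/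
def extendFamily (hst : s ⊆ t) {M : t → BanMod c A} (e : ∀ i, M i)
    (m : ∀ i : s, M ⟨i.1, hst i.2⟩) (i : t) : M i :=
  if h : i.1 ∈ s then m ⟨i.1, h⟩ else e i

theorem extendFamily_update (hst : s ⊆ t) {M : t → BanMod c A} (e : ∀ i, M i)
    [DecidableEq s] [DecidableEq t]
    (m : ∀ i : s, M ⟨i.1, hst i.2⟩) (i : s) (x : M ⟨i.1, hst i.2⟩) :
    extendFamily hst e (Function.update m i x) =
      Function.update (extendFamily hst e m) ⟨i.1, hst i.2⟩ x := by
  funext j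
  by_cases hj : j = ⟨i.1, hst i.2⟩
  · subst hj
    simp [extendFamily]
  · rw [Function.update_of_ne hj]
    unfold extendFamily
    by_cases h : j.1 ∈ s
    · rw [dif_pos h, dif_pos h, Function.update_of_ne]
      rintro rfl
      exact hj rfl
    · rw [dif_neg h, dif_neg h]

theorem prod_norm_extendFamily (hst : s ⊆ t) {M : t → BanMod c A} (e : ∀ i, M i)
    (m : ∀ i : s, M ⟨i.1, hst i.2⟩) :
    ∏ i, ‖extendFamily hst e m i‖ ≤
      (∏ i : t, if i.1 ∈ s then 1 else ‖e i‖) * ∏ i, ‖m i‖ := by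
  have h : ∏ i, ‖m i‖ = ∏ i : t, if h : i.1 ∈ s then ‖m ⟨i.1, h⟩‖ else 1 := by
    refine Fintype.prod_of_injective (fun i : s => (⟨i.1, hst i.2⟩ : t)) ?_ _ _ ?_ ?_
    · intro i j hij
      exact Subtype.ext (congrArg (fun k : t => k.1) hij)
    · intro i hi
      rw [dif_neg fun h => hi ⟨⟨i.1, h⟩, rfl⟩]
    · intro i
      rw [dif_pos i.2]
  rw [h, ← Finset.prod_mul_distrib]
  refine (Finset.prod_congr rfl fun i _ => ?_).le
  unfold extendFamily
  by_cases h : i.1 ∈ s <;> simp [h]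

/-- The morphism `⨂_{i ∈ s} Mᵢ → ⨂_{i ∈ t} Mᵢ` which inserts the element `eᵢ` in the factors with
`i ∉ s`. -/
noncomputable def tensorIns (hst : s ⊆ t) {M : t → BanMod c A} (e : ∀ i, M i) :
    tensor (fun i : s => M ⟨i.1, hst i.2⟩) ⟶ tensor M :=
  tensorLift
    { toFun := fun m => tmk (extendFamily hst e m)
      map_update_add' := fun m i x y => by
        classical
        simp only [extendFamily_update, ← tmkMultilinear_apply]
        rw [MultilinearMap.map_update_add]
      map_update_smul' := fun m i a x => by
        classical
        simp only [extendFamily_update, ← tmkMultilinear_apply]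
        rw [MultilinearMap.map_update_smul] }
    ⟨‖(1 : A)‖ * ∏ i : t, if i.1 ∈ s then 1 else ‖e i‖, fun m => by
      refine (norm_tmk_le _).trans ?_
      rw [mul_assoc]
      exact mul_le_mul_of_nonneg_left (prod_norm_extendFamily hst e m) (norm_nonneg _)⟩

@[simp] theorem tensorIns_tmk (hst : s ⊆ t) {M : t → BanMod c A} (e : ∀ i, M i)
    (m : ∀ i : s, M ⟨i.1, hst i.2⟩) :
    (tensorIns hst e).lin (tmk m) = tmk (extendFamily hst e m) :=
  tensorLift_tmk _ _ m

theorem tensorIns_eq_zero (hst : s ⊆ t) {M : t → BanMod c A} (e : ∀ i, M i) (i : t)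
    (hi : i.1 ∉ s) (h : e i = 0) : tensorIns hst e = 0 :=
  tensor_hom_ext fun m => by
    rw [tensorIns_tmk]
    exact tmk_eq_zero i (by rw [extendFamily, dif_neg hi, h])

theorem tensorIns_refl {M : t → BanMod c A} (e : ∀ i, M i) :
    tensorIns (Finset.Subset.refl t) e = 𝟙 (tensor M) :=
  tensor_hom_ext fun m => by
    rw [tensorIns_tmk]
    have h : extendFamily (Finset.Subset.refl t) e m = m := by
      funext i
      rw [extendFamily, dif_pos i.2]
    rw [h]
    rfl

theorem tensorIns_comp (hst : s ⊆ t) (htv : t ⊆ v) {M : v → BanMod c A} (e : ∀ i, M i) :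
    tensorIns hst (M := fun i : t => M ⟨i.1, htv i.2⟩) (fun i => e ⟨i.1, htv i.2⟩) ≫
      tensorIns htv e = tensorIns (hst.trans htv) e :=
  tensor_hom_ext fun m => by
    rw [comp_lin, tensorIns_tmk]
    refine (tensorIns_tmk htv e _).trans ((congrArg tmk ?_).trans
      (tensorIns_tmk (hst.trans htv) e m).symm)
    funext i
    unfold extendFamily
    by_cases h : i.1 ∈ s
    · simp only [dif_pos (hst h), dif_pos h]
    · by_cases h' : i.1 ∈ t
      · simp only [dif_pos h', dif_neg h]
      · simp only [dif_neg h', dif_neg h]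

theorem tensorIns_naturality (hst : s ⊆ t) {M M' : t → BanMod c A} (e : ∀ i, M i)
    (e' : ∀ i, M' i) (f : ∀ i, M i ⟶ M' i)
    (g : ∀ i : s, M ⟨i.1, hst i.2⟩ ⟶ M' ⟨i.1, hst i.2⟩) (hfg : ∀ i, g i = f ⟨i.1, hst i.2⟩)
    (he : ∀ i : t, i.1 ∉ s → (f i).lin (e i) = e' i) :
    tensorMap g ≫ tensorIns hst e' = tensorIns hst e ≫ tensorMap f :=
  tensor_hom_ext fun m => by
    rw [comp_lin, comp_lin, tensorMap_tmk, tensorIns_tmk, tensorIns_tmk, tensorMap_tmk]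
    congr 1
    funext i
    unfold extendFamily
    by_cases h : i.1 ∈ s
    · simp only [dif_pos h, hfg]
    · simp only [dif_neg h, he i h]

end

variable [LinearOrder I] (K : I → ChainComplex (BanMod c A) ℕ) (e : ∀ i, (K i).X 0)

/-- The total complex of the tensor product of the complexes `K i` with `i ∈ s`. -/
noncomputable abbrev tensorTotOn (s : Finset I) : ChainComplex (BanMod c A) ℕ :=
  tensorTot fun i : s => K i

/-- The elements `eᵢ` in degree zero, extended by zero to the other degrees. -/
def unitAt (i : I) : ∀ k, (K i).X k
  | 0 => e i
  | _ + 1 => 0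

theorem unitAt_eq_zero (i : I) {k : ℕ} (hk : k ≠ 0) : unitAt K e i k = 0 := by
  cases k with
  | zero => exact (hk rfl).elim
  | succ k => rfl

/-- Insertion of the elements `eᵢ` on total complexes, in degree `n`. -/
noncomputable def totIns (hst : s ⊆ t) (n : ℕ) :
    totX (fun i : s => K i) n ⟶ totX (fun i : t => K i) n :=
  piLift fun q => totProj (fun i : s => K i) n (fun i => q.1 ⟨i.1, hst i.2⟩) ≫
    tensorIns hst (M := fun i : t => (K i).X (q.1 i)) fun i => unitAt K e i (q.1 i)

theorem totIns_proj (hst : s ⊆ t) (n : ℕ) (q : t → ℕ) :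
    totIns K e hst n ≫ totProj (fun i : t => K i) n q =
      totProj (fun i : s => K i) n (fun i => q ⟨i.1, hst i.2⟩) ≫
        tensorIns hst (M := fun i : t => (K i).X (q i)) fun i => unitAt K e i (q i) := by
  by_cases h : ∑ i, q i = n
  · have := totProj_eq (fun i : t => K i) (n := n) ⟨q, h⟩
    rw [← this, totIns, piLift_proj]
  · rw [totProj, dif_neg h, comp_zero]
    by_cases h' : ∃ i : t, i.1 ∉ s ∧ q i ≠ 0
    · obtain ⟨i, hi, hq⟩ := h'
      rw [tensorIns_eq_zero hst _ i hi (unitAt_eq_zero K e i hq), comp_zero]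
    · push Not at h'
      have hsum : ∑ i : s, q ⟨i.1, hst i.2⟩ = ∑ i, q i :=
        Fintype.sum_of_injective (fun i : s => (⟨i.1, hst i.2⟩ : t))
          (fun i j hij => Subtype.ext (congrArg (fun k : t => k.1) hij)) _ _
          (fun i hi => h' i fun his => hi ⟨⟨i.1, his⟩, rfl⟩) fun i => rfl
      rw [totProj, dif_neg (by rw [hsum]; exact h), zero_comp]

theorem totIns_comm (hst : s ⊆ t) (n : ℕ) :
    totIns K e hst (n + 1) ≫ totD (fun i : t => K i) n =
      totD (fun i : s => K i) n ≫ totIns K e hst n := by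
  refine tot_hom_ext _ fun q => ?_
  obtain ⟨q, -⟩ := q
  dsimp only
  rw [Category.assoc, Category.assoc, totD_proj, totIns_proj, ← Category.assoc, totD_proj,
    Preadditive.comp_sum, Preadditive.sum_comp]
  simp only [Preadditive.comp_zsmul, ← Category.assoc, totIns_proj, Preadditive.zsmul_comp]
  simp only [Category.assoc]
  by_cases h' : ∃ i : t, i.1 ∉ s ∧ q i ≠ 0
  · obtain ⟨j, hj, hq⟩ := h'
    rw [tensorIns_eq_zero hst _ j hj (unitAt_eq_zero K e j hq)]
    simp only [comp_zero, smul_zero, Finset.sum_const_zero]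
    refine Finset.sum_eq_zero fun i _ => ?_
    have hb : bump q i j ≠ 0 := by
      by_cases hij : j = i
      · subst hij; simp
      · rwa [bump_ne _ hij]
    rw [tensorIns_eq_zero hst _ j hj (unitAt_eq_zero K e j hb), zero_comp, comp_zero, smul_zero]
  · push Not at h'
    symm
    refine Fintype.sum_of_injective (fun i : s => (⟨i.1, hst i.2⟩ : t))
      (fun i j hij => Subtype.ext (congrArg (fun k : t => k.1) hij)) _ _ ?_ ?_
    · intro i hi
      have his : i.1 ∉ s := fun his => hi ⟨⟨i.1, his⟩, rfl⟩
      rw [tensorIns_eq_zero hst _ i his (unitAt_eq_zero K e i (by simp)), zero_comp, comp_zero,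
        smul_zero]
    · intro i
      have hb : (fun j : s => bump q ⟨i.1, hst i.2⟩ ⟨j.1, hst j.2⟩) =
          bump (fun j : s => q ⟨j.1, hst j.2⟩) i := by
        funext j
        by_cases hj : j = i
        · subst hj; simp
        · rw [bump_ne _ hj, bump_ne]
          intro h
          exact hj (Subtype.ext (congrArg (fun k : t => k.1) h))
      have hsign : koszulSign (fun j : s => q ⟨j.1, hst j.2⟩) i =
          koszulSign q ⟨i.1, hst i.2⟩ := by
        rw [koszulSign, koszulSign]
        congr 1
        rw [Finset.sum_filter, Finset.sum_filter]
        refine Fintype.sum_of_injective (fun i : s => (⟨i.1, hst i.2⟩ : t))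
          (fun i j hij => Subtype.ext (congrArg (fun k : t => k.1) hij)) _ _ ?_ fun j => rfl
        intro j hj
        rw [h' j fun hjs => hj ⟨⟨j.1, hjs⟩, rfl⟩, ite_self]
      rw [hsign]
      congr 1
      have key : ∀ r : s → ℕ, ∀ hr : r = fun j : s => bump q ⟨i.1, hst i.2⟩ ⟨j.1, hst j.2⟩,
          totProj (fun i : s => K i) (n + 1) r ≫
            tensorD (fun i : s => K i) i r (fun j => q ⟨j.1, hst j.2⟩) ≫
              tensorIns hst (M := fun i : t => (K i).X (q i)) (fun i => unitAt K e i (q i)) =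
          totProj (fun i : s => K i) (n + 1)
              (fun j : s => bump q ⟨i.1, hst i.2⟩ ⟨j.1, hst j.2⟩) ≫
            tensorIns hst (M := fun j : t => (K j).X (bump q ⟨i.1, hst i.2⟩ j))
              (fun j => unitAt K e j (bump q ⟨i.1, hst i.2⟩ j)) ≫
              tensorD (fun i : t => K i) ⟨i.1, hst i.2⟩ (bump q ⟨i.1, hst i.2⟩) q := by
        rintro r rfl
        congr 1
        refine tensorIns_naturality hst (M := fun j : t => (K j).X (bump q ⟨i.1, hst i.2⟩ j))
          (M' := fun j : t => (K j).X (q j)) _ _ _ _ ?_ ?_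
        · intro j
          by_cases hj : j = i
          · subst hj
            simp
          · have hj' : (⟨j.1, hst j.2⟩ : t) ≠ ⟨i.1, hst i.2⟩ := fun h =>
              hj (Subtype.ext (congrArg (fun k : t => k.1) h))
            rw [if_neg hj, if_neg hj']
        · intro j hj
          have hji : j ≠ ⟨i.1, hst i.2⟩ := by
            rintro rfl
            exact hj i.2
          rw [if_neg hji]
          have hbj : bump q ⟨i.1, hst i.2⟩ j = q j := bump_ne _ hji
          rw [hbj, idOrZero_self]
          rfl
      exact key _ hb.symm

/-- Insertion of the elements `eᵢ`, as a morphism of complexes. -/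
noncomputable def tensorTotIns (hst : s ⊆ t) : tensorTotOn K s ⟶ tensorTotOn K t :=
  ChainComplex.ofHom (X := tensorTotOn K s) (Y := tensorTotOn K t) (totIns K e hst) fun n => by
    change totIns K e hst (n + 1) ≫ ChainComplex.of.d _ (totD fun i : t => K i) (n + 1) n =
      ChainComplex.of.d _ (totD fun i : s => K i) (n + 1) n ≫ totIns K e hst n
    rw [ChainComplex.of_d, ChainComplex.of_d]
    exact totIns_comm K e hst n

theorem tensorTotIns_refl : tensorTotIns K e (Finset.Subset.refl t) = 𝟙 _ := by
  ext1 n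
  refine tot_hom_ext _ fun q => ?_
  refine (totIns_proj K e _ n q.1).trans ?_
  rw [tensorIns_refl]
  exact (Category.comp_id _).trans (Category.id_comp _).symm

theorem tensorTotIns_comp (hst : s ⊆ t) (htv : t ⊆ v) :
    tensorTotIns K e hst ≫ tensorTotIns K e htv = tensorTotIns K e (hst.trans htv) := by
  ext1 n
  refine tot_hom_ext _ fun q => ?_
  change (totIns K e hst n ≫ totIns K e htv n) ≫ _ = totIns K e (hst.trans htv) n ≫ _
  rw [Category.assoc, totIns_proj, ← Category.assoc, totIns_proj, Category.assoc, totIns_proj]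
  congr 1
  exact tensorIns_comp hst htv (M := fun i : v => (K i).X (q.1 i)) fun i => unitAt K e i (q.1 i)

/-- The diagram `s ↦ Tot (⨂_{i ∈ s} Kᵢ)` of complexes, indexed by the finite subsets of `I`. -/
noncomputable def tensorTotFunctor : Finset I ⥤ ChainComplex (BanMod c A) ℕ where
  obj s := tensorTotOn K s
  map f := tensorTotIns K e (leOfHom f)
  map_id _ := tensorTotIns_refl K e
  map_comp f g := (tensorTotIns_comp K e (leOfHom f) (leOfHom g)).symm

/-- The diagram `s ↦ ⨂_{i ∈ s} Mᵢ` of Banach modules, indexed by the finite subsets of `I`; the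
transition morphisms insert the given elements of the modules `Mᵢ`. -/
noncomputable def tensorFunctor (M : I → BanMod c A) (e : ∀ i, M i) : Finset I ⥤ BanMod c A where
  obj s := tensor fun i : s => M i
  map {s t} f := tensorIns (s := s) (t := t) (leOfHom f) (M := fun i : t => M i) fun i => e i
  map_id s := tensorIns_refl (t := s) (M := fun i : s => M i) fun i => e i
  map_comp {s t v} f g := (tensorIns_comp (s := s) (t := t) (v := v) (leOfHom f) (leOfHom g)
    (M := fun i : v => M i) fun i => e i).symm

end insertion

/-! ### The augmented alternating Čech complex of a cubical diagram -/

section cech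

variable {m : ℕ}

/-- The sign of `i` in the alternating sum over the elements of `s`, taken in increasing order. -/
def cechSign (s : Finset (Fin m)) (i : Fin m) : ℤ := (-1) ^ (s.filter (· < i)).card

theorem cechSign_mul (s : Finset (Fin m)) {i j : Fin m} (hi : i ∈ s) (hj : j ∈ s) (h : i ≠ j) :
    cechSign s i * cechSign (s.erase i) j = -(cechSign s j * cechSign (s.erase j) i) := by
  wlog hij : i < j generalizing i j
  · rw [this hj hi h.symm (lt_of_le_of_ne (not_lt.1 hij) h.symm), neg_neg]
  have h1 : (s.erase j).filter (· < i) = s.filter (· < i) := by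
    ext k
    simp only [Finset.mem_filter, Finset.mem_erase]
    exact ⟨fun hk => ⟨hk.1.2, hk.2⟩, fun hk => ⟨⟨(hk.2.trans hij).ne, hk.1⟩, hk.2⟩⟩
  have h2 : (s.filter (· < j)).card = ((s.erase i).filter (· < j)).card + 1 := by
    rw [Finset.filter_erase]
    exact (Finset.card_erase_add_one (by simp [hi, hij])).symm
  rw [cechSign, cechSign, cechSign, cechSign, h1, h2]
  ring

/-- The cancellation on which `d ∘ d = 0` rests. -/
theorem cech_sum_eq_zero {G : Type*} [AddCommGroup G] (s : Finset (Fin m))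
    (a : Fin m → Fin m → G) (ha : ∀ i ∈ s, ∀ j ∈ s, i ≠ j → a i j = a j i) :
    ∑ i ∈ s, ∑ j ∈ s.erase i, (cechSign s i * cechSign (s.erase i) j) • a i j = 0 := by
  rw [Finset.sum_sigma']
  refine Finset.sum_involution (fun x _ => ⟨x.2, x.1⟩) ?_ ?_ ?_ ?_
  · rintro ⟨i, j⟩ hx
    simp only [Finset.mem_sigma, Finset.mem_erase] at hx
    rw [ha i hx.1 j hx.2.2 hx.2.1.symm, ← add_smul,
      cechSign_mul s hx.1 hx.2.2 hx.2.1.symm, neg_add_cancel, zero_smul]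
  · rintro ⟨i, j⟩ hx - h
    simp only [Finset.mem_sigma, Finset.mem_erase] at hx
    exact hx.2.1 (congrArg Sigma.fst h)
  · rintro ⟨i, j⟩ hx
    simp only [Finset.mem_sigma, Finset.mem_erase] at hx ⊢
    exact ⟨hx.2.2, hx.2.1.symm, hx.1⟩
  · rintro ⟨i, j⟩ -
    rfl

section nonderived

variable (F : Finset (Fin m) ⥤ BanMod c A)

/-- The component of degree `n` of the Čech complex: the product of the `F s` with `s` of
cardinality `n`. -/
noncomputable abbrev cechX (n : ℕ) : BanMod c A :=
  pi fun s : {s : Finset (Fin m) // s.card = n} => F.obj s.1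

/-- The projection to the component `s` (zero if `s` is not of cardinality `n`). -/
noncomputable def cechProj (n : ℕ) (s : Finset (Fin m)) : cechX F n ⟶ F.obj s :=
  if h : s.card = n then proj (fun s : {s : Finset (Fin m) // s.card = n} => F.obj s.1) ⟨s, h⟩
  else 0

theorem cechProj_eq {n : ℕ} (s : {s : Finset (Fin m) // s.card = n}) :
    proj (fun s : {s : Finset (Fin m) // s.card = n} => F.obj s.1) s = cechProj F n s.1 := by
  rw [cechProj, dif_pos s.2]

theorem cechProj_map {n : ℕ} {s s' t : Finset (Fin m)} (h : s = s') (f : s ⟶ t) (f' : s' ⟶ t) :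
    cechProj F n s ≫ F.map f = cechProj F n s' ≫ F.map f' := by
  subst h
  rw [Subsingleton.elim f f']

/-- The inclusion of `s` without `i` into `s`. -/
def eraseHom (s : Finset (Fin m)) (i : Fin m) : s.erase i ⟶ s := homOfLE (Finset.erase_subset i s)

/-- The differential of the Čech complex. -/
noncomputable def cechD (n : ℕ) : cechX F n ⟶ cechX F (n + 1) :=
  piLift fun s => ∑ i ∈ s.1, cechSign s.1 i • (cechProj F n (s.1.erase i) ≫ F.map (eraseHom s.1 i))

theorem cechD_proj (n : ℕ) (s : Finset (Fin m)) :
    cechD F n ≫ cechProj F (n + 1) s =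
      ∑ i ∈ s, cechSign s i • (cechProj F n (s.erase i) ≫ F.map (eraseHom s i)) := by
  by_cases h : s.card = n + 1
  · have := cechProj_eq F (n := n + 1) ⟨s, h⟩
    rw [← this, cechD, piLift_proj]
  · rw [cechProj, dif_neg h, comp_zero]
    refine (Finset.sum_eq_zero fun i hi => ?_).symm
    have := Finset.card_erase_add_one hi
    rw [cechProj, dif_neg (by omega), zero_comp, smul_zero]

theorem cechD_sq (n : ℕ) : cechD F n ≫ cechD F (n + 1) = 0 := by
  refine pi_hom_ext fun s => ?_
  rw [cechProj_eq, Category.assoc, cechD_proj, zero_comp, Preadditive.comp_sum]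
  simp only [Preadditive.comp_zsmul, ← Category.assoc, cechD_proj, Preadditive.sum_comp,
    Preadditive.zsmul_comp, Finset.smul_sum, smul_smul]
  refine cech_sum_eq_zero s.1 (fun i j => (cechProj F n ((s.1.erase i).erase j) ≫
    F.map (eraseHom (s.1.erase i) j)) ≫ F.map (eraseHom s.1 i)) fun i _ j _ _ => ?_
  rw [Category.assoc, Category.assoc, ← F.map_comp, ← F.map_comp]
  exact cechProj_map F Finset.erase_right_comm _ _

/-- The augmented alternating Čech complex of `F`:
`F ∅ → ∏_i F {i} → ∏_{i < j} F {i, j} → ⋯`. -/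
noncomputable def cechComplex : CochainComplex (BanMod c A) ℕ :=
  CochainComplex.of (cechX F) (cechD F) (cechD_sq F)

end nonderived

section derived

variable (F : Finset (Fin m) ⥤ ChainComplex (BanMod c A) ℕ)

/-- The indices of the components of degree `n` of the total complex: the Čech degree counts
positively, the chain degree negatively. -/
abbrev CechTotIdx (m : ℕ) (n : ℤ) : Type :=
  {x : Finset (Fin m) × ℕ // (x.1.card : ℤ) - x.2 = n}

noncomputable instance (m : ℕ) (n : ℤ) : Fintype (CechTotIdx m n) :=
  Fintype.ofInjective (fun x : CechTotIdx m n => x.1.1) fun x y h => by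
    obtain ⟨⟨s, k⟩, hx⟩ := x
    obtain ⟨⟨t, l⟩, hy⟩ := y
    dsimp only at h hx hy
    subst h
    obtain rfl : k = l := by omega
    rfl

/-- The component of degree `n` of the total complex of the Čech double complex. -/
noncomputable abbrev cechTotX (n : ℤ) : BanMod c A :=
  pi fun x : CechTotIdx m n => (F.obj x.1.1).X x.1.2

/-- The projection to the component `(s, k)` (zero if it is not of degree `n`). -/
noncomputable def cechTotProj (n : ℤ) (s : Finset (Fin m)) (k : ℕ) :
    cechTotX F n ⟶ (F.obj s).X k :=
  if h : (s.card : ℤ) - k = n then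
    proj (fun x : CechTotIdx m n => (F.obj x.1.1).X x.1.2) ⟨(s, k), h⟩
  else 0

theorem cechTotProj_eq {n : ℤ} (x : CechTotIdx m n) :
    proj (fun x : CechTotIdx m n => (F.obj x.1.1).X x.1.2) x = cechTotProj F n x.1.1 x.1.2 := by
  rw [cechTotProj, dif_pos x.2]

theorem cechTotProj_map {n : ℤ} {s s' t : Finset (Fin m)} (h : s = s') (f : s ⟶ t) (f' : s' ⟶ t)
    (k : ℕ) : cechTotProj F n s k ≫ (F.map f).f k = cechTotProj F n s' k ≫ (F.map f').f k := by
  subst h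
  rw [Subsingleton.elim f f']

/-- The component `(s, k)` of the differential of the total complex. -/
noncomputable def cechTotDAt (n : ℤ) (s : Finset (Fin m)) (k : ℕ) :
    cechTotX F n ⟶ (F.obj s).X k :=
  ((-1) ^ s.card : ℤ) • (cechTotProj F n s (k + 1) ≫ (F.obj s).d (k + 1) k) +
    ∑ i ∈ s, cechSign s i • (cechTotProj F n (s.erase i) k ≫ (F.map (eraseHom s i)).f k)

/-- The differential of the total complex. -/
noncomputable def cechTotD (n : ℤ) : cechTotX F n ⟶ cechTotX F (n + 1) :=
  piLift fun x => cechTotDAt F n x.1.1 x.1.2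

theorem cechTotD_proj (n : ℤ) (s : Finset (Fin m)) (k : ℕ) :
    cechTotD F n ≫ cechTotProj F (n + 1) s k = cechTotDAt F n s k := by
  by_cases h : (s.card : ℤ) - k = n + 1
  · have := cechTotProj_eq F (n := n + 1) ⟨(s, k), h⟩
    rw [← this, cechTotD, piLift_proj]
  · rw [cechTotProj, dif_neg h, comp_zero, cechTotDAt, cechTotProj,
      dif_neg (by push_cast; omega), zero_comp, smul_zero, zero_add]
    refine (Finset.sum_eq_zero fun i hi => ?_).symm
    have := Finset.card_erase_add_one hi
    rw [cechTotProj, dif_neg (by omega), zero_comp, smul_zero]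

theorem cechTotD_sq (n : ℤ) : cechTotD F n ≫ cechTotD F (n + 1) = 0 := by
  refine pi_hom_ext fun x => ?_
  obtain ⟨⟨s, k⟩, -⟩ := x
  rw [cechTotProj_eq, Category.assoc, cechTotD_proj, zero_comp]
  dsimp only
  rw [cechTotDAt, Preadditive.comp_add, Preadditive.comp_zsmul, ← Category.assoc, cechTotD_proj,
    Preadditive.comp_sum]
  simp only [Preadditive.comp_zsmul, ← Category.assoc, cechTotD_proj]
  simp only [cechTotDAt, Preadditive.add_comp, Preadditive.sum_comp, Preadditive.zsmul_comp,
    Category.assoc, HomologicalComplex.d_comp_d, comp_zero, smul_zero, zero_add, smul_add,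
    Finset.sum_add_distrib, Finset.smul_sum, smul_smul]
  have hh : ∑ i ∈ s, ∑ j ∈ s.erase i, (cechSign s i * cechSign (s.erase i) j) •
      (cechTotProj F n ((s.erase i).erase j) k ≫ (F.map (eraseHom (s.erase i) j)).f k ≫
        (F.map (eraseHom s i)).f k) = 0 := by
    refine cech_sum_eq_zero s (fun i j => cechTotProj F n ((s.erase i).erase j) k ≫
      (F.map (eraseHom (s.erase i) j)).f k ≫ (F.map (eraseHom s i)).f k) fun i _ j _ _ => ?_
    rw [← HomologicalComplex.comp_f, ← F.map_comp, ← HomologicalComplex.comp_f, ← F.map_comp]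
    exact cechTotProj_map F Finset.erase_right_comm _ _ k
  rw [hh, add_zero, ← Finset.sum_add_distrib]
  refine Finset.sum_eq_zero fun i hi => ?_
  rw [HomologicalComplex.Hom.comm, ← add_smul, ← Finset.card_erase_add_one hi]
  ring_nf
  simp

/-- The total complex of the augmented alternating Čech complex
`F ∅ → ∏_i F {i} → ∏_{i < j} F {i, j} → ⋯` of a diagram of chain complexes. -/
noncomputable def cechTotal : CochainComplex (BanMod c A) ℤ :=
  CochainComplex.of (cechTotX F) (cechTotD F) (cechTotD_sq F)

end derived

end cech

/-! ### Strict exactness and the derived category -/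

section strict

/-- A morphism is strict if the canonical morphism from its coimage `M / ker f` (with the quotient
norm) to its image, which is the closure of the range in these categories, is an isomorphism, i.e.
is bijective with bounded inverse. -/
def IsStrict {M N : BanMod c A} (f : M ⟶ N) : Prop :=
  ∃ C : ℝ, ∀ y ∈ closure (Set.range f.lin), ∃ x, f.lin x = y ∧ ‖x‖ ≤ C * ‖y‖

/-- Strict exactness of `M → N → P` at `N`: the image of `f` is the kernel of `g`, and `f` is
strict. -/
def StrictExactAt {M N P : BanMod c A} (f : M ⟶ N) (g : N ⟶ P) : Prop :=
  closure (Set.range f.lin) = {y | g.lin y = 0} ∧ IsStrict f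

/-- A complex is strictly exact if it is so at each of its terms. (At an end of the complex the
missing differential is to be read as zero, which is what `prev`, `next` amount to.) -/
def StrictExact {κ : Type*} {sh : ComplexShape κ} (K : HomologicalComplex (BanMod c A) sh) : Prop :=
  ∀ j, StrictExactAt (K.d (sh.prev j) j) (K.d j (sh.next j))

variable (c A)

/-- Complexes (indexed cohomologically by `ℤ`) which are bounded above. -/
def boundedAbove : ObjectProperty (CochainComplex (BanMod c A) ℤ) :=
  fun K => ∃ n : ℤ, ∀ i, n < i → IsZero (K.X i)

/-- The category `Ch⁻` of complexes of Banach `A`-modules which are bounded above. -/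
abbrev ChMinus := (boundedAbove c A).FullSubcategory

/-- The quasi-isomorphisms: the morphisms of complexes with strictly exact mapping cone. -/
def quasiIso : MorphismProperty (ChMinus c A) :=
  fun _ _ f => StrictExact (CochainComplex.mappingCone f.hom)

/-- The derived category `Der⁻` of Banach `A`-modules: the localisation of `Ch⁻` (and hence of its
homotopy category) at the quasi-isomorphisms. -/
abbrev DerMinus := (quasiIso c A).Localization

variable {c A}

/-- A chain complex in nonnegative degrees, as an object of `Ch⁻`. -/
noncomputable def toChMinus (K : ChainComplex (BanMod c A) ℕ) : ChMinus c A :=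
  ⟨K.extend ComplexShape.embeddingDownNat, 0, fun i hi =>
    CochainComplex.isZero_of_isStrictlyLE _ 0 i hi⟩

/-- A morphism of chain complexes in nonnegative degrees, as a morphism of `Ch⁻`. -/
noncomputable def toChMinusMap {K L : ChainComplex (BanMod c A) ℕ} (f : K ⟶ L) :
    toChMinus K ⟶ toChMinus L :=
  ObjectProperty.homMk (HomologicalComplex.extendMap f ComplexShape.embeddingDownNat)

end strict

end BanMod

/-! ### Banach algebras -/

/-- A Banach ring, apart from completeness: the multiplication is bounded (it need not be
submultiplicative). -/
class BanRing (B : Type u) extends Norm B, CommRing B, MetricSpace B where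
  dist_eq : ∀ x y : B, dist x y = ‖-x + y‖
  mul_bdd : ∃ C : ℝ, ∀ x y : B, ‖x * y‖ ≤ C * ‖x‖ * ‖y‖

instance BanRing.toNormedAddCommGroup {B : Type u} [h : BanRing B] : NormedAddCommGroup B :=
  { h with }

/-- A normed commutative ring is a Banach ring (apart from completeness). -/
abbrev BanRing.ofNormed (B : Type u) [h : NormedCommRing B] : BanRing B :=
  { h with
    dist_eq := h.dist_eq
    mul_bdd := ⟨1, fun x y => by rw [one_mul]; exact norm_mul_le x y⟩ }

/-- The objects of `Alg_c(A)`: Banach `A`-algebras. -/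
structure BanAlg (c : BanKind) (A : Type u) [NormedCommRing A] : Type (u + 1) where
  carrier : Type u
  [ring : BanRing carrier]
  [complete : CompleteSpace carrier]
  [alg : Algebra A carrier]
  [obj : IsBanObj c carrier]
  smul_bdd : ∃ C : ℝ, ∀ (a : A) (b : carrier), ‖a • b‖ ≤ C * ‖a‖ * ‖b‖

namespace BanAlg

variable {c : BanKind} {A : Type u} [NormedCommRing A]

instance : CoeSort (BanAlg c A) (Type u) := ⟨BanAlg.carrier⟩

attribute [instance] BanAlg.ring BanAlg.complete BanAlg.alg BanAlg.obj

/-- Morphisms of `Alg_c(A)`: bounded `A`-algebra homomorphisms. -/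
@[ext]
structure Hom (B D : BanAlg c A) where
  algHom : B →ₐ[A] D
  bdd : ∃ C : ℝ, ∀ x, ‖algHom x‖ ≤ C * ‖x‖

instance : Category.{u} (BanAlg c A) where
  Hom B D := Hom B D
  id B := ⟨AlgHom.id A B, 1, fun x => by simp⟩
  comp f g := ⟨g.algHom.comp f.algHom, by
    obtain ⟨C, hC⟩ := f.bdd
    obtain ⟨D, hD0, hD⟩ := BanMod.exists_nonneg_bound g.bdd
    refine ⟨D * C, fun x => (hD _).trans ?_⟩
    rw [mul_assoc]
    exact mul_le_mul_of_nonneg_left (hC x) hD0⟩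

/-- The Banach module underlying a Banach algebra. -/
def toMod (B : BanAlg c A) : BanMod c A where
  carrier := B
  smul_bdd := B.smul_bdd

section restriction

variable (R : Type u) [NormedCommRing R] [Algebra R A] [IsBoundedSMul R A]

theorem norm_algebraMap_le' (r : R) : ‖algebraMap R A r‖ ≤ ‖r‖ * ‖(1 : A)‖ := by
  rw [Algebra.algebraMap_eq_smul_one]
  exact norm_smul_le r 1

/-- The ring `A` itself, as an object of `Alg_c(R)`. -/
def base (c : BanKind) (A : Type u) [NormedCommRing A] [Algebra R A] [IsBoundedSMul R A]
    [CompleteSpace A] [IsBanObj c A] : BanAlg c R :=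
  letI : BanRing A := BanRing.ofNormed A
  { carrier := A
    smul_bdd := ⟨1, fun r a => by rw [one_mul]; exact norm_smul_le r a⟩ }

/-- Restriction of scalars `Alg_c(A) → Alg_c(R)`. -/
def restrict (B : BanAlg c A) : BanAlg c R :=
  letI : Algebra R B := ((algebraMap A B).comp (algebraMap R A)).toAlgebra
  { carrier := B
    smul_bdd := by
      obtain ⟨C, hC⟩ := B.smul_bdd
      refine ⟨max C 0 * ‖(1 : A)‖, fun r b => ?_⟩
      have h1 : r • b = algebraMap R A r • b := by
        rw [Algebra.smul_def, Algebra.smul_def]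
        rfl
      rw [h1]
      calc ‖algebraMap R A r • b‖ ≤ C * ‖algebraMap R A r‖ * ‖b‖ := hC _ b
        _ ≤ max C 0 * (‖r‖ * ‖(1 : A)‖) * ‖b‖ := by
          gcongr
          · exact le_max_left _ _
          · exact norm_algebraMap_le' R r
        _ = _ := by ring }

/-- The structure morphism `A → B` of a Banach `A`-algebra, as a morphism of `Alg_c(R)`. -/
def structureHom [CompleteSpace A] [IsBanObj c A] (B : BanAlg c A) :
    base R c A ⟶ B.restrict R :=
  ⟨{ (algebraMap A B : A →+* B) with commutes' := fun _ => rfl }, by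
    obtain ⟨C, hC⟩ := B.smul_bdd
    have h : ∀ a : A, ‖algebraMap A B a‖ ≤ C * ‖(1 : B)‖ * ‖a‖ := fun a => by
      rw [Algebra.algebraMap_eq_smul_one]
      exact (hC a 1).trans_eq (by ring)
    exact ⟨C * ‖(1 : B)‖, h⟩⟩

end restriction

variable (B : BanAlg c A)

/-- The multiplication `B ⊗ B → B` on the completed tensor product. -/
noncomputable def mulHom : BanMod.tensor (fun _ : Fin 2 => B.toMod) ⟶ B.toMod :=
  BanMod.tensorLift (M := fun _ : Fin 2 => B.toMod) (N := B.toMod)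
    (MultilinearMap.mkPiAlgebra A (Fin 2) B) (by
      obtain ⟨C, hC⟩ := BanRing.mul_bdd (B := B)
      refine ⟨C, fun m => ?_⟩
      change ‖∏ i, (show Fin 2 → B from m) i‖ ≤ C * ∏ i, ‖(show Fin 2 → B from m) i‖
      rw [Fin.prod_univ_two, Fin.prod_univ_two, ← mul_assoc]
      exact hC _ _)

variable [IsBanObj c A]

/-- The derived tensor product `B ⊗ᴸ B`, i.e. `Tot (P(B) ⊗ P(B))`. -/
noncomputable def derivedSquare : ChainComplex (BanMod c A) ℕ :=
  BanMod.tensorTot fun _ : Fin 2 => BanMod.resolution B.toMod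

/-- The component in degree zero of the multiplication `B ⊗ᴸ B → B`. -/
noncomputable def derivedMulZero : B.derivedSquare.X 0 ⟶ B.toMod :=
  BanMod.totProj (fun _ : Fin 2 => BanMod.resolution B.toMod) 0 (fun _ => 0) ≫
    BanMod.tensorMap (fun _ => BanMod.augmentation B.toMod) ≫ B.mulHom

theorem totD_comp_mul :
    BanMod.totD (fun _ : Fin 2 => BanMod.resolution B.toMod) 0 ≫
      BanMod.totProj (fun _ : Fin 2 => BanMod.resolution B.toMod) 0 (fun _ => 0) ≫
        BanMod.tensorMap (fun _ => BanMod.augmentation B.toMod) ≫ B.mulHom = 0 := by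
  rw [← Category.assoc, BanMod.totD_proj, Preadditive.sum_comp]
  refine Finset.sum_eq_zero fun i _ => ?_
  have h : BanMod.tensorD (fun _ : Fin 2 => BanMod.resolution B.toMod) i
      (BanMod.bump (fun _ => 0) i) (fun _ => 0) ≫
        BanMod.tensorMap (fun _ : Fin 2 => BanMod.augmentation B.toMod) = 0 := by
    rw [BanMod.tensorD, BanMod.tensorMap_comp]
    refine BanMod.tensorMap_eq_zero _ i ?_
    rw [if_pos rfl, BanMod.bump_self]
    exact BanMod.resolution_d_augmentation B.toMod
  rw [Preadditive.zsmul_comp, Category.assoc, ← Category.assoc (BanMod.tensorD _ _ _ _), h,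
    zero_comp, comp_zero, smul_zero]

theorem d_derivedMulZero : B.derivedSquare.d 1 0 ≫ B.derivedMulZero = 0 :=
  (congrArg (· ≫ B.derivedMulZero) (BanMod.tensorTot_d _ 0)).trans B.totD_comp_mul

/-- The multiplication `B ⊗ᴸ B → B` as a morphism of complexes. -/
noncomputable def derivedMul :
    B.derivedSquare ⟶ (ChainComplex.single₀ (BanMod c A)).obj B.toMod :=
  (ChainComplex.toSingle₀Equiv _ _).symm ⟨B.derivedMulZero, B.d_derivedMulZero⟩

/-- The structure morphism `A → B` is a homotopy epimorphism: the multiplication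
`B ⊗ᴸ B → B` is an isomorphism in `Der⁻`. -/
def IsHomotopyEpi : Prop :=
  IsIso ((BanMod.quasiIso c A).Q.map (BanMod.toChMinusMap B.derivedMul))

/-- The augmented alternating Tate–Čech complex
`A → ∏_i B_i → ∏_{i < j} B_i ⊗ B_j → ⋯` of a finite family of Banach `A`-algebras. -/
noncomputable def tateCech {m : ℕ} (B : Fin m → BanAlg c A) : CochainComplex (BanMod c A) ℕ :=
  BanMod.cechComplex (BanMod.tensorFunctor (fun i => (B i).toMod) fun i => (1 : B i))

/-- The total complex of the augmented alternating derived Tate–Čech complex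
`A → ∏_i B_i → ∏_{i < j} B_i ⊗ᴸ B_j → ⋯` of a finite family of Banach `A`-algebras. Here
`⨂ᴸ_{i ∈ s} B_i` is represented by the complex `Tot (⨂_{i ∈ s} P(B_i))`, and the transition maps
insert the canonical lift to `P(B_i)₀` of the unit of `B_i`. -/
noncomputable def derivedTateCech {m : ℕ} (B : Fin m → BanAlg c A) :
    CochainComplex (BanMod c A) ℤ :=
  BanMod.cechTotal (BanMod.tensorTotFunctor (fun i => BanMod.resolution (B i).toMod)
    fun i => BanMod.resolutionLift (B i).toMod (1 : B i))

section covers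

variable (R : Type u) [NormedCommRing R] [Algebra R A] [IsBoundedSMul R A] [CompleteSpace A]

/-- Non-derived covers of the Banach `R`-algebra `A`: sets of Banach `A`-algebras whose structure
morphisms are epimorphisms in `Alg_c(R)` and which have a finite subset (enumerated without
repetitions as `B₀, …, Bₘ₋₁`) which satisfies Tate's acyclicity. -/
def IsNonDerivedCover (S : Set (BanAlg c A)) : Prop :=
  (∀ B ∈ S, Epi (B.structureHom R)) ∧
  ∃ (m : ℕ) (B : Fin m → BanAlg c A), Function.Injective B ∧ (∀ i, B i ∈ S) ∧
    BanMod.StrictExact (tateCech B)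

/-- Derived covers of the Banach algebra `A`: sets of Banach `A`-algebras whose structure
morphisms are homotopy epimorphisms and which have a finite subset (enumerated without
repetitions as `B₀, …, Bₘ₋₁`) which satisfies derived Tate's acyclicity. -/
def IsDerivedCover (S : Set (BanAlg c A)) : Prop :=
  (∀ B ∈ S, B.IsHomotopyEpi) ∧
  ∃ (m : ℕ) (B : Fin m → BanAlg c A), Function.Injective B ∧ (∀ i, B i ∈ S) ∧
    BanMod.StrictExact (derivedTateCech B)

end covers

end BanAlg

/-! ### Algebras of continuous functions and topological covers -/

instance {c : BanKind} {Y R : Type*} [TopologicalSpace Y] [CompactSpace Y]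
    [SeminormedAddCommGroup R] [h : IsBanObj c R] : IsBanObj c C(Y, R) where
  ultra hc := by
    have := h.ultra hc
    refine ⟨fun f g k => (ContinuousMap.dist_le (le_max_of_le_left dist_nonneg)).2 fun y => ?_⟩
    exact (dist_triangle_max (f y) (g y) (k y)).trans (max_le_max
      (ContinuousMap.dist_apply_le_dist y) (ContinuousMap.dist_apply_le_dist y))

theorem completeSpace_continuousMap (X R : Type*) [TopologicalSpace X] [CompactSpace X]
    [NormedField R] [CompleteSpace R] : CompleteSpace C(X, R) :=
  inferInstance

instance (X : CompHaus.{u}) (R : Type u) [NormedField R] [CompleteSpace R] :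
    CompleteSpace C(X, R) :=
  completeSpace_continuousMap X R

section topological

open Topology

variable (c : BanKind) (R : Type u) [NormedField R]

/-- `C(Y, R)` as a Banach `C(X, R)`-algebra, by precomposition with the structure map `Y → X`. -/
noncomputable def functionAlgebra [CompleteSpace R] [IsBanObj c R] {X : CompHaus.{u}} (Y : Over X) :
    BanAlg c C(X, R) :=
  letI : BanRing C(Y.left, R) := BanRing.ofNormed C(Y.left, R)
  letI : Algebra C(X, R) C(Y.left, R) :=
    (ContinuousMap.compRightAlgHom R R (Y.hom.hom.hom : C(Y.left, X))).toRingHom.toAlgebra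
  { carrier := C(Y.left, R)
    smul_bdd := ⟨1, fun a b => by
      rw [one_mul]
      refine (norm_mul_le (a.comp (Y.hom.hom.hom : C(Y.left, X))) b).trans ?_
      refine mul_le_mul_of_nonneg_right ?_ (norm_nonneg b)
      exact (ContinuousMap.norm_le _ (norm_nonneg a)).2 fun y => a.norm_coe_le_norm _⟩ }

/-- A non-Archimedean local field: a field which is complete and locally compact for a nontrivial
non-Archimedean absolute value. -/
def IsNonarchLocalField : Prop :=
  IsUltrametricDist R ∧ LocallyCompactSpace R ∧ ∃ x : R, 1 < ‖x‖

/-- Admissible pairs `(c, R)`: in the category of all Banach Abelian groups, `R` is `ℝ` or `ℂ` with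
the usual absolute value; in the category of non-Archimedean ones, `R` is a finite field with the
trivial absolute value or a local field. -/
def IsAdmissiblePair : Prop :=
  match c with
  | .arch => (∃ e : R ≃+* ℝ, Isometry e) ∨ ∃ e : R ≃+* ℂ, Isometry e
  | .nonarch => (Finite R ∧ ∀ x : R, x ≠ 0 → ‖x‖ = 1) ∨ IsNonarchLocalField R

/-- Admissible triples `(c, X, R)`. -/
def IsAdmissibleTriple (X : CompHaus.{u}) : Prop :=
  IsAdmissiblePair c R ∧ (c = .nonarch → TotallyDisconnectedSpace X)

/-- The functor `β`: the identity, respectively the Banaschewski compactification, i.e. the left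
adjoint of the inclusion of totally disconnected compact Hausdorff spaces into compact Hausdorff
spaces. -/
def betaFunctor : BanKind → (CompHaus.{u} ⥤ CompHaus.{u})
  | .arch => 𝟭 _
  | .nonarch => CompHaus.toProfinite ⋙ profiniteToCompHaus

/-- The canonical maps `Y → β Y`. -/
def iota : ∀ c : BanKind, 𝟭 CompHaus.{u} ⟶ betaFunctor.{u} c
  | .arch => 𝟙 _
  | .nonarch => Profinite.toProfiniteAdjToCompHaus.unit

/-- A `c`-embedding: a continuous map such that `β φ` is a homeomorphism onto its image. -/
def IsCEmbedding {Y X : CompHaus.{u}} (φ : Y ⟶ X) : Prop :=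
  IsEmbedding ((betaFunctor.{u} c).map φ)

/-- A `c`-cover of `X`. -/
def IsCCover (X : CompHaus.{u}) (S : Set (Over X)) : Prop :=
  (∀ Y ∈ S, IsCEmbedding c Y.hom) ∧
  ∃ S₀ ⊆ S, S₀.Finite ∧
    ∀ z : (betaFunctor.{u} c).obj X, ∃ Y ∈ S₀, ∃ y : Y.left, (iota.{u} c).app X (Y.hom y) = z

end topological

/-! Closed subsets of `X` can be separated by functions that form convex combinations: Urysohn
functions with values in `[0, 1]` if `R` is `ℝ` or `ℂ`, characteristic functions of clopen sets if
`X` is totally disconnected (`UniformlySeparated`). This gives two properties of the restriction map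
`A = C(X, R) → B = C(K, R)` with kernel `I`. Functions on `K` lift to `X` with control of the norm
(`BanAlg.HasBddLift`), and there is a bounded net of functions `f ∈ 1 + I` with `f t → 0` for every
`t ∈ I` (`BanMod.Cutoff`). Apart from these, covering enters only through the vanishing of every
product of elements, one from each kernel.

Bounded lifts identify a completed tensor product of such algebras with the quotient of `A` by the
closure of the sum of the kernels (`exists_smul_unitTensor`, `mem_closure_of_smul_unitTensor`). The
cutoffs show that derived tensor products carry nothing more. On the resolution `P(B)` the identity
is homotopic to maps which in degree zero are `x ↦ f Λ(x) u`, with `Λ` a linear form that lifts the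
augmentation, and which tend to zero pointwise in positive degrees (`exists_approxRetraction`).
Applying these homotopies in one tensor factor after the other, every cycle is approximated by
boundaries with control of the norm. Successive approximation then makes `⨂ᴸ Bᵢ` a strict resolution
of `⨂ Bᵢ` (`tot_strictExactAt_pos`, `tot_exact_zero`). Since `B ⊗ B → B` is an isomorphism, `A → B`
is a homotopy epimorphism.

For a cover, `ρᵢ = fᵢ ∏_{j < i} (1 - fⱼ)` is a partition of unity, because `∏ (1 - fᵢ)` is a product
of elements of all the kernels. The usual contraction of the Čech complex by `ρ`, applied to lifts
of the cochains to `A`, fails only by terms that contain some `fᵢ` times an element of the closure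
of a sum of kernels, and these become arbitrarily small (`cochain_approx`). The derived complex is
compared with the ordinary one column by column (`StrictResolution.strictExact_cechTotal`).

Conversely, exactness of either complex at its left end makes `A → ∏ Bᵢ` injective, whereas a point
outside the union of the closed sets would yield a nonzero function vanishing on that union. Finally
`X → β X` is an isomorphism for admissible triples, so `c`-covers are just finite covers. -/

open Filter Topology

namespace BanMod

variable {c : BanKind} {A : Type u} [NormedCommRing A]

/-! ### Strict exactness by approximation -/

section approximation

variable {M N P : BanMod c A}

/-- Successive approximation: if the elements of a subgroup `Z` can be approximated by images of
elements of controlled norm, with errors in `Z`, then they are images of elements of controlled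
norm. -/
theorem exists_preimage_of_approx (f : M ⟶ N) (Z : AddSubgroup N) {C : ℝ} (hC : 0 ≤ C)
    (h : ∀ y ∈ Z, ∀ ε > 0, ∃ x, ‖x‖ ≤ C * ‖y‖ ∧ ‖y - f.lin x‖ ≤ ε ∧ y - f.lin x ∈ Z)
    {y : N} (hy : y ∈ Z) : ∃ x, f.lin x = y ∧ ‖x‖ ≤ 2 * C * ‖y‖ := by
  -- The tolerance is half the norm of `y`; zero is treated apart because `h` asks for a positive
  -- one.
  have h' : ∀ y : Z, ∃ x : M, ‖x‖ ≤ C * ‖y.1‖ ∧ ‖y.1 - f.lin x‖ ≤ 1 / 2 * ‖y.1‖ ∧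
      y.1 - f.lin x ∈ Z := by
    intro y
    by_cases hy0 : y.1 = 0
    · exact ⟨0, by simp [hy0], by simp [hy0], by simp [hy0, Z.zero_mem]⟩
    · exact h y.1 y.2 _ (by have := norm_pos_iff.2 hy0; positivity)
  choose g hg1 hg2 hg3 using h'
  -- The successive residues. They stay in `Z` and their norms are halved each time, so the
  -- corrections are dominated by a geometric series; its sum is the factor `2` of the conclusion.
  let s : ℕ → Z := fun n => Nat.rec ⟨y, hy⟩ (fun _ z => ⟨z.1 - f.lin (g z), hg3 z⟩) n
  have hs : ∀ n, (s (n + 1)).1 = (s n).1 - f.lin (g (s n)) := fun n => rfl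
  have hsn : ∀ n, ‖(s n).1‖ ≤ (1 / 2) ^ n * ‖y‖ := by
    intro n
    induction n with
    | zero => simp [s]
    | succ n ih =>
      rw [hs, pow_succ']
      refine (hg2 _).trans ?_
      rw [mul_assoc]
      gcongr
  have hgeo : HasSum (fun n : ℕ => C * ((1 / 2 : ℝ) ^ n * ‖y‖)) (2 * C * ‖y‖) := by
    have := ((hasSum_geometric_two).mul_right ‖y‖).mul_left C
    rwa [← mul_assoc, mul_comm C] at this
  have hb : ∀ n, ‖g (s n)‖ ≤ C * ((1 / 2 : ℝ) ^ n * ‖y‖) := fun n =>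
    (hg1 _).trans (mul_le_mul_of_nonneg_left (hsn n) hC)
  have hsum : Summable fun n => g (s n) := Summable.of_norm_bounded hgeo.summable hb
  refine ⟨∑' n, g (s n), ?_, tsum_of_norm_bounded hgeo hb⟩
  have h1 : Tendsto (fun n => f.lin (∑ k ∈ Finset.range n, g (s k))) atTop
      (𝓝 (f.lin (∑' n, g (s n)))) :=
    ((Hom.continuous f).tendsto _).comp hsum.hasSum.tendsto_sum_nat
  have h2 : ∀ n, f.lin (∑ k ∈ Finset.range n, g (s k)) = y - (s n).1 := by
    intro n
    induction n with
    | zero => simp [s]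
    | succ n ih => rw [Finset.sum_range_succ, map_add, ih, hs]; abel
  have h3 : Tendsto (fun n => (s n).1) atTop (𝓝 0) := by
    refine squeeze_zero_norm hsn ?_
    have := (tendsto_pow_atTop_nhds_zero_of_lt_one (r := (1 / 2 : ℝ)) (by norm_num)
      (by norm_num)).mul_const ‖y‖
    rwa [zero_mul] at this
  have h4 : Tendsto (fun n => y - (s n).1) atTop (𝓝 y) := by
    have := (tendsto_const_nhds (x := y)).sub h3
    rwa [sub_zero] at this
  simp only [h2] at h1
  exact tendsto_nhds_unique h1 h4

/-- Strictness provides preimages for all points of the closure of the range, so the range is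
already closed and the closure disappears from the condition. -/
theorem strictExactAt_iff {f : M ⟶ N} {g : N ⟶ P} : StrictExactAt f g ↔
    (∀ x, g.lin (f.lin x) = 0) ∧
      ∃ C : ℝ, 0 ≤ C ∧ ∀ y, g.lin y = 0 → ∃ x, f.lin x = y ∧ ‖x‖ ≤ C * ‖y‖ := by
  constructor
  · rintro ⟨h, C, hC⟩
    refine ⟨fun x => ?_, max C 0, le_max_right _ _, fun y hy => ?_⟩
    · have : f.lin x ∈ {y | g.lin y = 0} := h ▸ subset_closure ⟨x, rfl⟩
      exact this
    · obtain ⟨x, hx, hx'⟩ := hC y (by rw [h]; exact hy)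
      exact ⟨x, hx, hx'.trans (mul_le_mul_of_nonneg_right (le_max_left _ _) (norm_nonneg _))⟩
  · rintro ⟨h, C, hC0, hC⟩
    have key : closure (Set.range f.lin) = {y | g.lin y = 0} := by
      refine Set.Subset.antisymm (closure_minimal ?_
        (isClosed_eq (Hom.continuous g) continuous_const)) fun y hy => ?_
      · rintro _ ⟨x, rfl⟩
        exact h x
      · obtain ⟨x, hx, -⟩ := hC y hy
        exact subset_closure ⟨x, hx⟩
    exact ⟨key, C, fun y hy => hC y (by rw [key] at hy; exact hy)⟩

/-- When a cycle is approximated by a boundary, the error is again a cycle, so the approximation can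
be iterated inside the kernel of `g`. -/
theorem strictExactAt_of_approx {f : M ⟶ N} {g : N ⟶ P} (hfg : ∀ x, g.lin (f.lin x) = 0)
    {C : ℝ} (hC : 0 ≤ C)
    (h : ∀ y, g.lin y = 0 → ∀ ε > 0, ∃ x, ‖x‖ ≤ C * ‖y‖ ∧ ‖y - f.lin x‖ ≤ ε) :
    StrictExactAt f g := by
  refine strictExactAt_iff.2 ⟨hfg, 2 * C, by positivity, fun y hy => ?_⟩
  refine exists_preimage_of_approx f (LinearMap.ker g.lin).toAddSubgroup hC (fun y hy ε hε => ?_)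
    (y := y) hy
  obtain ⟨x, hx, hx'⟩ := h y hy ε hε
  refine ⟨x, hx, hx', ?_⟩
  change g.lin (y - f.lin x) = 0
  rw [map_sub, hfg, show g.lin y = 0 from hy, sub_zero]

end approximation

/-! ### Bounds for morphisms given by universal properties -/

section bounds

/-- A morphism carries only the existence of a bound. For uniformly bounded families the constant
has to be explicit, and any bound before completion persists after it. -/
theorem norm_completionLift_le {V : Type u} [AddCommGroup V] [Module A V] {p : ModSeminorm c A V}
    {N : BanMod c A} (f : V →ₗ[A] N) (hf : ∃ C : ℝ, ∀ v, ‖f v‖ ≤ C * p.toFun v) {C : ℝ}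
    (hC : ∀ v, ‖f v‖ ≤ C * p.toFun v) (x : completion p) :
    ‖(completionLift f hf).lin x‖ ≤ C * ‖x‖ := by
  refine UniformSpace.Completion.induction_on (α := p.Space) x
    (isClosed_le (continuous_norm.comp (Hom.continuous (completionLift f hf)))
      (continuous_const.mul continuous_norm)) fun v => ?_
  refine (congrArg norm (completionLift_mk f hf v)).le.trans ((hC v).trans_eq ?_)
  exact congrArg (C * ·) (norm_completionMk p v).symm

theorem completion_induction {V : Type u} [AddCommGroup V] [Module A V] {p : ModSeminorm c A V}
    {Q : completion p → Prop} (hQ : IsClosed {x | Q x}) (h : ∀ v, Q (completionMk p v))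
    (x : completion p) : Q x :=
  UniformSpace.Completion.induction_on (α := p.Space) x hQ h

variable {ι : Type} [Fintype ι] {M M' : ι → BanMod c A} {N : BanMod c A}

theorem norm_tensor_smul_le (a : A) (x : tensor M) : ‖a • x‖ ≤ ‖a‖ * ‖x‖ :=
  completion_norm_smul_le (tensorSeminorm M) a x

theorem tensor_induction {Q : tensor M → Prop} (hQ : IsClosed {x | Q x})
    (hadd : ∀ x y, Q x → Q y → Q (x + y)) (htmk : ∀ (a : A) m, Q (a • tmk m)) (x : tensor M) :
    Q x := by
  refine completion_induction (p := tensorSeminorm M) hQ (fun v => ?_) x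
  induction v using PiTensorProduct.induction_on with
  | smul_tprod a m => rw [map_smul]; exact htmk a m
  | add x y hx hy => rw [map_add]; exact hadd _ _ hx hy

theorem norm_tensorLift_le (f : MultilinearMap A (fun i => M i) N)
    (hf : ∃ C : ℝ, ∀ m, ‖f m‖ ≤ C * ∏ i, ‖m i‖) {C D : ℝ} (hC0 : 0 ≤ C) (hD0 : 0 ≤ D)
    (hC : ∀ m, ‖f m‖ ≤ C * ∏ i, ‖m i‖) (hD : ∀ (a : A) (y : N), ‖a • y‖ ≤ D * ‖a‖ * ‖y‖)
    (x : tensor M) : ‖(tensorLift f hf).lin x‖ ≤ D * C * ‖x‖ := by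
  have hE : 0 ≤ D * C := mul_nonneg hD0 hC0
  refine norm_completionLift_le _ _ (fun t => ?_) x
  change _ ≤ _ * tensorNorm M t
  rw [tensorNorm, Real.mul_iInf_of_nonneg hE]
  refine le_ciInf fun l => ?_
  have := norm_list_sum_le N l.1 (fun x => x.1 • f x.2) (fun x => ‖x.1‖ * ∏ i, ‖x.2 i‖)
    (D * C) (fun x _ => by
      refine (hD x.1 (f x.2)).trans ?_
      calc D * ‖x.1‖ * ‖f x.2‖ ≤ D * ‖x.1‖ * (C * ∏ i, ‖x.2 i‖) := by
            gcongr
            exact hC x.2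
        _ = _ := by ring) hE
  refine le_of_eq_of_le (congrArg norm ?_) this
  refine (congrArg (PiTensorProduct.lift f) l.2).symm.trans ?_
  rw [map_list_sum, List.map_map]
  simp [Function.comp_def]

theorem norm_tensorMap_le (f : ∀ i, M i ⟶ M' i) {C : ι → ℝ} (hC0 : ∀ i, 0 ≤ C i)
    (hC : ∀ i x, ‖(f i).lin x‖ ≤ C i * ‖x‖) (x : tensor M) :
    ‖(tensorMap f).lin x‖ ≤ ‖(1 : A)‖ * (∏ i, C i) * ‖x‖ := by
  have h0 : 0 ≤ ∏ i, C i := Finset.prod_nonneg fun i _ => hC0 i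
  have := norm_tensorLift_le ((tmkMultilinear M').compLinearMap fun i => (f i).lin)
    ⟨‖(1 : A)‖ * ∏ i, C i, fun m => ?_⟩ (C := ‖(1 : A)‖ * ∏ i, C i) (D := 1) (by positivity)
    zero_le_one ?_ (fun a y => by rw [one_mul]; exact norm_tensor_smul_le a y) x
  · rwa [one_mul] at this
  all_goals
    try intro m
    refine (norm_tmk_le _).trans ?_
    rw [mul_assoc, ← Finset.prod_mul_distrib]
    gcongr with i
    exact hC i (m i)

theorem tensorMap_id : tensorMap (fun i => 𝟙 (M i)) = 𝟙 (tensor M) :=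
  tensor_hom_ext fun m => by simp

/-- This is what splits a homotopy identity in one tensor factor into its summands. -/
theorem tensorMap_eq_add {f g h : ∀ i, M i ⟶ M' i} (i : ι) (hi : f i = g i + h i)
    (hg : ∀ j, j ≠ i → g j = f j) (hh : ∀ j, j ≠ i → h j = f j) :
    tensorMap f = tensorMap g + tensorMap h := by
  classical
  refine tensor_hom_ext fun m => ?_
  have key : ∀ k : ∀ i, M i ⟶ M' i, (∀ j, j ≠ i → k j = f j) →
      (fun j => (k j).lin (m j)) =
        Function.update (fun j => (f j).lin (m j)) i ((k i).lin (m i)) := by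
    intro k hk
    funext j
    by_cases hj : j = i
    · subst hj; simp
    · rw [Function.update_of_ne hj, hk j hj]
  rw [add_lin, tensorMap_tmk, tensorMap_tmk, tensorMap_tmk, key g hg, key h hh,
    key f fun _ _ => rfl, ← tmkMultilinear_apply, ← tmkMultilinear_apply, ← tmkMultilinear_apply,
    hi, add_lin, MultilinearMap.map_update_add, Function.update_idem, Function.update_idem]

open scoped NNReal

variable {X : Type u} {w : X → ℝ≥0} [IsBanObj c A]

theorem norm_freeSingle_le (x : X) : ‖freeSingle c A w x‖ ≤ ‖(1 : A)‖ * w x := by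
  refine (norm_completionMk (freeSeminorm c A w) _).trans_le ?_
  change (freeNorm w c (Finsupp.single x 1) : ℝ) ≤ _
  have : freeNorm w c (Finsupp.single x (1 : A)) ≤ ‖(1 : A)‖₊ * w x := by
    cases c with
    | arch =>
      rw [freeNorm_arch w (Finsupp.support_single_subset)]
      simp
    | nonarch =>
      refine (freeNorm_nonarch_le w).2 fun y => ?_
      classical
      rw [Finsupp.single_apply]
      split_ifs with h
      · rw [h]
      · simp
  exact_mod_cast this

theorem free_induction {Q : free c A w → Prop} (hQ : IsClosed {x | Q x}) (h0 : Q 0)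
    (hadd : ∀ x y, Q x → Q y → Q (x + y)) (hsingle : ∀ (a : A) x, Q (a • freeSingle c A w x))
    (x : free c A w) : Q x := by
  refine completion_induction (p := freeSeminorm c A w) hQ (fun v => ?_) x
  induction v using Finsupp.induction_linear with
  | zero => rw [map_zero]; exact h0
  | add f g hf hg => rw [map_add]; exact hadd _ _ hf hg
  | single x a =>
    have : Finsupp.single x a = a • Finsupp.single x (1 : A) := by simp
    rw [this, map_smul]
    exact hsingle a x

theorem free_hom_ext {N : BanMod c A} {f g : free c A w ⟶ N}
    (h : ∀ x, f.lin (freeSingle c A w x) = g.lin (freeSingle c A w x)) : f = g := by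
  ext y
  refine free_induction (isClosed_eq (Hom.continuous f) (Hom.continuous g)) (by simp)
    (fun x y hx hy => by rw [map_add, map_add, hx, hy])
    (fun a x => by rw [map_smul, map_smul, h]) y

theorem norm_freeLift_le {N : BanMod c A} (g : X → N) (hg : ∃ C : ℝ, ∀ x, ‖g x‖ ≤ C * w x)
    {C D : ℝ} (hC0 : 0 ≤ C) (hD0 : 0 ≤ D) (hC : ∀ x, ‖g x‖ ≤ C * w x)
    (hD : ∀ (a : A) (y : N), ‖a • y‖ ≤ D * ‖a‖ * ‖y‖) (x : free c A w) :
    ‖(freeLift g hg).lin x‖ ≤ D * C * ‖x‖ := by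
  have hE : 0 ≤ D * C := mul_nonneg hD0 hC0
  have hx (f : X →₀ A) (x : X) : ‖f x • g x‖ ≤ D * C * (‖f x‖₊ * w x : ℝ≥0) := by
    refine (hD _ _).trans ?_
    calc D * ‖f x‖ * ‖g x‖ ≤ D * ‖f x‖ * (C * w x) := by gcongr; exact hC x
      _ = _ := by push_cast; ring
  refine norm_completionLift_le _ _ (fun f => ?_) x
  change ‖∑ x ∈ f.support, f x • g x‖ ≤ _ * (freeNorm w c f : ℝ)
  cases c with
  | arch =>
    refine (norm_sum_le _ _).trans ?_
    rw [freeNorm]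
    push_cast
    rw [Finset.mul_sum]
    exact Finset.sum_le_sum fun x _ => by simpa using hx f x
  | nonarch =>
    have := N.obj.ultra rfl
    refine IsUltrametricDist.norm_sum_le_of_forall_le_of_nonneg (by positivity) fun x _ => ?_
    refine (hx f x).trans (mul_le_mul_of_nonneg_left ?_ hE)
    exact_mod_cast le_freeNorm_nonarch w f x

end bounds

/-! ### Uniformly bounded families of morphisms -/

section families

variable {E : Type*} {l : Filter E} {M N P : BanMod c A}

/-- A family of morphisms which is uniformly bounded. -/
def UnifBdd (f : E → (M ⟶ N)) : Prop := ∃ C : ℝ, 0 ≤ C ∧ ∀ e x, ‖(f e).lin x‖ ≤ C * ‖x‖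

/-- A family of morphisms which converges to zero pointwise along a filter. -/
def PtNull (l : Filter E) (f : E → (M ⟶ N)) : Prop :=
  ∀ x, Tendsto (fun e => (f e).lin x) l (𝓝 0)

theorem UnifBdd.const (f : M ⟶ N) : UnifBdd fun _ : E => f := by
  obtain ⟨C, h0, hC⟩ := exists_nonneg_bound f.bdd
  exact ⟨C, h0, fun _ => hC⟩

theorem UnifBdd.comp {f : E → (M ⟶ N)} {g : E → (N ⟶ P)} (hf : UnifBdd f) (hg : UnifBdd g) :
    UnifBdd fun e => f e ≫ g e := by
  obtain ⟨C, hC0, hC⟩ := hf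
  obtain ⟨D, hD0, hD⟩ := hg
  refine ⟨D * C, mul_nonneg hD0 hC0, fun e x => (hD e _).trans ?_⟩
  rw [mul_assoc]
  exact mul_le_mul_of_nonneg_left (hC e x) hD0

theorem UnifBdd.add {f g : E → (M ⟶ N)} (hf : UnifBdd f) (hg : UnifBdd g) :
    UnifBdd fun e => f e + g e := by
  obtain ⟨C, hC0, hC⟩ := hf
  obtain ⟨D, hD0, hD⟩ := hg
  refine ⟨C + D, add_nonneg hC0 hD0, fun e x => (norm_add_le _ _).trans ?_⟩
  rw [add_mul]
  exact add_le_add (hC e x) (hD e x)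

theorem UnifBdd.neg {f : E → (M ⟶ N)} (hf : UnifBdd f) : UnifBdd fun e => -f e := by
  obtain ⟨C, hC0, hC⟩ := hf
  exact ⟨C, hC0, fun e x => by rw [neg_lin, norm_neg]; exact hC e x⟩

theorem UnifBdd.sub {f g : E → (M ⟶ N)} (hf : UnifBdd f) (hg : UnifBdd g) :
    UnifBdd fun e => f e - g e := by
  simpa only [sub_eq_add_neg] using hf.add hg.neg

theorem PtNull.comp_left {g : E → (N ⟶ P)} (hg : PtNull l g) (f : M ⟶ N) :
    PtNull l fun e => f ≫ g e := fun x => hg (f.lin x)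

/-- An `ε / 2` argument: the uniform bound controls the family on `x - y`, convergence at a nearby
`y` does the rest. Pointwise convergence therefore need only be checked on elements that span a
dense submodule. -/
theorem isClosed_tendsto_zero {f : E → (M ⟶ N)} (hf : UnifBdd f) :
    IsClosed {x | Tendsto (fun e => (f e).lin x) l (𝓝 0)} := by
  obtain ⟨C, hC0, hC⟩ := hf
  refine isClosed_of_closure_subset fun x hx => ?_
  rw [Set.mem_ofPred_eq, Metric.tendsto_nhds]
  intro ε hε
  -- Here and below, `C + 1` in place of `C` allows for `C = 0`.
  obtain ⟨y, hy, hxy⟩ := Metric.mem_closure_iff.1 hx (ε / 2 / (C + 1)) (by positivity)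
  filter_upwards [(Metric.tendsto_nhds.1 hy) (ε / 2) (by positivity)] with e he
  rw [dist_zero_right] at he ⊢
  have h1 : (f e).lin x = (f e).lin (x - y) + (f e).lin y := by rw [map_sub, sub_add_cancel]
  have h2 : ‖(f e).lin (x - y)‖ ≤ ε / 2 := by
    rw [dist_eq_norm] at hxy
    refine (hC e _).trans ?_
    have h3 : C * ‖x - y‖ ≤ (C + 1) * (ε / 2 / (C + 1)) := by gcongr; linarith
    rwa [mul_div_cancel₀ _ (by positivity)] at h3
  rw [h1]
  exact (norm_add_le _ _).trans_lt (by linarith)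

theorem UnifBdd.tensorMap {ι : Type} [Fintype ι] {M M' : ι → BanMod c A}
    {f : E → ∀ i, M i ⟶ M' i} (hf : ∀ i, UnifBdd fun e => f e i) :
    UnifBdd fun e => tensorMap (f e) := by
  choose C hC0 hC using hf
  have h0 : 0 ≤ ∏ i, C i := Finset.prod_nonneg fun i _ => hC0 i
  exact ⟨‖(1 : A)‖ * ∏ i, C i, by positivity, fun e x =>
    norm_tensorMap_le (f e) hC0 (fun i => hC i e) x⟩

/-- One null factor is enough: on a pure tensor the norm of the image is at most the product of the
norms, and the other factors stay bounded. -/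
theorem PtNull.tensorMap {ι : Type} [Fintype ι] {M M' : ι → BanMod c A}
    {f : E → ∀ i, M i ⟶ M' i} (hf : ∀ i, UnifBdd fun e => f e i) (i : ι)
    (hi : PtNull l fun e => f e i) : PtNull l fun e => BanMod.tensorMap (f e) := by
  classical
  refine tensor_induction (isClosed_tendsto_zero (UnifBdd.tensorMap hf))
    (fun x y hx hy => ?_) fun a m => ?_
  · simpa only [map_add, add_zero] using hx.add hy
  · choose C hC0 hC using hf
    have key : ∀ e, ‖(BanMod.tensorMap (f e)).lin (a • tmk m)‖ ≤
        ‖a‖ * (‖(1 : A)‖ * ((∏ j ∈ Finset.univ.erase i, C j * ‖m j‖) * ‖(f e i).lin (m i)‖)) := by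
      intro e
      rw [map_smul, tensorMap_tmk]
      refine (norm_tensor_smul_le _ _).trans (mul_le_mul_of_nonneg_left ?_ (norm_nonneg _))
      refine (norm_tmk_le _).trans (mul_le_mul_of_nonneg_left ?_ (norm_nonneg _))
      rw [← Finset.prod_erase_mul _ _ (Finset.mem_univ i)]
      refine mul_le_mul_of_nonneg_right ?_ (norm_nonneg _)
      exact Finset.prod_le_prod (fun _ _ => norm_nonneg _) fun j _ => hC j e (m j)
    refine squeeze_zero_norm key ?_
    have := ((((hi (m i)).norm).const_mul
      (∏ j ∈ Finset.univ.erase i, C j * ‖m j‖)).const_mul ‖(1 : A)‖).const_mul ‖a‖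
    simpa using this

end families

end BanMod

namespace BanMod

variable {c : BanKind} {A : Type u} [NormedCommRing A]

/-! ### Scalars and elements as morphisms -/

section scalars

variable {M N : BanMod c A}

/-- Multiplication by a scalar. -/
def smulHom (M : BanMod c A) (a : A) : M ⟶ M :=
  ⟨a • LinearMap.id, by
    obtain ⟨C, hC⟩ := M.smul_bdd
    exact ⟨C * ‖a‖, fun x => hC a x⟩⟩

theorem UnifBdd.smulHom {E : Type*} {f : E → A} (hf : ∃ C : ℝ, ∀ e, ‖f e‖ ≤ C) :
    UnifBdd fun e => smulHom M (f e) := by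
  obtain ⟨C, hC⟩ := hf
  obtain ⟨D, hD0, hD⟩ := M.exists_smul_bound
  refine ⟨D * max C 0, mul_nonneg hD0 (le_max_right _ _), fun e x => (hD (f e) x).trans ?_⟩
  gcongr
  exact (hC e).trans (le_max_left _ _)

variable (c A) in
/-- The ring `A` as a Banach module over itself. -/
def self [CompleteSpace A] [IsBanObj c A] : BanMod c A where
  carrier := A
  smul_bdd := ⟨1, fun a b => by rw [one_mul]; exact norm_mul_le a b⟩

variable [CompleteSpace A] [IsBanObj c A]

/-- The morphism `A → M` given by an element of `M`. -/
def elemHom (u : M) : self c A ⟶ M :=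
  ⟨LinearMap.toSpanSingleton A M u, by
    obtain ⟨C, hC⟩ := M.smul_bdd
    exact ⟨C * ‖u‖, fun x => (hC x u).trans_eq (by rw [mul_right_comm]; rfl)⟩⟩

end scalars

/-! ### Lifting families of morphisms -/

/-- Uniformly bounded families of morphisms from `P` can be lifted along morphisms which admit
preimages of controlled norm; lifts of families converging to zero do so, too. -/
def FamilyProjective (P : BanMod c A) : Prop :=
  ∀ ⦃E : Type u⦄ ⦃L N : BanMod c A⦄ (g : L ⟶ N) (f : E → (P ⟶ N)) (K : ℝ), 0 ≤ K → UnifBdd f →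
    (∀ e x, ∃ y, g.lin y = (f e).lin x ∧ ‖y‖ ≤ K * ‖(f e).lin x‖) →
    ∃ f' : E → (P ⟶ L), (∀ e, f' e ≫ g = f e) ∧ UnifBdd f' ∧ ∀ l, PtNull l f → PtNull l f'

theorem FamilyProjective.of_iso {P P' : BanMod c A} (i : P ≅ P') (h : FamilyProjective P) :
    FamilyProjective P' := by
  intro E L N g f K hK hf hlift
  obtain ⟨f', h1, h2, h3⟩ := h g (fun e => i.hom ≫ f e) K hK ((UnifBdd.const i.hom).comp hf)
    fun e x => hlift e (i.hom.lin x)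
  refine ⟨fun e => i.inv ≫ f' e, fun e => by rw [Category.assoc, h1, i.inv_hom_id_assoc],
    (UnifBdd.const i.inv).comp h2, fun l hl => (h3 l (hl.comp_left i.hom)).comp_left i.inv⟩

-- Lifts are chosen on the basis vectors only, with no coherence required, since a free module
-- extends any bounded map. The inequality between the norms of the lift and of `f e` on a basis
-- vector yields both uniform boundedness and convergence to zero along every filter.
open scoped NNReal in
theorem familyProjective_free [IsBanObj c A] {X : Type u} (w : X → ℝ≥0) :
    FamilyProjective (free c A w) := by
  intro E L N g f K hK hf hlift
  obtain ⟨C, hC0, hC⟩ := hf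
  obtain ⟨D, hD0, hD⟩ := L.exists_smul_bound
  choose s hs hs' using fun e x => hlift e (freeSingle c A w x)
  have hb : ∀ e x, ‖s e x‖ ≤ K * (C * ‖(1 : A)‖) * w x := fun e x => by
    refine (hs' e x).trans ?_
    rw [mul_assoc, mul_assoc]
    exact mul_le_mul_of_nonneg_left ((hC e _).trans
      (mul_le_mul_of_nonneg_left (norm_freeSingle_le x) hC0)) hK
  have hbdd : UnifBdd fun e => freeLift (s e) ⟨_, hb e⟩ :=
    ⟨D * (K * (C * ‖(1 : A)‖)), by positivity, fun e x =>
      norm_freeLift_le (s e) _ (by positivity) hD0 (hb e) hD x⟩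
  refine ⟨fun e => freeLift (s e) ⟨_, hb e⟩, fun e => free_hom_ext fun x => ?_, hbdd,
    fun l hl => ?_⟩
  · rw [comp_lin, freeLift_single, hs]
  · refine free_induction (isClosed_tendsto_zero hbdd) (by simpa using tendsto_const_nhds)
      (fun x y hx hy => by simpa only [map_add, add_zero] using hx.add hy) fun a x => ?_
    simp only [map_smul, freeLift_single]
    have h1 : Tendsto (fun e => s e x) l (𝓝 0) := by
      refine squeeze_zero_norm (fun e => hs' e x) ?_
      simpa using ((hl (freeSingle c A w x)).norm).const_mul K
    have := ((Hom.continuous (smulHom L a)).tendsto _).comp h1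
    rwa [map_zero] at this

/-! ### The functorial resolution -/

section resolution

variable [IsBanObj c A] (M : BanMod c A)

/-- The basis vector attached to a kernel element is a preimage of it. The functorial resolution is
thus strictly exact with constant `‖1‖` at each step. -/
theorem exists_freeSingle_ker {M N : BanMod c A} (f : M ⟶ N) (z : M) (hz : f.lin z = 0) :
    ∃ x, (coverKer f).lin x = z ∧ ‖x‖ ≤ ‖(1 : A)‖ * ‖z‖ := by
  refine ⟨freeSingle c A (fun m : ker f => ‖m‖₊) ⟨z, hz⟩, ?_, norm_freeSingle_le _⟩
  exact congrArg (kerι f).lin (freeLift_single (fun m : ker f => m) ⟨1, fun m => by simp⟩ ⟨z, hz⟩)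

theorem resolution_strictExactAt_zero :
    StrictExactAt ((resolution M).d 1 0) (augmentation M) := by
  refine strictExactAt_iff.2 ⟨fun x => ?_, ‖(1 : A)‖, norm_nonneg _, fun z hz => ?_⟩
  · exact congrArg (fun k : (resolution M).X 1 ⟶ M => k.lin x) (resolution_d_augmentation M)
  · have h : (resolution M).d 1 0 = coverKer (counit M) := ChainComplex.mk'_d_1_0 _ _ _ _
    rw [h]
    exact exists_freeSingle_ker (counit M) z hz

theorem resolution_strictExactAt_succ (n : ℕ) :
    StrictExactAt ((resolution M).d (n + 2) (n + 1)) ((resolution M).d (n + 1) n) := by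
  -- From degree two on, the term is free only up to an isomorphism, whose inverse contributes the
  -- constant `C`.
  let i : (resolution M).X (n + 2) ≅ freeOn (ker ((resolution M).d (n + 1) n)) :=
    ChainComplex.mk'XIso _ _ _ _ n
  have hi : (resolution M).d (n + 2) (n + 1) = i.hom ≫ coverKer ((resolution M).d (n + 1) n) :=
    ChainComplex.mk'_d _ _ _ _ n
  obtain ⟨C, hC0, hC⟩ := exists_nonneg_bound i.inv.bdd
  refine strictExactAt_iff.2 ⟨fun x => ?_, C * ‖(1 : A)‖, by positivity, fun z hz => ?_⟩
  · exact congrArg (fun k : (resolution M).X (n + 2) ⟶ (resolution M).X n => k.lin x)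
      ((resolution M).d_comp_d _ _ _)
  · obtain ⟨x, hx, hx'⟩ := exists_freeSingle_ker _ z hz
    refine ⟨i.inv.lin x, ?_, (hC x).trans ?_⟩
    · rw [hi, comp_lin, ← comp_lin i.inv i.hom, i.inv_hom_id, id_lin, hx]
    · rw [mul_assoc]
      exact mul_le_mul_of_nonneg_left hx' hC0

theorem familyProjective_resolution : ∀ n, FamilyProjective ((resolution M).X n)
  | 0 => familyProjective_free _
  | 1 => familyProjective_free _
  | n + 2 => (familyProjective_free _).of_iso
      (ChainComplex.mk'XIso _ _ _ _ n : (resolution M).X (n + 2) ≅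
        freeOn (ker ((resolution M).d (n + 1) n))).symm

theorem augmentation_resolutionLift (m : M) :
    (augmentation M).lin (resolutionLift M m) = m :=
  freeLift_single (fun m : M => m) ⟨1, fun m => by simp⟩ m

end resolution

/-! ### Approximate retractions -/

/-- A bounded net of elements `f` of `1 + I` with `f t → 0` for all `t ∈ I`; equivalently, the
elements `1 - f` form a bounded approximate unit of `I`. -/
structure Cutoff (I : Ideal A) : Type (u + 1) where
  E : Type u
  l : Filter E
  [neBot : l.NeBot]
  f : E → A
  one_sub_mem : ∀ e, 1 - f e ∈ I
  bdd : ∃ C : ℝ, ∀ e, ‖f e‖ ≤ C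
  tendsto : ∀ t ∈ I, Tendsto (fun e => f e * t) l (𝓝 0)

attribute [instance] Cutoff.neBot

/-- Homotopies from the identity of `K` to endomorphisms which factor in degree zero over `A`, and
which converge to zero pointwise in positive degrees. -/
structure ApproxRetraction (K : ChainComplex (BanMod c A) ℕ) (u : K.X 0) (Λ : K.X 0 →ₗ[A] A)
    {I : Ideal A} (F : Cutoff I) where
  σ : F.E → ∀ a b, K.X a ⟶ K.X b
  σ_bdd : ∀ a b, UnifBdd fun e => σ e a b
  σ_eq_zero : ∀ e a b, a + 1 ≠ b → σ e a b = 0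
  φ : F.E → ∀ a, K.X a ⟶ K.X a
  φ_zero : ∀ e x, (φ e 0).lin x = (F.f e * Λ x) • u
  φ_null : ∀ a, PtNull F.l fun e => φ e (a + 1)
  htpy : ∀ e a, σ e a (a + 1) ≫ K.d (a + 1) a + K.d a (a - 1) ≫ σ e (a - 1) a + φ e a = 𝟙 _

/-- The homotopy identity expresses `φ` through `σ` and the differentials, so its boundedness
follows from that of `σ`. -/
theorem ApproxRetraction.φ_bdd {K : ChainComplex (BanMod c A) ℕ} {u : K.X 0} {Λ : K.X 0 →ₗ[A] A}
    {I : Ideal A} {F : Cutoff I} (H : ApproxRetraction K u Λ F) (a : ℕ) :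
    UnifBdd fun e => H.φ e a := by
  have h : (fun e => H.φ e a) = fun e => 𝟙 _ - (H.σ e a (a + 1) ≫ K.d (a + 1) a +
      K.d a (a - 1) ≫ H.σ e (a - 1) a) :=
    funext fun e => by rw [← H.htpy e a]; abel
  rw [h]
  exact (UnifBdd.const _).sub (((H.σ_bdd _ _).comp (.const _)).add ((UnifBdd.const _).comp
    (H.σ_bdd _ _)))

/-- The maps `θ : x ↦ f Λ(x) u` induce the identity on `B`, because `1 - f` lies in the kernel of `A
→ B` and `Λ` lifts the augmentation. The usual comparison of chain maps by projectivity then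
produces a homotopy, except that `θ` is not extended to a chain map: the failure `d - d σ d` tends
to zero pointwise, and its lifts are the maps `φ` in positive degrees. -/
theorem exists_approxRetraction [CompleteSpace A] [IsBanObj c A] (B : BanAlg c A)
    (K : ChainComplex (BanMod c A) ℕ) (hproj : ∀ n, FamilyProjective (K.X n))
    (hK : ∀ n, StrictExactAt (K.d (n + 2) (n + 1)) (K.d (n + 1) n)) (ε : K.X 0 ⟶ B.toMod)
    (hε : StrictExactAt (K.d 1 0) ε) (u : K.X 0) (hu : ε.lin u = (1 : B)) (Λ : K.X 0 ⟶ self c A)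
    (hΛ : ∀ x, algebraMap A B (Λ.lin x) = ε.lin x)
    (F : Cutoff (RingHom.ker (algebraMap A B))) : Nonempty (ApproxRetraction K u Λ.lin F) := by
  let θ : F.E → (K.X 0 ⟶ K.X 0) := fun e => Λ ≫ smulHom _ (F.f e) ≫ elemHom u
  have hθ : UnifBdd θ := (UnifBdd.const _).comp ((UnifBdd.smulHom F.bdd).comp (.const _))
  have hθε : ∀ e, θ e ≫ ε = ε := fun e => by
    ext x
    have h1 : algebraMap A B (F.f e) = 1 := by
      have := F.one_sub_mem e
      rw [RingHom.mem_ker, map_sub, map_one, sub_eq_zero] at this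
      exact this.symm
    change ε.lin ((F.f e * (show A from Λ.lin x)) • u) = _
    rw [map_smul, hu]
    refine (Algebra.smul_def (A := B) _ (1 : B)).trans ?_
    rw [mul_one, map_mul, h1, one_mul, hΛ]
  obtain ⟨hdε, Cε, hCε0, hCε⟩ := strictExactAt_iff.1 hε
  -- the initial homotopy
  obtain ⟨σ₀, h1, h2, -⟩ := hproj 0 (K.d 1 0) (fun e => 𝟙 _ - θ e) Cε hCε0
    ((UnifBdd.const _).sub hθ) fun e x => hCε _ (by
      have := congrArg (fun k : K.X 0 ⟶ B.toMod => k.lin x) (hθε e)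
      simp only [sub_eq_add_neg, add_lin, neg_lin, id_lin, map_add, map_neg]
      rw [← sub_eq_add_neg, sub_eq_zero]
      exact this.symm)
  -- A stage of the recursion consists of the homotopies out of degree `k`, together with the two
  -- facts needed to continue: uniform boundedness, and pointwise convergence to zero of the failure
  -- in degree `k + 1`.
  let St : ℕ → Type u := fun k => {σ : F.E → (K.X k ⟶ K.X (k + 1)) // UnifBdd σ ∧
    PtNull F.l fun e => K.d (k + 1) k - K.d (k + 1) k ≫ σ e ≫ K.d (k + 1) k}
  have hnull : PtNull F.l fun e => K.d 1 0 - K.d 1 0 ≫ σ₀ e ≫ K.d 1 0 := by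
    intro x
    have hx : (fun e => (K.d 1 0 - K.d 1 0 ≫ σ₀ e ≫ K.d 1 0).lin x) = fun e =>
        (F.f e * (show A from Λ.lin ((K.d 1 0).lin x))) • u := funext fun e => by
      rw [h1 e, Preadditive.comp_sub, Category.comp_id, sub_sub_cancel]
      rfl
    rw [hx]
    -- The only use of the cutoff property: `Λ (d x)` lies in the kernel of `A → B` because the
    -- augmentation kills boundaries.
    have ht := F.tendsto (Λ.lin ((K.d 1 0).lin x))
      (RingHom.mem_ker.2 ((hΛ _).trans (hdε x)))
    have := ((Hom.continuous (elemHom (c := c) u)).tendsto (0 : A)).comp ht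
    have h0 : (elemHom (c := c) u).lin (0 : A) = 0 := zero_smul A u
    rwa [h0] at this
  have step : ∀ k (s : St k), ∃ s' : St (k + 1), PtNull F.l fun e =>
      𝟙 _ - s'.1 e ≫ K.d (k + 2) (k + 1) - K.d (k + 1) k ≫ s.1 e := by
    rintro k ⟨σ, hσ, hn⟩
    -- The values of `d - d σ d` are cycles, hence boundaries with control of the norm. In degree
    -- zero the augmentation plays the role of the outgoing differential.
    have hlift : ∃ C : ℝ, 0 ≤ C ∧ ∀ y : K.X k, (∃ (e : F.E) (x : K.X (k + 1)),
        y = (K.d (k + 1) k - K.d (k + 1) k ≫ σ e ≫ K.d (k + 1) k).lin x) →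
          ∃ x, (K.d (k + 1) k).lin x = y ∧ ‖x‖ ≤ C * ‖y‖ := by
      cases k with
      | zero =>
        refine ⟨Cε, hCε0, fun y hy => hCε y ?_⟩
        obtain ⟨e, x, rfl⟩ := hy
        rw [sub_eq_add_neg, add_lin, neg_lin, map_add, map_neg, comp_lin, comp_lin, hdε, hdε]
        simp
      | succ k =>
        obtain ⟨hd, C, hC0, hC⟩ := strictExactAt_iff.1 (hK k)
        refine ⟨C, hC0, fun y hy => hC y ?_⟩
        obtain ⟨e, x, rfl⟩ := hy
        rw [sub_eq_add_neg, add_lin, neg_lin, map_add, map_neg, comp_lin, comp_lin, hd, hd]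
        simp
    obtain ⟨C, hC0, hC⟩ := hlift
    -- A lift of the failure along `d`; being a lift of a null family it is null, and it becomes `φ`
    -- in degree `k + 1`.
    obtain ⟨r, hr1, hr2, hr3⟩ := hproj (k + 1) (K.d (k + 1) k)
      (fun e => K.d (k + 1) k - K.d (k + 1) k ≫ σ e ≫ K.d (k + 1) k) C hC0
      ((UnifBdd.const _).sub ((UnifBdd.const _).comp (hσ.comp (.const _))))
      fun e x => hC _ ⟨e, x, rfl⟩
    obtain ⟨-, C', hC'0, hC'⟩ := strictExactAt_iff.1 (hK k)
    -- Subtracting `r` makes `1 - d σ - r` take values in the cycles, so it lifts to the next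
    -- homotopy. The new failure is `r` preceded by a differential, hence null again.
    obtain ⟨σ', hσ1, hσ2, -⟩ := hproj (k + 1) (K.d (k + 2) (k + 1))
      (fun e => 𝟙 _ - K.d (k + 1) k ≫ σ e - r e) C' hC'0
      (((UnifBdd.const _).sub ((UnifBdd.const _).comp hσ)).sub hr2) fun e x => hC' _ (by
        rw [← comp_lin]
        simp only [Preadditive.sub_comp, Category.id_comp, Category.assoc, hr1, sub_self,
          zero_lin])
    refine ⟨⟨σ', hσ2, ?_⟩, ?_⟩
    · have : ∀ e, K.d (k + 2) (k + 1) - K.d (k + 2) (k + 1) ≫ σ' e ≫ K.d (k + 2) (k + 1) =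
          K.d (k + 2) (k + 1) ≫ r e := fun e => by
        rw [hσ1]
        simp
      change PtNull F.l fun e => K.d (k + 2) (k + 1) -
        K.d (k + 2) (k + 1) ≫ σ' e ≫ K.d (k + 2) (k + 1)
      simp only [this]
      exact (hr3 F.l hn).comp_left _
    · have : ∀ e, 𝟙 _ - σ' e ≫ K.d (k + 2) (k + 1) - K.d (k + 1) k ≫ σ e = r e := fun e => by
        rw [hσ1]
        abel
      simp only [this]
      exact hr3 F.l hn
  choose next hnext using step
  let seq : ∀ k, St k := fun k => Nat.rec ⟨σ₀, h2, hnull⟩ next k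
  have hseq : ∀ k, seq (k + 1) = next k (seq k) := fun k => rfl
  let σ : F.E → ∀ a b, K.X a ⟶ K.X b := fun e a b =>
    if h : a + 1 = b then (seq a).1 e ≫ eqToHom (congrArg K.X h) else 0
  have hσ : ∀ e a, σ e a (a + 1) = (seq a).1 e := fun e a => by simp [σ]
  refine ⟨⟨σ, ?_, ?_, fun e a => 𝟙 _ - (σ e a (a + 1) ≫ K.d (a + 1) a +
    K.d a (a - 1) ≫ σ e (a - 1) a), ?_, ?_, ?_⟩⟩
  · intro a b
    by_cases h : a + 1 = b
    · subst h
      simp only [hσ]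
      exact (seq a).2.1
    · simp only [σ, dif_neg h]
      exact .const 0
  · intro e a b h
    simp only [σ, dif_neg h]
  · intro e x
    -- In degree zero the index `a - 1` is `0`, and the differential from degree zero to itself
    -- vanishes.
    rw [hσ, K.shape 0 (0 - 1) (by simp), zero_comp, add_zero]
    change (𝟙 _ - σ₀ e ≫ K.d 1 0).lin x = _
    rw [h1, sub_sub_cancel]
    rfl
  · intro a
    change PtNull F.l fun e => 𝟙 _ - (σ e (a + 1) (a + 1 + 1) ≫ K.d (a + 2) (a + 1) +
      K.d (a + 1) a ≫ σ e a (a + 1))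
    simp only [hσ, ← sub_sub]
    rw [hseq]
    exact hnext a (seq a)
  · intro e a
    simp

end BanMod

namespace BanMod

variable {c : BanKind} {A : Type u} [NormedCommRing A]

/-! ### Operators in one factor of a tensor product of complexes -/

section pi

variable {κ : Type} [Fintype κ] {E : Type*} {l : Filter E} {N : BanMod c A} {M : κ → BanMod c A}

theorem UnifBdd.piLift {f : E → ∀ i, N ⟶ M i} (hf : ∀ i, UnifBdd fun e => f e i) :
    UnifBdd fun e => piLift (f e) := by
  choose C hC0 hC using hf
  have h0 : 0 ≤ ∑ i, C i := Finset.sum_nonneg fun i _ => hC0 i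
  refine ⟨∑ i, C i, h0, fun e x => (pi_norm_le_iff_of_nonneg (by positivity)).2 fun i =>
    (hC i e x).trans ?_⟩
  gcongr
  exact Finset.single_le_sum (f := C) (fun i _ => hC0 i) (Finset.mem_univ i)

theorem PtNull.piLift {f : E → ∀ i, N ⟶ M i} (hf : ∀ i, PtNull l fun e => f e i) :
    PtNull l fun e => piLift (f e) := fun x => tendsto_pi_nhds.2 fun i => hf i x

end pi

section tot

variable {ι : Type} [Fintype ι]

theorem tot_ext {K : ι → ChainComplex (BanMod c A) ℕ} {n : ℕ} {x y : totX K n}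
    (h : ∀ q : TotIdx ι n, (totProj K n q.1).lin x = (totProj K n q.1).lin y) : x = y := by
  funext q
  have := h q
  rwa [← totProj_eq] at this

theorem tot_norm_le {K : ι → ChainComplex (BanMod c A) ℕ} {n : ℕ} {x : totX K n} {r : ℝ}
    (hr : 0 ≤ r) (h : ∀ q : TotIdx ι n, ‖(totProj K n q.1).lin x‖ ≤ r) : ‖x‖ ≤ r := by
  refine (pi_norm_le_iff_of_nonneg hr).2 fun q => ?_
  have := h q
  rwa [← totProj_eq] at this

theorem idOrZero_comp (L : ChainComplex (BanMod c A) ℕ) {a b k : ℕ} (h : a = b)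
    (f : ∀ a, L.X a ⟶ L.X k) : idOrZero L a b ≫ f b = f a := by
  subst h
  rw [idOrZero_self, Category.id_comp]

theorem comp_idOrZero (L : ChainComplex (BanMod c A) ℕ) {a b k : ℕ} (h : a = b)
    (f : ∀ a, L.X k ⟶ L.X a) : f a ≫ idOrZero L a b = f b := by
  subst h
  rw [idOrZero_self, Category.comp_id]

variable [LinearOrder ι] (K : ι → ChainComplex (BanMod c A) ℕ)

/-- The tensor product of the operator `f i` in the factor `i` and of the identities in the other
factors, as a map from multi-degree `q'` to multi-degree `q`. -/
noncomputable def tensorAct (f : ∀ j a b, (K j).X a ⟶ (K j).X b) (i : ι) (q' q : ι → ℕ) :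
    tensorAt K q' ⟶ tensorAt K q :=
  tensorMap fun j => if j = i then f j (q' j) (q j) else idOrZero (K j) (q' j) (q j)

/-- Operators in different factors commute without a sign; the signs are supplied by the total
complex. The hypotheses on the multi-degrees make the identities in the remaining factors honest
identities rather than zero. -/
theorem tensorAct_comm (f g : ∀ j a b, (K j).X a ⟶ (K j).X b) {i k : ι} (hik : i ≠ k)
    {q₁ q₂ q₃ r : ι → ℕ} (h12 : ∀ j, j ≠ i → q₁ j = q₂ j) (h23 : ∀ j, j ≠ k → q₂ j = q₃ j)
    (h1r : ∀ j, j ≠ k → q₁ j = r j) (hr3 : ∀ j, j ≠ i → r j = q₃ j) :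
    tensorAct K f i q₁ q₂ ≫ tensorAct K g k q₂ q₃ =
      tensorAct K g k q₁ r ≫ tensorAct K f i r q₃ := by
  simp only [tensorAct, tensorMap_comp]
  congr 1
  funext j
  by_cases hi : j = i
  · subst hi
    simp only [hik, if_true, if_false]
    rw [comp_idOrZero _ (h23 j hik) (f j (q₁ j)), idOrZero_comp _ (h1r j hik) fun a => f j a (q₃ j)]
  · by_cases hk : j = k
    · subst hk
      simp only [hi, if_true, if_false]
      rw [idOrZero_comp _ (h12 j hi) fun a => g j a (q₃ j), comp_idOrZero _ (hr3 j hi) (g j (q₁ j))]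
    · simp only [hi, hk, if_false]
      rw [comp_idOrZero _ (h23 j hk), comp_idOrZero _ (hr3 j hi)]

theorem tensorAct_eq_zero (f : ∀ j a b, (K j).X a ⟶ (K j).X b) (i : ι) (q' q : ι → ℕ)
    (h : f i (q' i) (q i) = 0) : tensorAct K f i q' q = 0 :=
  tensorMap_eq_zero _ i (by rw [if_pos rfl, h])

/-- The multi-index `q` decreased by one at `i`. -/
def lower (q : ι → ℕ) (i : ι) : ι → ℕ := Function.update q i (q i - 1)

@[simp] theorem lower_self (q : ι → ℕ) (i : ι) : lower q i i = q i - 1 := by simp [lower]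

theorem lower_ne (q : ι → ℕ) {i j : ι} (h : j ≠ i) : lower q i j = q j := by simp [lower, h]

theorem lower_bump (q : ι → ℕ) (i : ι) : lower (bump q i) i = q := by
  funext j
  by_cases hj : j = i
  · subst hj; simp
  · rw [lower_ne _ hj, bump_ne _ hj]

theorem bump_lower (q : ι → ℕ) (i : ι) (h : q i ≠ 0) : bump (lower q i) i = q := by
  funext j
  by_cases hj : j = i
  · subst hj; simp; omega
  · rw [bump_ne _ hj, lower_ne _ hj]

theorem koszulSign_mul_self (q : ι → ℕ) (i : ι) : koszulSign q i * koszulSign q i = 1 := by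
  rw [koszulSign, ← mul_pow]
  simp

/-- The homotopy on the total complex given by an operator of degree one in the factor `i`. -/
noncomputable def totS (σ : ∀ j a b, (K j).X a ⟶ (K j).X b) (i : ι) (n : ℕ) :
    totX K n ⟶ totX K (n + 1) :=
  piLift fun q => koszulSign q.1 i • (totProj K n (lower q.1 i) ≫ tensorAct K σ i (lower q.1 i) q.1)

theorem totS_proj (σ : ∀ j a b, (K j).X a ⟶ (K j).X b)
    (hσ : ∀ j a b, a + 1 ≠ b → σ j a b = 0) (i : ι) (n : ℕ) (q : ι → ℕ) :
    totS K σ i n ≫ totProj K (n + 1) q =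
      koszulSign q i • (totProj K n (lower q i) ≫ tensorAct K σ i (lower q i) q) := by
  by_cases h : ∑ i, q i = n + 1
  · have := totProj_eq K (n := n + 1) ⟨q, h⟩
    rw [← this, totS, piLift_proj]
  · rw [totProj, dif_neg h, comp_zero]
    -- If `q i = 0`, truncated subtraction makes `lower q i` equal to `q`, and the operator from
    -- degree zero to degree zero vanishes by `hσ`.
    by_cases hq : q i = 0
    · rw [tensorAct_eq_zero K σ i _ _ (hσ _ _ _ (by omega)), comp_zero, smul_zero]
    · have h' := sum_bump (lower q i) i
      rw [bump_lower q i hq] at h'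
      rw [totProj, dif_neg (by omega), zero_comp, smul_zero]

/-- The operator `φ i` in the factor `i`, on the total complex. -/
noncomputable def totDiag (φ : ∀ j a, (K j).X a ⟶ (K j).X a) (s : Finset ι) (n : ℕ) :
    totX K n ⟶ totX K n :=
  piLift fun q => totProj K n q.1 ≫ tensorMap fun j => if j ∈ s then φ j (q.1 j) else 𝟙 _

theorem totDiag_proj (φ : ∀ j a, (K j).X a ⟶ (K j).X a) (s : Finset ι) (n : ℕ) (q : ι → ℕ) :
    totDiag K φ s n ≫ totProj K n q =
      totProj K n q ≫ tensorMap fun j => if j ∈ s then φ j (q j) else 𝟙 _ := by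
  by_cases h : ∑ i, q i = n
  · have := totProj_eq K (n := n) ⟨q, h⟩
    rw [← this, totDiag, piLift_proj, this]
  · rw [totProj, dif_neg h, comp_zero, zero_comp]

section homotopy

variable {K} {σ : ∀ j a b, (K j).X a ⟶ (K j).X b} {φ : ∀ j a, (K j).X a ⟶ (K j).X a}

/-- Cross terms of the homotopy and the differential. Both operators have odd degree, so exchanging
them alters exactly one of the Koszul signs involved. -/
theorem totS_totD_cancel (hσ : ∀ j a b, a + 1 ≠ b → σ j a b = 0)
    {i j : ι} (hij : j ≠ i) (n : ℕ) (q : ι → ℕ) :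
    koszulSign q j • ((koszulSign (bump q j) i • (totProj K n (lower (bump q j) i) ≫
        tensorAct K σ i (lower (bump q j) i) (bump q j))) ≫ tensorD K j (bump q j) q) +
      koszulSign q i • ((koszulSign (lower q i) j • (totProj K n (bump (lower q i) j) ≫
        tensorD K j (bump (lower q i) j) (lower q i))) ≫ tensorAct K σ i (lower q i) q) = 0 := by
  by_cases hq : q i = 0
  · rw [tensorAct_eq_zero K σ i _ (bump q j) (hσ _ _ _ (by rw [bump_ne _ hij.symm]; omega)),
      tensorAct_eq_zero K σ i _ q (hσ _ _ _ (by omega))]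
    simp
  · obtain ⟨p, rfl⟩ : ∃ p, q = bump p i := ⟨lower q i, (bump_lower q i hq).symm⟩
    have h1 : lower (bump (bump p i) j) i = bump p j := by rw [bump_comm _ hij.symm, lower_bump]
    rw [lower_bump, h1]
    have h2 : tensorAct K σ i (bump p j) (bump (bump p i) j) ≫
        tensorD K j (bump (bump p i) j) (bump p i) =
          tensorD K j (bump p j) p ≫ tensorAct K σ i p (bump p i) := by
      refine tensorAct_comm K σ (fun j => (K j).d) hij.symm ?_ ?_ ?_ ?_ <;> intro k hk
      · rw [bump_comm _ hij.symm, bump_ne _ hk]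
      · rw [bump_ne _ hk]
      · rw [bump_ne _ hk]
      · rw [bump_ne _ hk]
    rw [Preadditive.zsmul_comp, Preadditive.zsmul_comp, Category.assoc, Category.assoc, h2,
      smul_smul, smul_smul, ← add_smul]
    have h3 : koszulSign (bump p i) j * koszulSign (bump (bump p i) j) i +
        koszulSign (bump p i) i * koszulSign p j = 0 := by
      rcases lt_or_gt_of_ne hij with h | h
      · rw [koszulSign_bump_of_lt _ h, koszulSign_bump_of_le _ h.le]
        ring
      · rw [koszulSign_bump_of_lt _ h, koszulSign_bump_of_le _ h.le,
          koszulSign_bump_of_le _ le_rfl]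
        ring
    rw [h3, zero_smul]

/-- The operator `σ d` in the factor `i`. -/
theorem totS_totD_diag (i : ι) (n : ℕ) (q : ι → ℕ) :
    koszulSign q i • ((koszulSign (bump q i) i • (totProj K n (lower (bump q i) i) ≫
        tensorAct K σ i (lower (bump q i) i) (bump q i))) ≫ tensorD K i (bump q i) q) =
      totProj K n q ≫ tensorMap fun j =>
        if j = i then σ j (q j) (q j + 1) ≫ (K j).d (q j + 1) (q j) else 𝟙 _ := by
  rw [lower_bump, koszulSign_bump_of_le _ le_rfl, Preadditive.zsmul_comp, smul_smul,
    koszulSign_mul_self, one_smul, Category.assoc, tensorAct, tensorD, tensorMap_comp]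
  congr 2
  funext j
  by_cases hj : j = i
  · subst hj
    rw [if_pos rfl, if_pos rfl, if_pos rfl, bump_self]
  · rw [if_neg hj, if_neg hj, if_neg hj, bump_ne _ hj, idOrZero_self]
    exact Category.comp_id _

theorem totD_totS_diag (hσ : ∀ j a b, a + 1 ≠ b → σ j a b = 0)
    (i : ι) (n : ℕ) (q : ι → ℕ) :
    koszulSign q i • ((koszulSign (lower q i) i • (totProj K n (bump (lower q i) i) ≫
        tensorD K i (bump (lower q i) i) (lower q i))) ≫ tensorAct K σ i (lower q i) q) =
      totProj K n q ≫ tensorMap fun j =>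
        if j = i then (K j).d (q j) (q j - 1) ≫ σ j (q j - 1) (q j) else 𝟙 _ := by
  by_cases hq : q i = 0
  · rw [tensorAct_eq_zero K σ i _ q (hσ _ _ _ (by omega)), tensorMap_eq_zero _ i]
    · simp
    · rw [if_pos rfl, hσ _ _ _ (by omega), comp_zero]
  · have h1 : koszulSign q i = koszulSign (lower q i) i := by
      conv_lhs => rw [← bump_lower q i hq, koszulSign_bump_of_le _ le_rfl]
    rw [h1, Preadditive.zsmul_comp, smul_smul, koszulSign_mul_self, one_smul, bump_lower q i hq,
      Category.assoc, tensorAct, tensorD, tensorMap_comp]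
    congr 2
    funext j
    by_cases hj : j = i
    · subst hj
      rw [if_pos rfl, if_pos rfl, if_pos rfl, lower_self]
    · rw [if_neg hj, if_neg hj, if_neg hj, lower_ne _ hj, idOrZero_self]
      exact Category.comp_id _

/-- The homotopy identity of the factor `i`, tensored with the identities of the other factors. -/
theorem tensorMap_htpy (hφ : ∀ j a, σ j a (a + 1) ≫ (K j).d (a + 1) a +
      (K j).d a (a - 1) ≫ σ j (a - 1) a + φ j a = 𝟙 _)
    (i : ι) (q : ι → ℕ) :
    (tensorMap fun j => if j = i then σ j (q j) (q j + 1) ≫ (K j).d (q j + 1) (q j) else 𝟙 _) +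
      (tensorMap fun j =>
        if j = i then (K j).d (q j) (q j - 1) ≫ σ j (q j - 1) (q j) else 𝟙 _) +
      (tensorMap fun j => if j ∈ ({i} : Finset ι) then φ j (q j) else 𝟙 _) =
        𝟙 (tensorAt K q) := by
  rw [← tensorMap_id, eq_comm, tensorMap_eq_add (g := fun j =>
    if j = i then σ j (q j) (q j + 1) ≫ (K j).d (q j + 1) (q j) +
      (K j).d (q j) (q j - 1) ≫ σ j (q j - 1) (q j) else 𝟙 _)
    (h := fun j => if j ∈ ({i} : Finset ι) then φ j (q j) else 𝟙 _) i, tensorMap_eq_add i]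
  · simp
  · intro j hj; simp [hj]
  · intro j hj; simp [hj]
  · simp [hφ]
  · intro j hj; simp [hj]
  · intro j hj; simp [hj]

/-- In total degree zero all multi-degrees vanish, so the summand `d σ` of the factor `i` is zero
and every cross term is zero by itself. -/
theorem totS_htpy_zero (hσ : ∀ j a b, a + 1 ≠ b → σ j a b = 0)
    (hφ : ∀ j a, σ j a (a + 1) ≫ (K j).d (a + 1) a +
      (K j).d a (a - 1) ≫ σ j (a - 1) a + φ j a = 𝟙 _)
    (i : ι) : totS K σ i 0 ≫ totD K 0 + totDiag K φ {i} 0 = 𝟙 _ := by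
  refine tot_hom_ext K fun q => ?_
  have hq : ∀ j, q.1 j = 0 := fun j =>
    (Finset.sum_eq_zero_iff.1 q.2) j (Finset.mem_univ j)
  rw [Preadditive.add_comp, Category.assoc, totD_proj, Preadditive.comp_sum, totDiag_proj,
    Category.id_comp]
  simp only [Preadditive.comp_zsmul, ← Category.assoc, totS_proj K σ hσ]
  rw [Finset.sum_eq_single i, totS_totD_diag]
  · rw [← Preadditive.comp_add]
    have := tensorMap_htpy hφ i q.1
    rw [tensorMap_eq_zero (fun j => if j = i then (K j).d (q.1 j) (q.1 j - 1) ≫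
      σ j (q.1 j - 1) (q.1 j) else 𝟙 _) i, add_zero] at this
    · rw [this, Category.comp_id]
    · rw [if_pos rfl, hσ _ _ _ (by rw [hq]; omega), comp_zero]
  · intro j _ hj
    rw [tensorAct_eq_zero K σ i _ _ (hσ _ _ _ (by rw [bump_ne _ hj.symm, hq]; omega))]
    simp
  · simp

/-- The cross terms with the differentials of the factors `j ≠ i` cancel in pairs, and the remaining
terms reproduce the homotopy identity of the factor `i`. -/
theorem totS_htpy_succ (hσ : ∀ j a b, a + 1 ≠ b → σ j a b = 0)
    (hφ : ∀ j a, σ j a (a + 1) ≫ (K j).d (a + 1) a +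
      (K j).d a (a - 1) ≫ σ j (a - 1) a + φ j a = 𝟙 _)
    (i : ι) (n : ℕ) :
    totS K σ i (n + 1) ≫ totD K (n + 1) + totD K n ≫ totS K σ i n + totDiag K φ {i} (n + 1) =
      𝟙 _ := by
  refine tot_hom_ext K fun q => ?_
  rw [Preadditive.add_comp, Preadditive.add_comp, Category.assoc, Category.assoc, totD_proj,
    Preadditive.comp_sum, totDiag_proj, totS_proj K σ hσ, Category.id_comp]
  simp only [Preadditive.comp_zsmul, ← Category.assoc, totS_proj K σ hσ, totD_proj]
  rw [Preadditive.sum_comp, Finset.smul_sum, ← Finset.sum_add_distrib, Finset.sum_eq_single i,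
    totS_totD_diag, totD_totS_diag hσ, ← Preadditive.comp_add, ← Preadditive.comp_add,
    tensorMap_htpy hφ, Category.comp_id]
  · intro j _ hj
    exact totS_totD_cancel hσ hj _ _
  · simp

end homotopy

end tot

end BanMod

namespace BanMod

variable {c : BanKind} {A : Type u} [NormedCommRing A]

/-- The constant takes care of the empty product, as `‖1‖ = 1` is not assumed. -/
theorem norm_prod_le_max_one {ι : Type*} (s : Finset ι) (a : ι → A) :
    ‖∏ i ∈ s, a i‖ ≤ max 1 ‖(1 : A)‖ * ∏ i ∈ s, ‖a i‖ := by
  by_cases h : s.Nonempty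
  · refine (Finset.norm_prod_le' _ h _).trans ?_
    exact le_mul_of_one_le_left (Finset.prod_nonneg fun _ _ => norm_nonneg _) (le_max_left _ _)
  · rw [Finset.not_nonempty_iff_eq_empty.1 h]
    simp

/-! ### Tensor products of approximately retractible complexes -/

section retraction

theorem norm_sub_le_of_bound {M N : BanMod c A} (f : M ⟶ N) {C : ℝ} (hC : ∀ x, ‖f.lin x‖ ≤ C * ‖x‖)
    (x y : M) : ‖f.lin x - f.lin y‖ ≤ C * ‖x - y‖ := by
  rw [← map_sub]
  exact hC _

variable {ι : Type} [Fintype ι] [LinearOrder ι] {K : ι → ChainComplex (BanMod c A) ℕ}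
  {u : ∀ i, (K i).X 0} {Λ : ∀ i, (K i).X 0 →ₗ[A] A} {I : ι → Ideal A} {F : ∀ i, Cutoff (I i)}

theorem totS_unifBdd (H : ∀ i, ApproxRetraction (K i) (u i) (Λ i) (F i))
    (i : ι) (n : ℕ) :
    UnifBdd fun e : ∀ i, (F i).E => totS K (fun j => (H j).σ (e j)) i n := by
  refine UnifBdd.piLift fun q => ?_
  simp only [← Preadditive.comp_zsmul]
  refine (UnifBdd.const _).comp ?_
  have : UnifBdd fun e : ∀ i, (F i).E =>
      tensorAct K (fun j => (H j).σ (e j)) i (lower q.1 i) q.1 := by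
    refine UnifBdd.tensorMap fun j => ?_
    by_cases hj : j = i
    · simp only [if_pos hj]
      obtain ⟨C, hC0, hC⟩ := (H j).σ_bdd (lower q.1 i j) (q.1 j)
      exact ⟨C, hC0, fun e => hC (e j)⟩
    · simp only [if_neg hj]
      exact .const _
  have h2 : (fun e : ∀ i, (F i).E => koszulSign q.1 i •
      tensorAct K (fun j => (H j).σ (e j)) i (lower q.1 i) q.1) = fun e =>
      tensorAct K (fun j => (H j).σ (e j)) i (lower q.1 i) q.1 ≫ (koszulSign q.1 i • 𝟙 _) := by
    funext e
    rw [Preadditive.comp_zsmul, Category.comp_id]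
  rw [h2]
  exact this.comp (.const _)

theorem tensorMap_diag_unifBdd (H : ∀ i, ApproxRetraction (K i) (u i) (Λ i) (F i))
    (s : Finset ι) (q : ι → ℕ) :
    UnifBdd fun e : ∀ i, (F i).E => tensorMap (M := fun j => (K j).X (q j))
      fun j => if j ∈ s then (H j).φ (e j) (q j) else 𝟙 _ := by
  refine UnifBdd.tensorMap fun j => ?_
  by_cases hj : j ∈ s
  · simp only [if_pos hj]
    obtain ⟨C, hC0, hC⟩ := (H j).φ_bdd (q j)
    exact ⟨C, hC0, fun e => hC (e j)⟩
  · simp only [if_neg hj]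
    exact .const _

theorem totDiag_unifBdd (H : ∀ i, ApproxRetraction (K i) (u i) (Λ i) (F i))
    (s : Finset ι) (n : ℕ) :
    UnifBdd fun e : ∀ i, (F i).E => totDiag K (fun j => (H j).φ (e j)) s n :=
  UnifBdd.piLift fun q => (UnifBdd.const _).comp (tensorMap_diag_unifBdd H s q.1)

/-- The part of the operator `φ i` in the factor `i` which belongs to multi-degrees which are
positive at `i`. -/
theorem totDiag_ptNull (H : ∀ i, ApproxRetraction (K i) (u i) (Λ i) (F i))
    (i : ι) (n : ℕ) :
    PtNull (Filter.pi fun i => (F i).l) fun e : ∀ i, (F i).E =>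
      piLift fun q : TotIdx ι n => if q.1 i = 0 then 0 else
        totDiag K (fun j => (H j).φ (e j)) {i} n ≫ totProj K n q.1 := by
  refine PtNull.piLift fun q => ?_
  by_cases hq : q.1 i = 0
  · simp only [if_pos hq]
    exact fun x => tendsto_const_nhds
  · simp only [if_neg hq, totDiag_proj]
    refine PtNull.comp_left ?_ _
    refine PtNull.tensorMap (fun j => ?_) i ?_
    · by_cases hj : j ∈ ({i} : Finset ι)
      · simp only [if_pos hj]
        obtain ⟨C, hC0, hC⟩ := (H j).φ_bdd (q.1 j)
        exact ⟨C, hC0, fun e => hC (e j)⟩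
      · simp only [if_neg hj]
        exact .const _
    · simp only [Finset.mem_singleton, if_true]
      obtain ⟨k, hk⟩ := Nat.exists_eq_succ_of_ne_zero hq
      rw [hk]
      exact fun x => ((H i).φ_null k x).comp (tendsto_eval_pi _ i)

/-- The factors are treated one at a time. On a cycle the homotopy in the factor `i` leaves, modulo
boundaries, only `φ` applied in that factor; its components of positive degree at `i` tend to zero.
Hence up to a small error the cycle can be moved into degree zero at every `i ∈ s`. The constant is
independent of the index `e` of the cutoffs, which is chosen last. -/
theorem tot_approx_pos (H : ∀ i, ApproxRetraction (K i) (u i) (Λ i) (F i))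
    (n : ℕ) (s : Finset ι) : ∃ C : ℝ, 0 ≤ C ∧ ∀ y : totX K (n + 1),
    (totD K n).lin y = 0 → ∀ ε > 0, ∃ x w, ‖x‖ ≤ C * ‖y‖ ∧ ‖y - (totD K (n + 1)).lin x - w‖ ≤ ε ∧
      ∀ q : TotIdx ι (n + 1), (∃ i ∈ s, q.1 i ≠ 0) → (totProj K (n + 1) q.1).lin w = 0 := by
  classical
  induction s using Finset.induction_on with
  | empty => exact ⟨0, le_rfl, fun y _ ε hε => ⟨0, y, by simp, by simpa using hε.le, by simp⟩⟩
  | insert i s his ih =>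
    obtain ⟨C, hC0, hC⟩ := ih
    obtain ⟨D, hD0, hD⟩ := exists_nonneg_bound (totD K (n + 1)).bdd
    obtain ⟨CS, hS0, hS⟩ := totS_unifBdd H i (n + 1)
    obtain ⟨CF, hF0, hF⟩ := totDiag_unifBdd H {i} (n + 1)
    refine ⟨C + CS * (1 + D * C), by positivity, fun y hy ε hε => ?_⟩
    -- The operator applied next may enlarge the error by the factor `CF`. This bound is uniform in
    -- `e`, so `w` can be fixed before `e` is chosen in terms of `w`.
    obtain ⟨x, w, hx, hw, hw0⟩ := hC y hy (ε / 2 / (CF + 1)) (by positivity)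
    have hev := (Metric.tendsto_nhds.1 (totDiag_ptNull H i (n + 1) w)) (ε / 2) (by positivity)
    obtain ⟨e, he⟩ := hev.exists
    rw [dist_zero_right] at he
    set y₁ := y - (totD K (n + 1)).lin x with hy₁
    have hDy₁ : (totD K n).lin y₁ = 0 := by
      rw [hy₁, map_sub, hy, ← comp_lin, totD_sq, zero_lin, sub_zero]
    have hny₁ : ‖y₁‖ ≤ (1 + D * C) * ‖y‖ := by
      refine (norm_sub_le _ _).trans ?_
      rw [add_mul, one_mul, mul_assoc]
      gcongr
      exact (hD x).trans (mul_le_mul_of_nonneg_left hx hD0)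
    -- Since `y₁` is a cycle, the identity reads `d (S y₁) + Φ y₁ = y₁`.
    have hht := congrArg (fun k : totX K (n + 1) ⟶ totX K (n + 1) => k.lin y₁)
      (totS_htpy_succ (K := K) (fun j => (H j).σ_eq_zero (e j)) (fun j => (H j).htpy (e j)) i n)
    simp only [add_lin, comp_lin, hDy₁, map_zero, add_zero, id_lin] at hht
    set S := totS K (fun j => (H j).σ (e j)) i (n + 1)
    set Φ := totDiag K (fun j => (H j).φ (e j)) {i} (n + 1) with hΦ
    set R : totX K (n + 1) ⟶ totX K (n + 1) := piLift fun q : TotIdx ι (n + 1) =>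
      if q.1 i = 0 then 0 else Φ ≫ totProj K (n + 1) q.1
    -- `R` extracts from `Φ` the components of positive degree at `i`. Removing them exactly costs
    -- the small term `R w`, and the vanishing already achieved for `s` persists because `Φ`
    -- preserves multi-degrees.
    refine ⟨x + S.lin y₁, Φ.lin w - R.lin w, ?_, ?_, ?_⟩
    · refine (norm_add_le _ _).trans ?_
      rw [add_mul, mul_assoc CS]
      exact add_le_add hx ((hS e y₁).trans (mul_le_mul_of_nonneg_left hny₁ hS0))
    · have h1 : y - (totD K (n + 1)).lin (x + S.lin y₁) - (Φ.lin w - R.lin w) =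
          (Φ.lin y₁ - Φ.lin w) + R.lin w := by
        have h2 : Φ.lin y₁ = y₁ - (totD K (n + 1)).lin (S.lin y₁) :=
          eq_sub_of_add_eq' hht
        rw [map_add, ← sub_sub, ← hy₁, h2]
        abel
      rw [h1]
      refine (norm_add_le _ _).trans ?_
      have h2 : ‖Φ.lin y₁ - Φ.lin w‖ ≤ ε / 2 := by
        refine (norm_sub_le_of_bound Φ (hF e) _ _).trans ?_
        have : CF * ‖y₁ - w‖ ≤ (CF + 1) * (ε / 2 / (CF + 1)) := by gcongr; linarith
        rwa [mul_div_cancel₀ _ (by positivity)] at this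
      linarith
    · intro q hq
      have hR : (totProj K (n + 1) q.1).lin (R.lin w) =
          (if q.1 i = 0 then 0 else Φ ≫ totProj K (n + 1) q.1).lin w := by
        have := totProj_eq K q
        exact (congrArg (fun k : totX K (n + 1) ⟶ tensorAt K q.1 => k.lin (R.lin w)) this).symm
      rw [map_sub, hR]
      by_cases hi : q.1 i = 0
      · rw [if_pos hi, zero_lin, sub_zero, ← comp_lin, hΦ, totDiag_proj, comp_lin, hw0 q, map_zero]
        obtain ⟨j, hj, hqj⟩ := hq
        rcases Finset.mem_insert.1 hj with rfl | hj
        · exact (hqj hi).elim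
        · exact ⟨j, hj, hqj⟩
      · rw [if_neg hi, comp_lin, sub_self]

/-- In positive total degree every multi-degree is positive at some factor, so once all factors have
been treated the remainder `w` is zero. -/
theorem tot_strictExactAt_pos (H : ∀ i, ApproxRetraction (K i) (u i) (Λ i) (F i))
    (n : ℕ) : StrictExactAt (totD K (n + 1)) (totD K n) := by
  obtain ⟨C, hC0, hC⟩ := tot_approx_pos H n Finset.univ
  refine strictExactAt_of_approx (fun x => ?_) hC0 fun y hy ε hε => ?_
  · rw [← comp_lin, totD_sq, zero_lin]
  · obtain ⟨x, w, hx, hw, hw0⟩ := hC y hy ε hε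
    have : w = 0 := tot_ext fun q => by
      rw [map_zero]
      refine hw0 q ?_
      by_contra! h
      have := Finset.sum_eq_zero h
      have := q.2
      omega
    rw [this, sub_zero] at hw
    exact ⟨x, hx, hw⟩

theorem totDiag_comp_zero (φ : ∀ j a, (K j).X a ⟶ (K j).X a) {s : Finset ι} {i : ι} (hi : i ∉ s)
    (n : ℕ) : totDiag K φ s n ≫ totDiag K φ {i} n = totDiag K φ (insert i s) n := by
  refine tot_hom_ext K fun q => ?_
  rw [Category.assoc, totDiag_proj, totDiag_proj, ← Category.assoc, totDiag_proj, Category.assoc,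
    tensorMap_comp]
  congr 2
  funext j
  by_cases hj : j = i
  · subst hj; simp [hi]
  · simp [hj]

/-- In degree zero no cycle condition intervenes. Modulo boundaries of controlled norm, `y` may be
replaced by its image under `φ` in all the factors of `s`, exactly and for each `e`, with a constant
independent of `e`. -/
theorem tot_approx_zero (H : ∀ i, ApproxRetraction (K i) (u i) (Λ i) (F i))
    (s : Finset ι) : ∃ C : ℝ, 0 ≤ C ∧ ∀ (e : ∀ i, (F i).E) (y : totX K 0),
    ∃ x, ‖x‖ ≤ C * ‖y‖ ∧
      y - (totD K 0).lin x = (totDiag K (fun j => (H j).φ (e j)) s 0).lin y := by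
  classical
  induction s using Finset.induction_on with
  | empty =>
    refine ⟨0, le_rfl, fun e y => ⟨0, by simp, ?_⟩⟩
    refine tot_ext fun q => ?_
    rw [← comp_lin _ (totProj K 0 q.1), totDiag_proj]
    simp [tensorMap_id]
  | insert i s his ih =>
    obtain ⟨C, hC0, hC⟩ := ih
    obtain ⟨D, hD0, hD⟩ := exists_nonneg_bound (totD K 0).bdd
    obtain ⟨CS, hS0, hS⟩ := totS_unifBdd H i 0
    refine ⟨C + CS * (1 + D * C), by positivity, fun e y => ?_⟩
    obtain ⟨x, hx, hxy⟩ := hC e y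
    set y₁ := y - (totD K 0).lin x with hy₁
    have hny₁ : ‖y₁‖ ≤ (1 + D * C) * ‖y‖ := by
      refine (norm_sub_le _ _).trans ?_
      rw [add_mul, one_mul, mul_assoc]
      gcongr
      exact (hD x).trans (mul_le_mul_of_nonneg_left hx hD0)
    have hht := congrArg (fun k : totX K 0 ⟶ totX K 0 => k.lin y₁)
      (totS_htpy_zero (K := K) (fun j => (H j).σ_eq_zero (e j)) (fun j => (H j).htpy (e j)) i)
    simp only [add_lin, comp_lin, id_lin] at hht
    refine ⟨x + (totS K (fun j => (H j).σ (e j)) i 0).lin y₁, ?_, ?_⟩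
    · refine (norm_add_le _ _).trans ?_
      rw [add_mul, mul_assoc CS]
      exact add_le_add hx ((hS e y₁).trans (mul_le_mul_of_nonneg_left hny₁ hS0))
    · rw [← totDiag_comp_zero _ his, comp_lin, ← hxy, map_add, ← sub_sub, ← hy₁, sub_eq_iff_eq_add',
        hht]

variable [CompleteSpace A] [IsBanObj c A]

/-- The tensor product of linear forms. -/
noncomputable def tensorForm (M : ι → BanMod c A) (Λ : ∀ i, M i →ₗ[A] A)
    (hΛ : ∀ i, ∃ C : ℝ, ∀ x, ‖Λ i x‖ ≤ C * ‖x‖) : tensor M ⟶ self c A :=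
  tensorLift (N := self c A) ((MultilinearMap.mkPiAlgebra A ι A).compLinearMap Λ) (by
    choose C hC0 hC using fun i => exists_nonneg_bound (hΛ i)
    refine ⟨max 1 ‖(1 : A)‖ * ∏ i, C i, fun m => ?_⟩
    change ‖∏ i, Λ i (m i)‖ ≤ _
    refine (norm_prod_le_max_one _ _).trans ?_
    rw [mul_assoc, ← Finset.prod_mul_distrib]
    gcongr with i
    exact hC i (m i))

@[simp] theorem tensorForm_tmk (M : ι → BanMod c A) (Λ : ∀ i, M i →ₗ[A] A)
    (hΛ : ∀ i, ∃ C : ℝ, ∀ x, ‖Λ i x‖ ≤ C * ‖x‖) (m : ∀ i, M i) :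
    (tensorForm M Λ hΛ).lin (tmk m) = ∏ i, Λ i (m i) :=
  tensorLift_tmk _ _ m

/-- In degree zero each `φ` factors over `A`; their tensor product therefore factors over `A`
through the tensor product of the linear forms, and the cutoffs multiply. -/
theorem tensorMap_φ_zero (H : ∀ i, ApproxRetraction (K i) (u i) (Λ i) (F i))
    (hΛ : ∀ i, ∃ C : ℝ, ∀ x, ‖Λ i x‖ ≤ C * ‖x‖) (e : ∀ i, (F i).E) (y : tensor fun i => (K i).X 0) :
    (tensorMap fun j => (H j).φ (e j) 0).lin y =
      ((∏ i, (F i).f (e i)) * (show A from (tensorForm _ Λ hΛ).lin y)) • tmk u := by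
  have h : (tensorMap fun j => (H j).φ (e j) 0) =
      tensorForm _ Λ hΛ ≫ smulHom _ (∏ i, (F i).f (e i)) ≫ elemHom (tmk u) := by
    refine tensor_hom_ext fun m => ?_
    have h1 : (tensorForm _ Λ hΛ ≫ smulHom _ (∏ i, (F i).f (e i)) ≫ elemHom (tmk u)).lin (tmk m) =
        ((∏ i, (F i).f (e i)) * ∏ i, Λ i (m i)) • tmk u :=
      congrArg (fun a : A => ((∏ i, (F i).f (e i)) * a) • tmk u) (tensorForm_tmk _ Λ hΛ m)
    rw [h1, tensorMap_tmk]
    simp only [ApproxRetraction.φ_zero]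
    rw [← tmkMultilinear_apply, MultilinearMap.map_smul_univ, Finset.prod_mul_distrib]
    rfl
  rw [h]
  rfl

/-- The total complex of approximately retractible complexes in degree zero. -/
theorem tot_exact_zero (H : ∀ i, ApproxRetraction (K i) (u i) (Λ i) (F i))
    (hΛ : ∀ i, ∃ C : ℝ, ∀ x, ‖Λ i x‖ ≤ C * ‖x‖) (J : Ideal A)
    (hJ : ∀ a ∈ J, ∀ ε > 0, ∃ e : ∀ i, (F i).E, ‖(∏ i, (F i).f (e i)) * a‖ ≤ ε) :
    ∃ C : ℝ, 0 ≤ C ∧ ∀ y : totX K 0,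
      (show A from (tensorForm _ Λ hΛ).lin ((totProj K 0 fun _ => 0).lin y)) ∈ J →
        ∃ x, (totD K 0).lin x = y ∧ ‖x‖ ≤ C * ‖y‖ := by
  obtain ⟨C, hC0, hC⟩ := tot_approx_zero H Finset.univ
  let π : totX K 0 ⟶ self c A := totProj K 0 (fun _ => 0) ≫ tensorForm _ Λ hΛ
  -- The elements whose form lies in `J`. The residues are multiples of `tmk u` by elements of the
  -- ideal `J`, so they stay in `Z` and become small with the product of the cutoffs.
  let Z : AddSubgroup (totX K 0) :=
    (Submodule.comap π.lin (show Submodule A A from J)).toAddSubgroup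
  refine ⟨2 * C, by positivity, fun y hy =>
    exists_preimage_of_approx (totD K 0) Z hC0 (fun y hy ε hε => ?_) (y := y) hy⟩
  obtain ⟨e, he⟩ := hJ _ hy (ε / (‖tmk u‖ + 1)) (by positivity)
  obtain ⟨x, hx, hxy⟩ := hC e y
  have hzero : ∀ q : TotIdx ι 0, q.1 = fun _ => 0 := fun q => funext fun j =>
    (Finset.sum_eq_zero_iff.1 q.2) j (Finset.mem_univ j)
  have key : (totProj K 0 fun _ => 0).lin (y - (totD K 0).lin x) =
      ((∏ i, (F i).f (e i)) * (show A from π.lin y)) • tmk u := by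
    rw [hxy, ← comp_lin, totDiag_proj]
    simp only [Finset.mem_univ, if_true]
    exact tensorMap_φ_zero H hΛ e _
  refine ⟨x, hx, tot_norm_le hε.le fun q => ?_, ?_⟩
  · rw [hzero q, key]
    refine (norm_tensor_smul_le _ _).trans ?_
    have : ‖(∏ i, (F i).f (e i)) * (show A from π.lin y)‖ * ‖tmk u‖ ≤
        ε / (‖tmk u‖ + 1) * (‖tmk u‖ + 1) := by
      exact mul_le_mul he (by linarith) (norm_nonneg _) (by positivity)
    rwa [div_mul_cancel₀ _ (by positivity)] at this
  · change (show A from (tensorForm _ Λ hΛ).lin ((totProj K 0 fun _ => 0).lin _)) ∈ J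
    rw [key]
    have h1 : (tensorForm _ Λ hΛ).lin (((∏ i, (F i).f (e i)) * (show A from π.lin y)) • tmk u) =
      ((∏ i, (F i).f (e i)) * (show A from π.lin y)) * (show A from
        (tensorForm _ Λ hΛ).lin (tmk u)) := map_smul _ _ _
    rw [h1]
    exact J.mul_mem_right _ (J.mul_mem_left _ hy)

end retraction

end BanMod

/-! ### Approximation in completed tensor products by finite sums of pure tensors -/

namespace BanMod

variable {c : BanKind} {A : Type u} [NormedCommRing A] {ι : Type} [Fintype ι] {M : ι → BanMod c A}

/-- One `ε` is lost in passing to an algebraic tensor, the other in choosing an expression of it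
whose size is close to the infimum. -/
theorem exists_list_approx (y : tensor M) {ε : ℝ} (hε : 0 < ε) : ∃ l : List (A × ∀ i, M i),
    ‖y - (l.map fun x => x.1 • tmk x.2).sum‖ ≤ ε ∧ tensorCost M l ≤ 2 * ε + ‖y‖ := by
  let mk : (PiTensorProduct A fun i => M i) →ₗ[A] tensor M := completionMk (tensorSeminorm M)
  obtain ⟨t, ht⟩ : ∃ t, ‖y - mk t‖ ≤ ε := by
    obtain ⟨t, ht⟩ := (UniformSpace.Completion.denseRange_coe
      (α := (tensorSeminorm M).Space)).exists_dist_lt y hε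
    exact ⟨t, (dist_eq_norm y (mk t)).symm.trans_le ht.le⟩
  obtain ⟨l, hl, hl'⟩ := exists_tensorRep_lt M t hε
  refine ⟨l, ?_, ?_⟩
  · have : (l.map fun x => x.1 • tmk x.2).sum = mk t := by
      rw [← hl, map_list_sum, List.map_map]
      congr 1
      exact List.map_congr_left fun x _ => (map_smul mk x.1 _).symm
    rwa [this]
  · have h1 : tensorNorm M t = ‖mk t‖ := (norm_completionMk (tensorSeminorm M) t).symm
    have h2 := norm_sub_norm_le (mk t) y
    rw [norm_sub_rev] at h2
    linarith

end BanMod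

/-! ### Tensor products of quotient algebras -/

namespace BanAlg

open BanMod

variable {c : BanKind} {A : Type u} [NormedCommRing A]

/-- The structure morphism of `B` admits lifts of controlled norm. -/
def HasBddLift (B : BanAlg c A) : Prop :=
  ∃ C : ℝ, 0 ≤ C ∧ ∀ b : B, ∃ a : A, algebraMap A B a = b ∧ ‖a‖ ≤ C * ‖b‖

/-- The kernel of the structure morphism. -/
abbrev idl (B : BanAlg c A) : Ideal A := RingHom.ker (algebraMap A B)

variable {ι : Type} [Fintype ι] {B : ι → BanAlg c A}

variable (B) in
/-- The unit of the tensor product of the algebras `B i`. -/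
noncomputable def unitTensor : tensor fun i => (B i).toMod :=
  tmk (M := fun i => (B i).toMod) fun i => (1 : B i)

theorem prod_smul_unitTensor (a : ι → A) :
    (∏ i, a i) • unitTensor B =
      tmk (M := fun i => (B i).toMod) fun i => algebraMap A (B i) (a i) := by
  have h := (tmkMultilinear fun i => (B i).toMod).map_smul_univ a fun i => (1 : B i)
  refine h.symm.trans (congrArg tmk (funext fun i => ?_))
  exact (Algebra.algebraMap_eq_smul_one (A := B i) (a i)).symm

/-- A scalar may be moved into any one factor; in the factor `i` it acts through its image in `B i`,
which is zero. -/
theorem smul_unitTensor_eq_zero {a : A} {i : ι} (h : a ∈ (B i).idl) : a • unitTensor B = 0 := by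
  classical
  have h1 : a = ∏ j, if j = i then a else 1 := by simp
  rw [h1, prod_smul_unitTensor]
  exact tmk_eq_zero i (by rw [if_pos rfl]; exact h)

variable [CompleteSpace A] [IsBanObj c A]

/-- Lifting the entries of a finite sum of pure tensors turns the sum into a multiple of the unit
tensor, with multiplier bounded by the size of the expression. So the tensor product is a quotient
of `A`, with control of the norm. -/
theorem exists_smul_unitTensor (hB : ∀ i, (B i).HasBddLift) : ∃ C : ℝ, 0 ≤ C ∧
    ∀ y : tensor fun i => (B i).toMod, ∃ a : A, a • unitTensor B = y ∧ ‖a‖ ≤ C * ‖y‖ := by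
  choose C hC0 lift hlift hliftn using hB
  set D : ℝ := max 1 ‖(1 : A)‖ * ∏ i, C i with hD
  have hp : 0 ≤ ∏ i, C i := Finset.prod_nonneg fun i _ => hC0 i
  have hD0 : 0 ≤ D := by positivity
  refine ⟨2 * (3 * D), by positivity, fun y => ?_⟩
  refine exists_preimage_of_approx (elemHom (c := c) (unitTensor B)) ⊤ (C := 3 * D) (by positivity)
    (fun y _ ε hε => ?_) (y := y) trivial
  by_cases hy : y = 0
  · exact ⟨0, by simp [hy], by rw [hy, map_zero, sub_zero, norm_zero]; exact hε.le, trivial⟩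
  have hy' : 0 < ‖y‖ := norm_pos_iff.2 hy
  -- With tolerance at most `‖y‖`, the size of the expression is at most `3 * ‖y‖`. The tolerance is
  -- positive only for `y ≠ 0`.
  obtain ⟨l, hl, hl'⟩ := exists_list_approx y (lt_min hε hy')
  let a : A := (l.map fun x => x.1 * ∏ i, lift i (x.2 i)).sum
  refine ⟨a, ?_, ?_, trivial⟩
  · have := norm_list_sum_le (self c A) l (fun x => x.1 * ∏ i, lift i (x.2 i))
      (fun x => ‖x.1‖ * ∏ i, ‖x.2 i‖) D (fun x _ => ?_) hD0
    · refine this.trans ?_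
      change D * tensorCost _ l ≤ _
      have := hl'.trans (add_le_add_left
        (mul_le_mul_of_nonneg_left (min_le_right _ _) zero_le_two) _)
      nlinarith
    · refine (norm_mul_le x.1 (∏ i, lift i (x.2 i))).trans ?_
      have h1 : ‖∏ i, lift i (x.2 i)‖ ≤ D * ∏ i, ‖x.2 i‖ := by
        refine (norm_prod_le_max_one _ _).trans ?_
        rw [hD, mul_assoc, ← Finset.prod_mul_distrib]
        gcongr with i
        exact hliftn i _
      calc ‖x.1‖ * ‖∏ i, lift i (x.2 i)‖ ≤ ‖x.1‖ * (D * ∏ i, ‖x.2 i‖) := by gcongr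
        _ = _ := by ring
  · have h1 : (elemHom (c := c) (unitTensor B)).lin a = (l.map fun x => x.1 • tmk x.2).sum := by
      change (l.map fun x => x.1 * ∏ i, lift i (x.2 i)).sum • unitTensor B = _
      rw [List.sum_smul, List.map_map]
      congr 1
      refine List.map_congr_left fun x _ => ?_
      simp only [Function.comp_apply]
      rw [mul_smul, prod_smul_unitTensor]
      exact congrArg (fun m => x.1 • tmk (M := fun i => (B i).toMod) m)
        (funext fun i => hlift i (x.2 i))
    rw [h1]
    exact hl.trans (min_le_left _ _)

/-- The quotient of `A` by a closed ideal, as a Banach module. -/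
noncomputable def quotMod (c : BanKind) {A : Type u} [NormedCommRing A] [CompleteSpace A]
    [IsBanObj c A] (J : Ideal A) [hJ : IsClosed (J : Set A)] : BanMod c A where
  carrier := A ⧸ J
  obj := ⟨fun h => by
    have := IsBanObj.ultra (M := A) h
    refine IsUltrametricDist.isUltrametricDist_of_forall_norm_add_le_max_norm fun x y => ?_
    refine le_of_forall_pos_le_add fun ε hε => ?_
    obtain ⟨a, rfl, ha⟩ := Ideal.Quotient.norm_mk_lt x hε
    obtain ⟨b, rfl, hb⟩ := Ideal.Quotient.norm_mk_lt y hε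
    rw [← map_add, max_add]
    exact (Ideal.Quotient.norm_mk_le _ _).trans ((IsUltrametricDist.norm_add_le_max _ _).trans
      (max_le_max ha.le hb.le))⟩
  smul_bdd := ⟨1, fun a x => by
    refine le_of_forall_gt_imp_ge_of_dense fun r hr => ?_
    obtain ⟨b, rfl, hb⟩ := Ideal.Quotient.norm_mk_lt x (ε := (r - 1 * ‖a‖ * ‖x‖) / (‖a‖ + 1))
      (by have := sub_pos.2 hr; positivity)
    have h1 : a • Ideal.Quotient.mk J b = Ideal.Quotient.mk J (a * b) := rfl
    rw [h1]
    refine (Ideal.Quotient.norm_mk_le _ _).trans ((norm_mul_le a b).trans ?_)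
    set s := r - 1 * ‖a‖ * ‖Ideal.Quotient.mk J b‖ with hs
    have hs0 : 0 < s := sub_pos.2 hr
    calc ‖a‖ * ‖b‖ ≤ ‖a‖ * (‖Ideal.Quotient.mk J b‖ + s / (‖a‖ + 1)) := by gcongr
      _ = ‖a‖ * ‖Ideal.Quotient.mk J b‖ + ‖a‖ / (‖a‖ + 1) * s := by ring
      _ ≤ ‖a‖ * ‖Ideal.Quotient.mk J b‖ + 1 * s := by
        gcongr
        rw [div_le_one (by positivity)]
        linarith
      _ = r := by rw [hs]; ring⟩

/-- The quotient `A ⧸ J` by the closed ideal `J` receives a bounded map from each `B i`, hence by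
multiplication a morphism from the tensor product which sends the unit tensor to `1`. It detects the
class of `a`. -/
theorem mem_closure_of_smul_unitTensor (hB : ∀ i, (B i).HasBddLift) {a : A}
    (ha : a • unitTensor B = 0) : a ∈ (⨆ i, (B i).idl).closure := by
  set J : Ideal A := (⨆ i, (B i).idl).closure with hJ
  have hle : ∀ i, (B i).idl ≤ J := fun i => (le_iSup (fun i => (B i).idl) i).trans fun x hx =>
    subset_closure hx
  have : IsClosed (J : Set A) := by rw [hJ, Ideal.coe_closure]; exact isClosed_closure
  choose C hC0 lift hlift hliftn using hB
  have hmk : ∀ i (x y : A), algebraMap A (B i) x = algebraMap A (B i) y →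
      Ideal.Quotient.mk J x = Ideal.Quotient.mk J y := fun i x y h => by
    rw [Ideal.Quotient.eq]
    refine hle i ?_
    rw [RingHom.mem_ker, map_sub, h, sub_self]
  -- The chosen lifts need not be linear, but two lifts of the same element differ by an element of
  -- `J`.
  let g : ∀ i, (B i).toMod →ₗ[A] A ⧸ J := fun i =>
    { toFun := fun b => Ideal.Quotient.mk J (lift i b)
      map_add' := fun x y => by
        rw [← map_add]
        refine hmk i _ _ ?_
        rw [map_add]
        exact (hlift i _).trans (congrArg₂ (fun b b' : B i => b + b') (hlift i x) (hlift i y)).symm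
      map_smul' := fun r x => by
        change _ = Ideal.Quotient.mk J (r * lift i x)
        refine hmk i _ _ ?_
        rw [map_mul]
        refine (hlift i _).trans ((Algebra.smul_def (A := B i) r (show B i from x)).trans ?_)
        exact congrArg (fun b : B i => algebraMap A (B i) r * b) (hlift i x).symm }
  let Q := quotMod c J
  have hp : 0 ≤ ∏ i, C i := Finset.prod_nonneg fun i _ => hC0 i
  let G : tensor (fun i => (B i).toMod) ⟶ Q :=
    tensorLift (N := Q) ((MultilinearMap.mkPiAlgebra A ι (A ⧸ J)).compLinearMap g)
      ⟨max 1 ‖(1 : A)‖ * ∏ i, C i, fun m => by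
        have h1 : ((MultilinearMap.mkPiAlgebra A ι (A ⧸ J)).compLinearMap g) m =
            Ideal.Quotient.mk J (∏ i, lift i (m i)) := by
          rw [map_prod]
          rfl
        change ‖((MultilinearMap.mkPiAlgebra A ι (A ⧸ J)).compLinearMap g) m‖ ≤ _
        rw [h1]
        refine (Ideal.Quotient.norm_mk_le _ _).trans ((norm_prod_le_max_one _ _).trans ?_)
        rw [mul_assoc, ← Finset.prod_mul_distrib]
        gcongr with i
        exact hliftn i _⟩
  have hG : G.lin (unitTensor B) = (1 : A ⧸ J) := by
    refine (tensorLift_tmk _ _ _).trans ?_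
    change ∏ i, Ideal.Quotient.mk J (lift i 1) = 1
    refine Finset.prod_eq_one fun i _ => ?_
    rw [← map_one (Ideal.Quotient.mk J)]
    exact hmk i _ _ (by rw [hlift, map_one])
  have h2 : G.lin (a • unitTensor B) = Ideal.Quotient.mk J a := by
    rw [map_smul, hG]
    change Ideal.Quotient.mk J (a * 1) = _
    rw [mul_one]
  rw [ha, map_zero] at h2
  exact Ideal.Quotient.eq_zero_iff_mem.1 h2.symm

end BanAlg

/-! ### Strict exactness of the Tate–Čech complex -/

namespace BanMod

variable {m : ℕ}

theorem cechSign_mul_self (s : Finset (Fin m)) (i : Fin m) : cechSign s i * cechSign s i = 1 := by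
  rw [cechSign, ← mul_pow]
  simp

theorem norm_cechSign_smul {G : Type*} [SeminormedAddCommGroup G] (s : Finset (Fin m)) (i : Fin m)
    (x : G) : ‖cechSign s i • x‖ = ‖x‖ := by
  rcases neg_one_pow_eq_or ℤ (s.filter (· < i)).card with h | h <;> simp [cechSign, h]

/-! ### The contraction of alternating cochains by a partition of unity -/

section combinatorics

variable {A : Type*} [CommRing A]

/-- The Čech differential on families of ring elements. -/
def cechDelta (a : Finset (Fin m) → A) (s : Finset (Fin m)) : A :=
  ∑ i ∈ s, cechSign s i • a (s.erase i)

/-- The contracting homotopy of the Čech complex given by a partition of unity. -/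
def cechContr (ρ : Fin m → A) (a : Finset (Fin m) → A) (s : Finset (Fin m)) : A :=
  ∑ i ∈ sᶜ, cechSign (insert i s) i • (ρ i * a (insert i s))

/-- The terms that return to `s` add up to `(∑ ρ i) * a s`. In the others an element `j` of `s` is
exchanged for some `i` outside `s`; each exchange occurs once in either composite, with opposite
signs. -/
theorem cechDelta_contr (ρ : Fin m → A) (hρ : ∑ i, ρ i = 1) (a : Finset (Fin m) → A)
    (s : Finset (Fin m)) :
    cechDelta (cechContr ρ a) s + cechContr ρ (cechDelta a) s = a s := by
  have h1 : cechContr ρ (cechDelta a) s = ∑ i ∈ sᶜ, ρ i * a s + ∑ i ∈ sᶜ, ∑ j ∈ s,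
      (cechSign (insert i s) i * cechSign (insert i s) j) • (ρ i * a ((insert i s).erase j)) := by
    rw [← Finset.sum_add_distrib]
    refine Finset.sum_congr rfl fun i hi => ?_
    have hi : i ∉ s := Finset.mem_compl.1 hi
    rw [cechDelta, Finset.sum_insert hi, Finset.erase_insert hi, mul_add, smul_add,
      mul_smul_comm, smul_smul, cechSign_mul_self, one_smul, Finset.mul_sum, Finset.smul_sum]
    congr 1
    refine Finset.sum_congr rfl fun j _ => ?_
    rw [mul_smul_comm, smul_smul]
  have h2 : cechDelta (cechContr ρ a) s = ∑ j ∈ s, ρ j * a s + ∑ j ∈ s, ∑ i ∈ sᶜ,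
      (cechSign s j * cechSign (insert i (s.erase j)) i) •
        (ρ i * a (insert i (s.erase j))) := by
    rw [← Finset.sum_add_distrib]
    refine Finset.sum_congr rfl fun j hj => ?_
    have hc : (s.erase j)ᶜ = insert j sᶜ := by
      ext k
      simp only [Finset.mem_compl, Finset.mem_erase, Finset.mem_insert]
      tauto
    rw [cechContr, hc, Finset.sum_insert (by simpa using hj), Finset.insert_erase hj, smul_add,
      smul_smul, cechSign_mul_self, one_smul, Finset.smul_sum]
    congr 1
    exact Finset.sum_congr rfl fun i _ => smul_smul _ _ _
  rw [h1, h2, Finset.sum_comm (s := s) (t := sᶜ)]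
  have h3 : ∑ i ∈ sᶜ, ∑ j ∈ s, (cechSign s j * cechSign (insert i (s.erase j)) i) •
      (ρ i * a (insert i (s.erase j))) = -∑ i ∈ sᶜ, ∑ j ∈ s,
      (cechSign (insert i s) i * cechSign (insert i s) j) • (ρ i * a ((insert i s).erase j)) := by
    simp only [← Finset.sum_neg_distrib]
    refine Finset.sum_congr rfl fun i hi => Finset.sum_congr rfl fun j hj => ?_
    have hi : i ∉ s := Finset.mem_compl.1 hi
    have hij : i ≠ j := fun h => hi (h ▸ hj)
    have he : (insert i s).erase j = insert i (s.erase j) := Finset.erase_insert_of_ne hij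
    have hs := cechSign_mul (insert i s) (Finset.mem_insert_self i s)
      (Finset.mem_insert_of_mem hj) hij
    rw [Finset.erase_insert hi, he] at hs
    rw [he, ← neg_smul]
    congr 1
    have h4 := cechSign_mul_self (insert i s) j
    have h5 := cechSign_mul_self s j
    -- The sign rule multiplied by two signs, which are then removed because each sign is its own
    -- inverse.
    linear_combination (cechSign (insert i s) j * cechSign s j) * hs -
      (cechSign s j * cechSign (insert i (s.erase j)) i) * h4 -
      (cechSign (insert i s) i * cechSign (insert i s) j) * h5
  rw [h3]
  have h6 : ∑ j ∈ s, ρ j * a s + ∑ i ∈ sᶜ, ρ i * a s = a s := by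
    rw [Finset.sum_add_sum_compl, ← Finset.sum_mul, hρ, one_mul]
  linear_combination h6

end combinatorics

end BanMod

/-! ### The approximate contraction of the Tate–Čech complex -/

namespace BanAlg

open BanMod

variable {c : BanKind} {A : Type u} [NormedCommRing A] {m : ℕ} (B : Fin m → BanAlg c A)

/-- The diagram `s ↦ ⨂_{i ∈ s} B i`. -/
noncomputable abbrev tensorDiagram : Finset (Fin m) ⥤ BanMod c A :=
  tensorFunctor (fun i => (B i).toMod) fun i => (1 : B i)

/-- The unit of `⨂_{i ∈ s} B i`. -/
noncomputable def unitOn (s : Finset (Fin m)) : (tensorDiagram B).obj s :=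
  unitTensor fun i : s => B i

theorem map_unitOn {s t : Finset (Fin m)} (f : s ⟶ t) :
    ((tensorDiagram B).map f).lin (unitOn B s) = unitOn B t := by
  refine (tensorIns_tmk (leOfHom f) (M := fun i : t => (B i).toMod) (fun i => (1 : B i)) _).trans ?_
  refine congrArg tmk (funext fun i => ?_)
  unfold extendFamily
  by_cases h : i.1 ∈ s
  · exact dif_pos h
  · exact dif_neg h

/-- The Čech cochain represented by a family of elements of `A`. -/
noncomputable def cochain (a : Finset (Fin m) → A) (n : ℕ) : cechX (tensorDiagram B) n :=
  fun s => a s.1 • unitOn B s.1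

theorem cechProj_cochain (a : Finset (Fin m) → A) {n : ℕ} {s : Finset (Fin m)} (hs : s.card = n) :
    (cechProj (tensorDiagram B) n s).lin (cochain B a n) = a s • unitOn B s := by
  rw [cechProj, dif_pos hs]
  rfl

theorem cechD_cochain (a : Finset (Fin m) → A) (n : ℕ) :
    (cechD (tensorDiagram B) n).lin (cochain B a n) = cochain B (cechDelta a) (n + 1) := by
  funext s
  change (∑ i ∈ s.1, cechSign s.1 i • (cechProj (tensorDiagram B) n (s.1.erase i) ≫
    (tensorDiagram B).map (eraseHom s.1 i))).lin (cochain B a n) = cechDelta a s.1 • unitOn B s.1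
  rw [sum_lin, cechDelta, Finset.sum_smul]
  refine Finset.sum_congr rfl fun i hi => ?_
  have hc : (s.1.erase i).card = n := by
    have := Finset.card_erase_add_one hi
    have := s.2
    omega
  rw [zsmul_lin, comp_lin, cechProj_cochain B a hc, map_smul, map_unitOn, smul_assoc]

variable [CompleteSpace A] [IsBanObj c A]

variable {B} in
theorem exists_lift_unitOn (hB : ∀ i, (B i).HasBddLift) : ∃ C : ℝ, 0 ≤ C ∧
    ∀ s (y : (tensorDiagram B).obj s), ∃ a : A, a • unitOn B s = y ∧ ‖a‖ ≤ C * ‖y‖ := by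
  choose C hC0 hC using fun s : Finset (Fin m) =>
    exists_smul_unitTensor (B := fun i : s => B i) fun i => hB i
  refine ⟨∑ s, C s, Finset.sum_nonneg fun s _ => hC0 s, fun s y => ?_⟩
  obtain ⟨a, ha, ha'⟩ := hC s y
  refine ⟨a, ha, ha'.trans ?_⟩
  exact mul_le_mul_of_nonneg_right
    (Finset.single_le_sum (f := C) (fun i _ => hC0 i) (Finset.mem_univ s)) (norm_nonneg _)

-- Elements of the kernels with index in `s` already annihilate the unit of `⨂_{j ∈ s} B j`, and
-- those of the kernel of `B i` are handled by the cutoffs. Boundedness of the cutoffs extends this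
-- to sums and to the closure.
variable {B} in
theorem tendsto_cutoff_smul_unitOn (F : ∀ i, Cutoff (B i).idl) {s : Finset (Fin m)} {i : Fin m}
    {t : A} (ht : t ∈ (⨆ j : (insert i s : Finset (Fin m)), (B j).idl).closure) :
    Tendsto (fun e => ((F i).f e * t) • unitOn B s) (F i).l (𝓝 0) := by
  let g : (F i).E → (self c A ⟶ (tensorDiagram B).obj s) := fun e =>
    smulHom _ ((F i).f e) ≫ elemHom (unitOn B s)
  have hg : UnifBdd g := (UnifBdd.smulHom (F i).bdd).comp (.const _)
  have hcl := isClosed_tendsto_zero (l := (F i).l) hg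
  suffices h : ((⨆ j : (insert i s : Finset (Fin m)), (B j).idl : Ideal A) : Set A) ⊆
      {x | Tendsto (fun e => (g e).lin x) (F i).l (𝓝 0)} from
    closure_minimal h hcl ht
  intro x hx
  refine Submodule.iSup_induction _ (motive := fun x : A =>
    Tendsto (fun e => ((F i).f e * x) • unitOn B s) (F i).l (𝓝 0)) hx (fun j x hx => ?_) ?_ ?_
  · rcases Finset.mem_insert.1 j.2 with hj | hj
    · have h1 := (F i).tendsto x (by rw [← hj]; exact hx)
      have := ((Hom.continuous (elemHom (c := c) (unitOn B s))).tendsto (0 : A)).comp h1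
      have h0 : (elemHom (c := c) (unitOn B s)).lin (0 : A) = 0 := zero_smul A _
      rwa [h0] at this
    · have h0 : ∀ e, ((F i).f e * x) • unitOn B s = 0 := fun e => by
        rw [mul_smul]
        have : x • unitOn B s = 0 :=
          smul_unitTensor_eq_zero (B := fun i : s => B i) (i := ⟨j.1, hj⟩) hx
        rw [this, smul_zero]
      simp only [h0]
      exact tendsto_const_nhds
  · simp only [mul_zero, zero_smul]
    exact tendsto_const_nhds
  · intro x y hx hy
    simpa only [mul_add, add_smul, add_zero] using hx.add hy

variable {B} in
/-- The approximation on which the strict exactness of the Čech complex rests. -/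
theorem cochain_approx (hB : ∀ i, (B i).HasBddLift) (F : ∀ i, Cutoff (B i).idl)
    (hprod : ∀ a : Fin m → A, (∀ i, a i ∈ (B i).idl) → ∏ i, a i = 0) :
    ∃ C : ℝ, 0 ≤ C ∧ ∀ n (y : cechX (tensorDiagram B) n), (cechD (tensorDiagram B) n).lin y = 0 →
      ∀ ε > 0, ∃ b : Finset (Fin m) → A, (∀ k, ‖cochain B b k‖ ≤ C * ‖y‖) ∧
        ‖y - cochain B (cechDelta b) n‖ ≤ ε := by
  classical
  obtain ⟨CL, hL0, hL⟩ := exists_lift_unitOn hB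
  choose D hD using fun i => (F i).bdd
  obtain ⟨T, hT0, hT⟩ : ∃ T : ℝ, 0 ≤ T ∧ ∀ s, ‖unitOn B s‖ ≤ T :=
    ⟨∑ s, ‖unitOn B s‖, Finset.sum_nonneg fun _ _ => norm_nonneg _, fun s =>
      Finset.single_le_sum (f := fun s => ‖unitOn B s‖) (fun _ _ => norm_nonneg _)
        (Finset.mem_univ s)⟩
  -- bounds for the partition of unity
  let P : Fin m → ℝ := fun i => max 1 ‖(1 : A)‖ * ∏ j with j < i, (‖(1 : A)‖ + |D j|)
  have hP0 : ∀ i, 0 ≤ P i := fun i => by positivity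
  have hPb : ∀ (e : ∀ i, (F i).E) i, ‖∏ j with j < i, (1 - (F j).f (e j))‖ ≤ P i := fun e i => by
    refine (norm_prod_le_max_one _ _).trans ?_
    refine mul_le_mul_of_nonneg_left (Finset.prod_le_prod (fun _ _ => norm_nonneg _) fun j _ => ?_)
      (zero_le_one.trans (le_max_left _ _))
    exact (norm_sub_le _ _).trans (add_le_add le_rfl ((hD j _).trans (le_abs_self _)))
  let Q : ℝ := ∑ i, P i * |D i|
  have hQ0 : 0 ≤ Q := Finset.sum_nonneg fun i _ => mul_nonneg (hP0 i) (abs_nonneg _)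
  -- `P` and `Q` involve only the bounds of the cutoffs, not their indices, so the constant is fixed
  -- before the indices are chosen in terms of `y` and `ε`.
  refine ⟨Q * CL * T, by positivity, fun n y hy ε hε => ?_⟩
  have hex : ∀ s, ∃ a : A, (∀ h : s.card = n, a • unitOn B s = y ⟨s, h⟩) ∧
      ‖a‖ ≤ CL * ‖y‖ := by
    intro s
    by_cases h : s.card = n
    · obtain ⟨a, ha, ha'⟩ := hL s (y ⟨s, h⟩)
      refine ⟨a, fun _ => ha, ha'.trans ?_⟩
      gcongr
      exact norm_le_pi_norm (show ∀ s : {s : Finset (Fin m) // s.card = n},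
        (tensorDiagram B).obj s.1 from y) ⟨s, h⟩
    · exact ⟨0, fun h' => (h h').elim, by simp; positivity⟩
  choose a ha ha' using hex
  have hya : y = cochain B a n := funext fun s => (ha s.1 s.2).symm
  -- The lifted family `a` is no cocycle in `A`: its differential merely annihilates the unit
  -- tensors, hence lies in the closures of the sums of kernels.
  have hker : ∀ s : Finset (Fin m), s.card = n + 1 →
      cechDelta a s ∈ (⨆ j : s, (B j).idl).closure := by
    intro s hs
    refine mem_closure_of_smul_unitTensor (B := fun i : s => B i) (fun i => hB i) ?_
    rw [hya, cechD_cochain] at hy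
    exact congrFun hy ⟨s, hs⟩
  -- the cutoffs
  let P' : ℝ := ∑ i, P i
  have hP' : 0 ≤ P' := Finset.sum_nonneg fun i _ => hP0 i
  -- A single index has to serve the finitely many sets `s` at once.
  have hcut : ∀ i, ∃ e, ∀ s : Finset (Fin m), s.card = n → i ∉ s →
      ‖((F i).f e * cechDelta a (insert i s)) • unitOn B s‖ ≤ ε / (P' + 1) := by
    intro i
    have : ∀ s : Finset (Fin m), ∀ᶠ e in (F i).l, s.card = n → i ∉ s →
        ‖((F i).f e * cechDelta a (insert i s)) • unitOn B s‖ ≤ ε / (P' + 1) := by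
      intro s
      by_cases h : s.card = n ∧ i ∉ s
      · have ht := tendsto_cutoff_smul_unitOn F (s := s) (i := i)
          (hker (insert i s) (by rw [Finset.card_insert_of_notMem h.2, h.1]))
        filter_upwards [Metric.tendsto_nhds.1 ht (ε / (P' + 1)) (by positivity)] with e he _ _
        rw [dist_zero_right] at he
        exact he.le
      · exact Eventually.of_forall fun e h1 h2 => (h ⟨h1, h2⟩).elim
    exact (eventually_all.2 this).exists
  choose e he using hcut
  -- The sum telescopes to `1 - ∏ (1 - f i)`, and this product of elements of all the kernels
  -- vanishes by `hprod`.
  let ρ : Fin m → A := fun i => (F i).f (e i) * ∏ j with j < i, (1 - (F j).f (e j))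
  have hρ : ∑ i, ρ i = 1 := by
    have h1 := Finset.prod_one_sub_ordered Finset.univ fun i => (F i).f (e i)
    rw [hprod _ fun i => (F i).one_sub_mem (e i)] at h1
    exact (sub_eq_zero.1 h1.symm).symm
  have hρn : ∑ i, ‖ρ i‖ ≤ Q := Finset.sum_le_sum fun i _ => by
    refine (norm_mul_le _ _).trans ?_
    rw [mul_comm]
    gcongr
    · exact hPb e i
    · exact (hD i _).trans (le_abs_self _)
  refine ⟨cechContr ρ a, fun k => ?_, ?_⟩
  · refine (pi_norm_le_iff_of_nonneg (by positivity)).2 fun s => ?_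
    change ‖cechContr ρ a s.1 • unitOn B s.1‖ ≤ _
    refine (norm_tensor_smul_le _ _).trans ?_
    have h1 : ‖cechContr ρ a s.1‖ ≤ Q * (CL * ‖y‖) := by
      refine (norm_sum_le _ _).trans ?_
      calc ∑ i ∈ s.1ᶜ, ‖cechSign (insert i s.1) i • (ρ i * a (insert i s.1))‖
          ≤ ∑ i ∈ s.1ᶜ, ‖ρ i‖ * (CL * ‖y‖) := Finset.sum_le_sum fun i _ => by
            rw [norm_cechSign_smul]
            refine (norm_mul_le _ _).trans ?_
            gcongr
            exact ha' _
        _ ≤ ∑ i, ‖ρ i‖ * (CL * ‖y‖) :=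
          Finset.sum_le_sum_of_subset_of_nonneg (Finset.subset_univ _) fun i _ _ => by positivity
        _ ≤ Q * (CL * ‖y‖) := by rw [← Finset.sum_mul]; gcongr
    calc ‖cechContr ρ a s.1‖ * ‖unitOn B s.1‖ ≤ Q * (CL * ‖y‖) * T := by
          gcongr
          exact hT _
      _ = _ := by ring
  · refine (pi_norm_le_iff_of_nonneg hε.le).2 fun s => ?_
    have h1 : (y - cochain B (cechDelta (cechContr ρ a)) n) s =
        cechContr ρ (cechDelta a) s.1 • unitOn B s.1 := by
      rw [hya]
      change a s.1 • unitOn B s.1 - cechDelta (cechContr ρ a) s.1 • unitOn B s.1 = _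
      rw [← sub_smul]
      congr 1
      rw [sub_eq_iff_eq_add', cechDelta_contr ρ hρ]
    -- The error of the contraction. Each summand contains the cutoff `f i` next to an element of
    -- the closure for `insert i s`, which was made small in `hcut`; the remaining factors of `ρ i`
    -- are bounded by `P i`.
    have h2 : cechContr ρ (cechDelta a) s.1 • unitOn B s.1 = ∑ i ∈ s.1ᶜ,
        cechSign (insert i s.1) i • ((∏ j with j < i, (1 - (F j).f (e j))) •
          (((F i).f (e i) * cechDelta a (insert i s.1)) • unitOn B s.1)) := by
      rw [cechContr, Finset.sum_smul]
      refine Finset.sum_congr rfl fun i _ => ?_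
      rw [smul_assoc, smul_smul]
      congr 2
      simp only [ρ]
      ring
    refine (congrArg norm (h1.trans h2)).le.trans ((norm_sum_le _ _).trans ?_)
    calc ∑ i ∈ s.1ᶜ, ‖cechSign (insert i s.1) i • ((∏ j with j < i, (1 - (F j).f (e j))) •
          (((F i).f (e i) * cechDelta a (insert i s.1)) • unitOn B s.1))‖
        ≤ ∑ i ∈ s.1ᶜ, P i * (ε / (P' + 1)) := Finset.sum_le_sum fun i hi => by
          rw [norm_cechSign_smul]
          refine (norm_tensor_smul_le _ _).trans ?_
          exact mul_le_mul (hPb e i) (he i s.1 s.2 (Finset.mem_compl.1 hi)) (norm_nonneg _) (hP0 i)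
      _ ≤ ∑ i, P i * (ε / (P' + 1)) :=
        Finset.sum_le_sum_of_subset_of_nonneg (Finset.subset_univ _) fun i _ _ => by
          have := hP0 i
          positivity
      _ = P' * (ε / (P' + 1)) := by rw [← Finset.sum_mul]
      _ ≤ (P' + 1) * (ε / (P' + 1)) := by gcongr; linarith
      _ = ε := mul_div_cancel₀ _ (by positivity)

variable {B} in
theorem cech_strictExactAt_succ (hB : ∀ i, (B i).HasBddLift) (F : ∀ i, Cutoff (B i).idl)
    (hprod : ∀ a : Fin m → A, (∀ i, a i ∈ (B i).idl) → ∏ i, a i = 0) (n : ℕ) :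
    StrictExactAt (cechD (tensorDiagram B) n) (cechD (tensorDiagram B) (n + 1)) := by
  obtain ⟨C, hC0, hC⟩ := cochain_approx hB F hprod
  refine strictExactAt_of_approx (fun x => ?_) hC0 fun y hy ε hε => ?_
  · rw [← comp_lin, cechD_sq, zero_lin]
  · obtain ⟨b, hb, hb'⟩ := hC (n + 1) y hy ε hε
    exact ⟨cochain B b n, hb n, by rwa [cechD_cochain]⟩

variable {B} in
-- In degree zero the approximating coboundary is an empty sum, so `y` itself has arbitrarily small
-- norm.
theorem cech_injective (hB : ∀ i, (B i).HasBddLift) (F : ∀ i, Cutoff (B i).idl)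
    (hprod : ∀ a : Fin m → A, (∀ i, a i ∈ (B i).idl) → ∏ i, a i = 0)
    {y : cechX (tensorDiagram B) 0} (hy : (cechD (tensorDiagram B) 0).lin y = 0) : y = 0 := by
  obtain ⟨C, -, hC⟩ := cochain_approx hB F hprod
  rw [← norm_le_zero_iff]
  refine le_of_forall_pos_le_add fun ε hε => ?_
  obtain ⟨b, -, hb⟩ := hC 0 y hy ε hε
  have : cochain B (cechDelta b) 0 = 0 := by
    funext s
    obtain ⟨s, hs⟩ := s
    obtain rfl := Finset.card_eq_zero.1 hs
    exact zero_smul A _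
  rwa [this, sub_zero, ← zero_add ε] at hb

end BanAlg

namespace BanMod

variable {c : BanKind} {A : Type u} [NormedCommRing A]

/-- The incoming differential at the left end is zero, so strict exactness there amounts to
injectivity of the outgoing one. -/
theorem strictExact_cochain_nat {K : CochainComplex (BanMod c A) ℕ}
    (h0 : ∀ y, (K.d 0 1).lin y = 0 → y = 0)
    (h : ∀ n, StrictExactAt (K.d n (n + 1)) (K.d (n + 1) (n + 2))) : StrictExact K := by
  intro j
  cases j with
  | zero =>
    have h1 : K.d ((ComplexShape.up ℕ).prev 0) 0 = 0 := K.shape _ _ (by simp)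
    rw [h1, CochainComplex.next]
    exact strictExactAt_iff.2 ⟨fun x => map_zero _, 0, le_rfl, fun y hy => ⟨0, by
      rw [h0 y hy, map_zero], by simp⟩⟩
  | succ n =>
    rw [CochainComplex.prev_nat_succ, CochainComplex.next]
    exact h n

end BanMod

/-! ### Tate acyclicity and its converse -/

namespace BanAlg

open BanMod

variable {c : BanKind} {A : Type u} [NormedCommRing A] {m : ℕ} {B : Fin m → BanAlg c A}
  [CompleteSpace A] [IsBanObj c A]

theorem tateCech_d (n : ℕ) : (tateCech B).d n (n + 1) = cechD (tensorDiagram B) n :=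
  CochainComplex.of_d _ _ n

theorem strictExact_tateCech (hB : ∀ i, (B i).HasBddLift) (F : ∀ i, Cutoff (B i).idl)
    (hprod : ∀ a : Fin m → A, (∀ i, a i ∈ (B i).idl) → ∏ i, a i = 0) :
    StrictExact (tateCech B) := by
  refine strictExact_cochain_nat (fun y hy => ?_) fun n => ?_
  · rw [tateCech_d 0] at hy
    exact cech_injective hB F hprod hy
  · rw [tateCech_d n, tateCech_d (n + 1)]
    exact cech_strictExactAt_succ hB F hprod n

/-- The empty tensor product is `A` itself: the supremum of no ideals is the zero ideal, which is
closed. -/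
theorem eq_zero_of_smul_unitOn_empty (hB : ∀ i, (B i).HasBddLift) {a : A}
    (h : a • unitOn B ∅ = 0) : a = 0 := by
  have h2 := mem_closure_of_smul_unitTensor (B := fun i : (∅ : Finset (Fin m)) => B i)
    (fun i => hB i) h
  have h3 : (⨆ i : (∅ : Finset (Fin m)), (B i).idl) = ⊥ := by simp
  rw [h3] at h2
  have h4 : (⊥ : Ideal A).closure = ⊥ :=
    Ideal.closure_eq_of_isClosed _ (by simp)
  rw [h4] at h2
  exact h2

/-- If the Tate–Čech complex is strictly exact, then `A → ∏ B i` is injective. -/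
theorem eq_zero_of_strictExact_tateCech (hB : ∀ i, (B i).HasBddLift)
    (h : StrictExact (tateCech B)) {a : A} (ha : ∀ i, a ∈ (B i).idl) : a = 0 := by
  have h0 := h 0
  rw [CochainComplex.next, (tateCech B).shape ((ComplexShape.up ℕ).prev 0) 0 (by simp)] at h0
  obtain ⟨-, C, -, hC⟩ := strictExactAt_iff.1 h0
  -- Membership in the kernel of `B i` means that `a` annihilates the unit over `{i}`, so `a` gives
  -- a cocycle in degree zero.
  have hy : (cechD (tensorDiagram B) 0).lin (cochain B (fun _ => a) 0) = 0 := by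
    rw [cechD_cochain]
    funext s
    obtain ⟨i, hi⟩ := Finset.card_eq_one.1 s.2
    have h1 : a • unitOn B s.1 = 0 :=
      smul_unitTensor_eq_zero (B := fun i : s.1 => B i) (i := ⟨i, by simp [hi]⟩) (ha i)
    change cechDelta (fun _ => a) s.1 • unitOn B s.1 = 0
    rw [cechDelta, Finset.sum_smul]
    refine Finset.sum_eq_zero fun j _ => ?_
    rw [smul_assoc, h1, smul_zero]
  obtain ⟨x, hx, -⟩ := hC (cochain B (fun _ => a) 0)
    ((congrArg (fun k => Hom.lin k _) (tateCech_d 0)).trans hy)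
  have h1 : a • unitOn B ∅ = 0 := (congrFun hx ⟨∅, rfl⟩).symm
  exact eq_zero_of_smul_unitOn_empty hB h1

end BanAlg

/-! ### Strict exactness of the total complex of a Čech double complex -/

namespace BanMod

variable {c : BanKind} {A : Type u} [NormedCommRing A] {m : ℕ}

section elements

variable {F : Finset (Fin m) ⥤ ChainComplex (BanMod c A) ℕ}

theorem cechTot_ext {n : ℤ} {x y : cechTotX F n}
    (h : ∀ s k, (cechTotProj F n s k).lin x = (cechTotProj F n s k).lin y) : x = y := by
  funext i
  have h1 := h i.1.1 i.1.2
  rw [← cechTotProj_eq] at h1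
  exact h1

theorem cechTotProj_of_ne {n : ℤ} {s : Finset (Fin m)} {k : ℕ} (h : (s.card : ℤ) - k ≠ n)
    (y : cechTotX F n) : (cechTotProj F n s k).lin y = 0 := by
  rw [cechTotProj, dif_neg h, zero_lin]

theorem norm_cechTotProj_le {n : ℤ} (s : Finset (Fin m)) (k : ℕ) (y : cechTotX F n) :
    ‖(cechTotProj F n s k).lin y‖ ≤ ‖y‖ := by
  by_cases h : (s.card : ℤ) - k = n
  · rw [cechTotProj, dif_pos h]
    exact norm_le_pi_norm (show ∀ x : CechTotIdx m n, (F.obj x.1.1).X x.1.2 from y) ⟨(s, k), h⟩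
  · rw [cechTotProj_of_ne h, norm_zero]
    exact norm_nonneg y

/-- The element of the total complex with given components. -/
def cechTotMk (n : ℤ) (v : ∀ s k, (F.obj s).X k) : cechTotX F n := fun x => v x.1.1 x.1.2

theorem cechTotProj_mk {n : ℤ} (v : ∀ s k, (F.obj s).X k) {s : Finset (Fin m)} {k : ℕ}
    (h : (s.card : ℤ) - k = n) : (cechTotProj F n s k).lin (cechTotMk n v) = v s k := by
  rw [cechTotProj, dif_pos h]
  rfl

theorem norm_cechTotMk_le {n : ℤ} {v : ∀ s k, (F.obj s).X k} {C : ℝ} (hC : 0 ≤ C)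
    (h : ∀ s k, ‖v s k‖ ≤ C) : ‖cechTotMk n v‖ ≤ C :=
  (pi_norm_le_iff_of_nonneg hC).2 fun x => h x.1.1 x.1.2

theorem cechTotProj_d (n : ℤ) (s : Finset (Fin m)) (k : ℕ) (w : cechTotX F n) :
    (cechTotProj F (n + 1) s k).lin ((cechTotD F n).lin w) =
      ((-1) ^ s.card : ℤ) • ((F.obj s).d (k + 1) k).lin ((cechTotProj F n s (k + 1)).lin w) +
      ∑ i ∈ s, cechSign s i • ((F.map (eraseHom s i)).f k).lin
        ((cechTotProj F n (s.erase i) k).lin w) := by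
  rw [← comp_lin, cechTotD_proj, cechTotDAt, add_lin, sum_lin]
  simp only [zsmul_lin, comp_lin]

theorem cechTotal_d (n : ℤ) : (cechTotal F).d n (n + 1) = cechTotD F n :=
  CochainComplex.of_d _ _ n

/-- The element `y` has no components `(s, k)` with `s` of cardinality less than `p`. -/
def CechSupp (p : ℕ) {n : ℤ} (y : cechTotX F n) : Prop :=
  ∀ s k, s.card < p → (cechTotProj F n s k).lin y = 0

theorem CechSupp.mono {p q : ℕ} (hpq : q ≤ p) {n : ℤ} {y : cechTotX F n} (h : CechSupp p y) :
    CechSupp q y := fun s k hs => h s k (hs.trans_le hpq)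

theorem CechSupp.add {p : ℕ} {n : ℤ} {x y : cechTotX F n} (hx : CechSupp p x)
    (hy : CechSupp p y) : CechSupp p (x + y) := fun s k hs => by
  rw [map_add, hx s k hs, hy s k hs, add_zero]

theorem cechTotD_cechTotD (n : ℤ) (w : cechTotX F n) :
    (cechTotD F (n + 1)).lin ((cechTotD F n).lin w) = 0 := by
  rw [← comp_lin, cechTotD_sq, zero_lin]

/-- Removal of the components `(s, k)` with `s` of cardinality `p` of an element of the total
complex, provided that they are boundaries. -/
theorem exists_cechSupp_sub {n : ℤ} {p k : ℕ} (hpk : (p : ℤ) - k = n + 1) {C : ℝ} (hC : 0 ≤ C)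
    {y : cechTotX F (n + 1)} (hy : CechSupp p y)
    (h : ∀ s : Finset (Fin m), s.card = p → ∃ v, ((F.obj s).d (k + 1) k).lin v =
      (cechTotProj F (n + 1) s k).lin y ∧ ‖v‖ ≤ C * ‖y‖) :
    ∃ w : cechTotX F n, ‖w‖ ≤ C * ‖y‖ ∧ CechSupp p w ∧
      CechSupp (p + 1) (y - (cechTotD F n).lin w) := by
  have h' : ∀ s : Finset (Fin m), ∀ j : ℕ, ∃ v : (F.obj s).X (j + 1), ‖v‖ ≤ C * ‖y‖ ∧
      (s.card ≠ p → v = 0) ∧ (s.card = p → j = k →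
        ((F.obj s).d (j + 1) j).lin v = (cechTotProj F (n + 1) s j).lin y) := by
    intro s j
    by_cases hs : s.card = p ∧ j = k
    · obtain ⟨hs, rfl⟩ := hs
      obtain ⟨v, hv, hv'⟩ := h s hs
      exact ⟨v, hv', fun h => (h hs).elim, fun _ _ => hv⟩
    · exact ⟨0, by simpa using mul_nonneg hC (norm_nonneg y), fun _ => rfl,
        fun h1 h2 => (hs ⟨h1, h2⟩).elim⟩
  choose v hv hv0 hvd using h'
  -- The sign undoes the one with which the differential of `F.obj s` enters the total differential.
  let f : ∀ (s : Finset (Fin m)) (j : ℕ), (F.obj s).X j := fun s j =>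
    match j with
    | 0 => 0
    | j + 1 => ((-1) ^ p : ℤ) • v s j
  have hf : ∀ s j, ‖f s j‖ ≤ C * ‖y‖ := by
    intro s j
    cases j with
    | zero => simpa [f] using mul_nonneg hC (norm_nonneg y)
    | succ j =>
      change ‖((-1) ^ p : ℤ) • v s j‖ ≤ _
      rcases neg_one_pow_eq_or ℤ p with h | h <;> simpa [h] using hv s j
  have hf0 : ∀ s j, s.card ≠ p → f s j = 0 := by
    intro s j hs
    cases j with
    | zero => rfl
    | succ j =>
      change ((-1) ^ p : ℤ) • v s j = 0
      rw [hv0 s j hs, smul_zero]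
  have hw0 : ∀ s j, s.card ≠ p → (cechTotProj F n s j).lin (cechTotMk n f) = 0 := by
    intro s j hs
    by_cases hsj : (s.card : ℤ) - j = n
    · rw [cechTotProj_mk f hsj, hf0 s j hs]
    · exact cechTotProj_of_ne hsj _
  refine ⟨cechTotMk n f, norm_cechTotMk_le (mul_nonneg hC (norm_nonneg y)) hf,
    fun s j hs => hw0 s j hs.ne, fun s j hs => ?_⟩
  by_cases hsj : (s.card : ℤ) - j = n + 1
  swap
  · exact cechTotProj_of_ne hsj _
  rw [map_sub, cechTotProj_d]
  -- The Čech part raises the cardinality, so from an element concentrated in cardinality `p` it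
  -- does not reach sets of cardinality at most `p`.
  have h1 : ∑ i ∈ s, cechSign s i • ((F.map (eraseHom s i)).f j).lin
      ((cechTotProj F n (s.erase i) j).lin (cechTotMk n f)) = 0 := by
    refine Finset.sum_eq_zero fun i hi => ?_
    have := Finset.card_erase_add_one hi
    rw [hw0 _ _ (by omega), map_zero, smul_zero]
  rw [h1, add_zero]
  by_cases hsp : s.card = p
  · have hjk : j = k := by omega
    rw [cechTotProj_mk f (by push_cast; omega)]
    change _ - ((-1) ^ s.card : ℤ) • ((F.obj s).d (j + 1) j).lin (((-1) ^ p : ℤ) • v s j) = 0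
    rw [map_zsmul, smul_smul, hsp, ← mul_pow, hvd s j hsp hjk]
    simp
  · rw [hy s j (by omega), hw0 s _ hsp, map_zero, smul_zero, sub_zero]

-- The columns are removed in order of increasing cardinality. As `n + 1 < p`, the components met on
-- the way have positive chain degree, where the columns are exact; the process ends because
-- cardinalities are bounded by `m`.
variable (F) in
theorem exists_cechTotD_eq (hF : ∀ s k, StrictExactAt ((F.obj s).d (k + 2) (k + 1))
      ((F.obj s).d (k + 1) k)) (n : ℤ) (p : ℕ) (hp : n + 1 < p) :
    ∃ C : ℝ, 0 ≤ C ∧ ∀ y : cechTotX F (n + 1), (cechTotD F (n + 1)).lin y = 0 → CechSupp p y →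
      ∃ w, (cechTotD F n).lin w = y ∧ ‖w‖ ≤ C * ‖y‖ ∧ CechSupp p w := by
  choose E hE0 hE using fun s k => (strictExactAt_iff.1 (hF s k)).2
  obtain ⟨r, hr⟩ : ∃ r, m < p + r := ⟨m + 1, by omega⟩
  induction r generalizing p with
  | zero =>
    refine ⟨0, le_rfl, fun y _ hy => ⟨0, ?_, by simp, fun s k _ => map_zero _⟩⟩
    rw [map_zero]
    refine cechTot_ext fun s k => ?_
    rw [hy s k (by have := s.card_le_univ; simp at this; omega), map_zero]
  | succ r ih =>
    obtain ⟨C, hC0, hC⟩ := ih (p + 1) (by push_cast; omega) (by omega)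
    obtain ⟨k, hk⟩ : ∃ k : ℕ, (p : ℤ) - (k + 1 : ℕ) = n + 1 :=
      ⟨(p - n - 2).toNat, by push_cast; omega⟩
    let D : ℝ := ∑ s, E s k
    have hD0 : 0 ≤ D := Finset.sum_nonneg fun s _ => hE0 s k
    obtain ⟨T, hT0, hT⟩ := exists_nonneg_bound (cechTotD F n).bdd
    refine ⟨D + C * (1 + T * D), by positivity, fun y hyd hy => ?_⟩
    obtain ⟨w, hw, hw', hw''⟩ := exists_cechSupp_sub hk hD0 hy fun s hs => by
      -- In the lowest column a total cycle is a cycle of that column, since the Čech part of the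
      -- differential would have to come from smaller sets.
      have h1 : ((F.obj s).d (k + 1) k).lin ((cechTotProj F (n + 1) s (k + 1)).lin y) = 0 := by
        have h2 := cechTotProj_d (n + 1) s k y
        rw [hyd, map_zero, Finset.sum_eq_zero, add_zero] at h2
        · rcases neg_one_pow_eq_or ℤ s.card with h | h
          · simpa [h] using h2.symm
          · simpa [h] using h2.symm
        · intro i hi
          have := Finset.card_erase_add_one hi
          rw [hy _ _ (by omega), map_zero, smul_zero]
      obtain ⟨v, hv, hv'⟩ := hE s k _ h1
      refine ⟨v, hv, hv'.trans ?_⟩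
      exact mul_le_mul (Finset.single_le_sum (f := fun s => E s k) (fun s _ => hE0 s k)
        (Finset.mem_univ s)) (norm_cechTotProj_le _ _ _) (norm_nonneg _) hD0
    obtain ⟨x, hx, hx', hx''⟩ := hC (y - (cechTotD F n).lin w)
      (by rw [map_sub, hyd, cechTotD_cechTotD, sub_zero]) hw''
    refine ⟨w + x, by rw [map_add, hx, add_sub_cancel], ?_, hw'.add (hx''.mono (by omega))⟩
    have h1 : ‖y - (cechTotD F n).lin w‖ ≤ (1 + T * D) * ‖y‖ := by
      refine (norm_sub_le _ _).trans ?_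
      calc ‖y‖ + ‖(cechTotD F n).lin w‖ ≤ ‖y‖ + T * (D * ‖y‖) := by
            gcongr
            exact (hT w).trans (mul_le_mul_of_nonneg_left hw hT0)
        _ = _ := by ring
    calc ‖w + x‖ ≤ D * ‖y‖ + C * ((1 + T * D) * ‖y‖) :=
          (norm_add_le _ _).trans (add_le_add hw (hx'.trans (mul_le_mul_of_nonneg_left h1 hC0)))
      _ = _ := by ring

end elements

theorem strictExact_cochain_int {K : CochainComplex (BanMod c A) ℤ} :
    StrictExact K ↔ ∀ n, StrictExactAt (K.d n (n + 1)) (K.d (n + 1) (n + 1 + 1)) := by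
  have key : ∀ n i j : ℤ, i = n → j = n + 1 + 1 →
      (StrictExactAt (K.d i (n + 1)) (K.d (n + 1) j) ↔
        StrictExactAt (K.d n (n + 1)) (K.d (n + 1) (n + 1 + 1))) := by
    rintro n _ _ rfl rfl
    rfl
  refine ⟨fun h n => (key n _ _ (by simp) (by simp)).1 (h (n + 1)), fun h j => ?_⟩
  obtain ⟨n, rfl⟩ : ∃ n, j = n + 1 := ⟨j - 1, by ring⟩
  exact (key n _ _ (by simp) (by simp)).2 (h n)

/-- A natural family of strict resolutions `F s → G s`. -/
structure StrictResolution (F : Finset (Fin m) ⥤ ChainComplex (BanMod c A) ℕ)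
    (G : Finset (Fin m) ⥤ BanMod c A) where
  aug : ∀ s, (F.obj s).X 0 ⟶ G.obj s
  naturality : ∀ {s t} (f : s ⟶ t), (F.map f).f 0 ≫ aug t = aug s ≫ G.map f
  exact_succ : ∀ s k, StrictExactAt ((F.obj s).d (k + 2) (k + 1)) ((F.obj s).d (k + 1) k)
  exact_zero : ∀ s, StrictExactAt ((F.obj s).d 1 0) (aug s)
  surj : ∀ s, ∃ C : ℝ, 0 ≤ C ∧ ∀ g, ∃ x, (aug s).lin x = g ∧ ‖x‖ ≤ C * ‖g‖

namespace StrictResolution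

variable {F : Finset (Fin m) ⥤ ChainComplex (BanMod c A) ℕ} {G : Finset (Fin m) ⥤ BanMod c A}

theorem aug_map (ρ : StrictResolution F G) {s t : Finset (Fin m)} (f : s ⟶ t) (x : (F.obj s).X 0) :
    (ρ.aug t).lin (((F.map f).f 0).lin x) = (G.map f).lin ((ρ.aug s).lin x) := by
  rw [← comp_lin, ρ.naturality, comp_lin]

theorem aug_d (ρ : StrictResolution F G) (s : Finset (Fin m)) (x : (F.obj s).X 1) :
    (ρ.aug s).lin (((F.obj s).d 1 0).lin x) = 0 :=
  (strictExactAt_iff.1 (ρ.exact_zero s)).1 x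

/-- The image of an element of the total complex in the Čech complex of `G`. -/
noncomputable def toCech (ρ : StrictResolution F G) (n : ℤ) (N : ℕ) (y : cechTotX F n) :
    cechX G N :=
  fun s => (ρ.aug s.1).lin ((cechTotProj F n s.1 0).lin y)

theorem cechProj_toCech (ρ : StrictResolution F G) {n : ℤ} {N : ℕ} (y : cechTotX F n)
    {s : Finset (Fin m)} (hs : s.card = N) :
    (cechProj G N s).lin (ρ.toCech n N y) = (ρ.aug s).lin ((cechTotProj F n s 0).lin y) := by
  rw [cechProj, dif_pos hs]
  rfl

/-- The augmentation kills the differential of the columns, so only the Čech part of the total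
differential is seen by `G`. -/
theorem aug_cechTotProj_d (ρ : StrictResolution F G) (n : ℤ) (N : ℕ) (y : cechTotX F n)
    {s : Finset (Fin m)} (hs : s.card = N + 1) :
    (ρ.aug s).lin ((cechTotProj F (n + 1) s 0).lin ((cechTotD F n).lin y)) =
      (cechProj G (N + 1) s).lin ((cechD G N).lin (ρ.toCech n N y)) := by
  rw [← comp_lin (cechD G N), cechD_proj, sum_lin, cechTotProj_d, map_add, map_zsmul, ρ.aug_d,
    smul_zero, zero_add, map_sum]
  refine Finset.sum_congr rfl fun i hi => ?_
  have := Finset.card_erase_add_one hi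
  rw [map_zsmul, ρ.aug_map, zsmul_lin, comp_lin, ρ.cechProj_toCech y (by omega)]

/-- A cycle of degree `N ≥ 0` gives a Čech cocycle of `G` in its components of chain degree zero.
Subtracting the differential of a lift of a primitive makes their augmentations vanish; they then
are boundaries in their columns, and what remains lies in larger cardinalities, where only exactness
of the columns is needed. In negative degrees there are no components of chain degree zero. -/
theorem strictExact_cechTotal (ρ : StrictResolution F G) (h0 : ∀ y, (cechD G 0).lin y = 0 → y = 0)
    (hG : ∀ n, StrictExactAt (cechD G n) (cechD G (n + 1))) : StrictExact (cechTotal F) := by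
  refine strictExact_cochain_int.2 fun n => ?_
  rw [cechTotal_d n, cechTotal_d (n + 1)]
  suffices h : StrictExactAt (cechTotD F n) (cechTotD F (n + 1)) from h
  refine strictExactAt_iff.2 ⟨cechTotD_cechTotD n, ?_⟩
  rcases lt_or_ge (n + 1) 0 with hn | hn
  · obtain ⟨C, hC0, hC⟩ := exists_cechTotD_eq F ρ.exact_succ n 0 (by simpa using hn)
    refine ⟨C, hC0, fun y hy => ?_⟩
    obtain ⟨w, hw, hw', -⟩ := hC y hy fun s k hs => (Nat.not_lt_zero _ hs).elim
    exact ⟨w, hw, hw'⟩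
  obtain ⟨N, hN⟩ : ∃ N : ℕ, (N : ℤ) = n + 1 := ⟨(n + 1).toNat, Int.toNat_of_nonneg hn⟩
  choose E hE0 hE using fun s => (strictExactAt_iff.1 (ρ.exact_zero s)).2
  choose U hU0 hU using ρ.surj
  choose V hV0 hV using fun s => exists_nonneg_bound (ρ.aug s).bdd
  obtain ⟨C, hC0, hC⟩ := exists_cechTotD_eq F ρ.exact_succ n (N + 1) (by push_cast; omega)
  obtain ⟨T, hT0, hT⟩ := exists_nonneg_bound (cechTotD F n).bdd
  -- correction of the bottom components
  have hstep : ∃ D : ℝ, 0 ≤ D ∧ ∀ y : cechTotX F (n + 1), (cechTotD F (n + 1)).lin y = 0 →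
      ∃ w : cechTotX F n, ‖w‖ ≤ D * ‖y‖ ∧ ∀ s : Finset (Fin m), s.card = N →
        (ρ.aug s).lin ((cechTotProj F (n + 1) s 0).lin (y - (cechTotD F n).lin w)) = 0 := by
    have hcoc : ∀ y : cechTotX F (n + 1), (cechTotD F (n + 1)).lin y = 0 →
        (cechD G N).lin (ρ.toCech (n + 1) N y) = 0 := by
      intro y hy
      funext s
      have h1 := ρ.aug_cechTotProj_d (n + 1) N y s.2
      rw [hy, map_zero, map_zero, ← cechProj_eq] at h1
      exact h1.symm
    cases N with
    -- At the left end no correction is needed: the cocycle is zero by `h0`.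
    | zero =>
      refine ⟨0, le_rfl, fun y hy => ⟨0, by simp, fun s hs => ?_⟩⟩
      rw [map_zero, sub_zero, ← ρ.cechProj_toCech y hs, h0 _ (hcoc y hy), map_zero]
    | succ N =>
      obtain ⟨Q, hQ0, hQ⟩ := (strictExactAt_iff.1 (hG N)).2
      let U' : ℝ := ∑ s, U s
      have hU' : 0 ≤ U' := Finset.sum_nonneg fun s _ => hU0 s
      let V' : ℝ := ∑ s, V s
      have hV' : 0 ≤ V' := Finset.sum_nonneg fun s _ => hV0 s
      refine ⟨U' * (Q * V'), by positivity, fun y hy => ?_⟩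
      obtain ⟨g, hg, hg'⟩ := hQ _ (hcoc y hy)
      have hy' : ‖ρ.toCech (n + 1) (N + 1) y‖ ≤ V' * ‖y‖ := by
        refine (pi_norm_le_iff_of_nonneg (by positivity)).2 fun s => (hV s.1 _).trans ?_
        exact mul_le_mul (Finset.single_le_sum (f := V) (fun s _ => hV0 s) (Finset.mem_univ s.1))
          (norm_cechTotProj_le _ _ _) (norm_nonneg _) hV'
      have hg'' : ‖g‖ ≤ Q * V' * ‖y‖ := by
        rw [mul_assoc]
        exact hg'.trans (mul_le_mul_of_nonneg_left hy' hQ0)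
      have hv : ∀ s : Finset (Fin m), ∃ v : (F.obj s).X 0,
          (ρ.aug s).lin v = (cechProj G N s).lin g ∧ ‖v‖ ≤ U' * (Q * V') * ‖y‖ := by
        intro s
        obtain ⟨v, hv, hv'⟩ := hU s ((cechProj G N s).lin g)
        refine ⟨v, hv, hv'.trans ?_⟩
        have hb : ‖(cechProj G N s).lin g‖ ≤ ‖g‖ := by
          by_cases h : s.card = N
          · rw [cechProj, dif_pos h]
            exact norm_le_pi_norm (show ∀ s : {s : Finset (Fin m) // s.card = N}, G.obj s.1 from g)
              ⟨s, h⟩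
          · rw [cechProj, dif_neg h, zero_lin, norm_zero]
            exact norm_nonneg g
        rw [mul_assoc]
        exact mul_le_mul (Finset.single_le_sum (f := U) (fun s _ => hU0 s) (Finset.mem_univ s))
          (hb.trans hg'') (norm_nonneg _) hU'
      choose v hv hv' using hv
      let f : ∀ (s : Finset (Fin m)) (j : ℕ), (F.obj s).X j := fun s j =>
        match j with
        | 0 => v s
        | _ + 1 => 0
      have hf : ∀ s j, ‖f s j‖ ≤ U' * (Q * V') * ‖y‖ := by
        intro s j
        cases j with
        | zero => exact hv' s
        | succ j =>
          change ‖(0 : (F.obj s).X (j + 1))‖ ≤ _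
          rw [norm_zero]
          positivity
      refine ⟨cechTotMk n f, norm_cechTotMk_le (by positivity) hf, fun s hs => ?_⟩
      have h1 : ρ.toCech n N (cechTotMk n f) = g := by
        funext t
        have ht := t.2
        change (ρ.aug t.1).lin ((cechTotProj F n t.1 0).lin (cechTotMk n f)) = g t
        rw [cechTotProj_mk f (by push_cast at hN ⊢; omega)]
        refine (hv t.1).trans ?_
        rw [← cechProj_eq]
        rfl
      rw [map_sub, map_sub, ρ.aug_cechTotProj_d n N _ hs, h1, hg, ρ.cechProj_toCech y hs, sub_self]
  obtain ⟨D, hD0, hD⟩ := hstep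
  let E' : ℝ := ∑ s, E s
  have hE' : 0 ≤ E' := Finset.sum_nonneg fun s _ => hE0 s
  refine ⟨D + (E' + C * (1 + T * E')) * (1 + T * D), by positivity, fun y hy => ?_⟩
  obtain ⟨w, hw, hw'⟩ := hD y hy
  set z := y - (cechTotD F n).lin w with hz
  have hzd : (cechTotD F (n + 1)).lin z = 0 := by
    rw [hz, map_sub, hy, cechTotD_cechTotD, sub_zero]
  have hzn : ‖z‖ ≤ (1 + T * D) * ‖y‖ := by
    refine (norm_sub_le _ _).trans ?_
    calc ‖y‖ + ‖(cechTotD F n).lin w‖ ≤ ‖y‖ + T * (D * ‖y‖) := by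
          gcongr
          exact (hT w).trans (mul_le_mul_of_nonneg_left hw hT0)
      _ = _ := by ring
  -- In total degree `N`, a component of chain degree `k` has cardinality `N + k`.
  have hzs : CechSupp N z := fun s k hs => cechTotProj_of_ne (by omega) z
  obtain ⟨v, hv, hv', hv''⟩ := exists_cechSupp_sub (k := 0) (by simpa using hN) hE' hzs
    fun s hs => by
      obtain ⟨v, hv, hv'⟩ := hE s _ (hw' s hs)
      refine ⟨v, hv, hv'.trans ?_⟩
      exact mul_le_mul (Finset.single_le_sum (f := E) (fun s _ => hE0 s) (Finset.mem_univ s))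
        (norm_cechTotProj_le _ _ _) (norm_nonneg _) hE'
  obtain ⟨x, hx, hx', -⟩ := hC (z - (cechTotD F n).lin v)
    (by rw [map_sub, hzd, cechTotD_cechTotD, sub_zero]) hv''
  refine ⟨w + (v + x), ?_, ?_⟩
  · rw [map_add, map_add, hx, add_sub_cancel, hz, add_sub_cancel]
  · have h1 : ‖z - (cechTotD F n).lin v‖ ≤ (1 + T * E') * ‖z‖ := by
      refine (norm_sub_le _ _).trans ?_
      calc ‖z‖ + ‖(cechTotD F n).lin v‖ ≤ ‖z‖ + T * (E' * ‖z‖) := by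
            gcongr
            exact (hT v).trans (mul_le_mul_of_nonneg_left hv hT0)
        _ = _ := by ring
    have h2 : ‖v + x‖ ≤ (E' + C * (1 + T * E')) * ‖z‖ := by
      refine (norm_add_le _ _).trans ?_
      calc ‖v‖ + ‖x‖ ≤ E' * ‖z‖ + C * ((1 + T * E') * ‖z‖) :=
            add_le_add hv (hx'.trans (mul_le_mul_of_nonneg_left h1 hC0))
        _ = _ := by ring
    calc ‖w + (v + x)‖ ≤ D * ‖y‖ + (E' + C * (1 + T * E')) * ((1 + T * D) * ‖y‖) :=
          (norm_add_le _ _).trans (add_le_add hw (h2.trans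
            (mul_le_mul_of_nonneg_left hzn (by positivity))))
      _ = _ := by ring

/-- A lift `v` of `g`, placed at `(∅, 0)`, can be completed to a total cycle by components with
nonempty sets, since the image of `g` vanishes on singletons and the columns are exact. By exactness
the cycle is a boundary; over `∅` only the differential of the column contributes, so `v` is a
boundary there and its augmentation `g` is zero. -/
theorem eq_zero_of_strictExact_cechTotal (ρ : StrictResolution F G)
    (h : StrictExact (cechTotal F)) {g : G.obj ∅}
    (hg : ∀ i (f : (∅ : Finset (Fin m)) ⟶ {i}), (G.map f).lin g = 0) : g = 0 := by
  obtain ⟨U, -, hU⟩ := ρ.surj ∅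
  obtain ⟨v, hv, -⟩ := hU g
  choose E hE0 hE using fun s => (strictExactAt_iff.1 (ρ.exact_zero s)).2
  -- In total degree zero only `s = ∅` has a component of chain degree zero; the transition maps
  -- merely allow a definition that is uniform in `s`.
  let f : ∀ (s : Finset (Fin m)) (j : ℕ), (F.obj s).X j := fun s j =>
    match j with
    | 0 => ((F.map (homOfLE s.empty_subset)).f 0).lin v
    | _ + 1 => 0
  -- The value `-1` is kept opaque so that the degrees retain the form `n + 1` and `n + 1 + 1`.
  obtain ⟨n, hn⟩ : ∃ n : ℤ, n = -1 := ⟨-1, rfl⟩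
  let z : cechTotX F (n + 1) := cechTotMk (n + 1) f
  have hz : (cechTotProj F (n + 1) ∅ 0).lin z = v := by
    have h1 : F.map (homOfLE (∅ : Finset (Fin m)).empty_subset) = 𝟙 _ := F.map_id ∅
    refine (cechTotProj_mk f (by simp [hn])).trans ?_
    change ((F.map (homOfLE (∅ : Finset (Fin m)).empty_subset)).f 0).lin v = v
    rw [h1]
    rfl
  have hdz : CechSupp 1 ((cechTotD F (n + 1)).lin z) := fun s k hs =>
    cechTotProj_of_ne (by omega) _
  obtain ⟨y, -, hy, hy'⟩ := exists_cechSupp_sub (k := 0) (n := n + 1) (p := 1) (by simp [hn])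
    (C := ∑ s, E s) (Finset.sum_nonneg fun s _ => hE0 s) hdz fun s hs => by
      have h1 : (ρ.aug s).lin ((cechTotProj F (n + 1 + 1) s 0).lin
          ((cechTotD F (n + 1)).lin z)) = 0 := by
        rw [ρ.aug_cechTotProj_d (n + 1) 0 z hs, ← comp_lin, cechD_proj, sum_lin]
        refine Finset.sum_eq_zero fun i hi => ?_
        obtain ⟨j, rfl⟩ := Finset.card_eq_one.1 hs
        have key : ∀ (t : Finset (Fin m)) (_ : t = ∅) (f : t ⟶ {j}),
            (G.map f).lin ((cechProj G 0 t).lin (ρ.toCech (n + 1) 0 z)) = 0 := by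
          rintro _ rfl f
          rw [ρ.cechProj_toCech z (by simp), hz, hv]
          exact hg j f
        rw [zsmul_lin, comp_lin, key _ (by simp_all), smul_zero]
      obtain ⟨x, hx, hx'⟩ := hE s _ h1
      refine ⟨x, hx, hx'.trans ?_⟩
      exact mul_le_mul (Finset.single_le_sum (f := E) (fun s _ => hE0 s) (Finset.mem_univ s))
        (norm_cechTotProj_le _ _ _) (norm_nonneg _) (Finset.sum_nonneg fun s _ => hE0 s)
  obtain ⟨C, -, hC⟩ := exists_cechTotD_eq F ρ.exact_succ (n + 1) 2 (by simp [hn])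
  obtain ⟨x, hx, -, hx'⟩ := hC _ (by rw [map_sub, cechTotD_cechTotD, cechTotD_cechTotD, sub_zero])
    hy'
  have hex := strictExact_cochain_int.1 h n
  rw [cechTotal_d n, cechTotal_d (n + 1)] at hex
  have hex : StrictExactAt (cechTotD F n) (cechTotD F (n + 1)) := hex
  obtain ⟨-, D, -, hD⟩ := strictExactAt_iff.1 hex
  obtain ⟨b, hb, -⟩ := hD (z - y - x) (by rw [map_sub, map_sub, hx, sub_self])
  have h1 := congrArg (cechTotProj F (n + 1) ∅ 0).lin hb
  rw [map_sub, map_sub, hz, hy ∅ 0 (by simp), hx' ∅ 0 (by simp), sub_zero, sub_zero,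
    cechTotProj_d, Finset.sum_empty, add_zero] at h1
  rw [← hv, ← h1, map_zsmul, ρ.aug_d, smul_zero]

end StrictResolution

end BanMod

/-! ### The derived tensor products of quotient algebras -/

namespace BanAlg

open BanMod

variable {c : BanKind} {A : Type u} [NormedCommRing A] [CompleteSpace A] [IsBanObj c A]

/-- If `t` lies in one of the ideals, the corresponding cutoff makes the product small while the
other factors stay bounded. Sums and limits follow from linearity and the uniform bound. -/
theorem tendsto_prod_cutoff (c : BanKind) [IsBanObj c A] {ι : Type} [Fintype ι] {I : ι → Ideal A}
    (F : ∀ i, Cutoff (I i)) {t : A} (ht : t ∈ (⨆ i, I i).closure) :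
    Tendsto (fun e : ∀ i, (F i).E => (∏ i, (F i).f (e i)) * t) (Filter.pi fun i => (F i).l)
      (𝓝 0) := by
  classical
  choose D hD using fun i => (F i).bdd
  have hb : ∀ (s : Finset ι) (e : ∀ i, (F i).E), ‖∏ i ∈ s, (F i).f (e i)‖ ≤
      max 1 ‖(1 : A)‖ * ∏ i ∈ s, |D i| := fun s e =>
    (norm_prod_le_max_one _ _).trans (mul_le_mul_of_nonneg_left
      (Finset.prod_le_prod (fun _ _ => norm_nonneg _) fun i _ => (hD i _).trans (le_abs_self _))
      (zero_le_one.trans (le_max_left _ _)))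
  let g : (∀ i, (F i).E) → (self c A ⟶ self c A) := fun e => smulHom _ (∏ i, (F i).f (e i))
  have hg : UnifBdd g := UnifBdd.smulHom ⟨_, hb Finset.univ⟩
  have hcl := isClosed_tendsto_zero (l := Filter.pi fun i => (F i).l) hg
  suffices h : ((⨆ i, I i : Ideal A) : Set A) ⊆
      {x | Tendsto (fun e => (g e).lin x) (Filter.pi fun i => (F i).l) (𝓝 0)} from
    closure_minimal h hcl ht
  intro x hx
  refine Submodule.iSup_induction _ (motive := fun x : A =>
    Tendsto (fun e : ∀ i, (F i).E => (∏ i, (F i).f (e i)) * x) (Filter.pi fun i => (F i).l) (𝓝 0))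
    hx (fun i x hx => ?_) ?_ ?_
  · have h1 : Tendsto (fun e : ∀ i, (F i).E => ‖(F i).f (e i) * x‖)
        (Filter.pi fun i => (F i).l) (𝓝 0) := by
      rw [← norm_zero (E := A)]
      exact (((F i).tendsto x hx).comp (tendsto_eval_pi _ i)).norm
    have h2 := h1.const_mul (max 1 ‖(1 : A)‖ * ∏ i ∈ Finset.univ.erase i, |D i|)
    rw [mul_zero] at h2
    refine squeeze_zero_norm (fun e => ?_) h2
    rw [← Finset.prod_erase_mul _ _ (Finset.mem_univ i), mul_assoc]
    exact (norm_mul_le _ _).trans (mul_le_mul_of_nonneg_right (hb _ e) (norm_nonneg _))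
  · simp only [mul_zero]
    exact tendsto_const_nhds
  · intro x y hx hy
    simpa only [mul_add, add_zero] using hx.add hy

theorem elemHom_one_lin (B : BanAlg c A) (a : A) :
    (elemHom (c := c) (M := B.toMod) (1 : B)).lin a = algebraMap A B a :=
  (Algebra.algebraMap_eq_smul_one (A := B) a).symm

/-- A lift that is merely a bounded map of sets suffices, because the module in degree zero is free
on the set `B`. -/
theorem HasBddLift.exists_form {B : BanAlg c A} (hB : B.HasBddLift) :
    ∃ Λ : (resolution B.toMod).X 0 ⟶ self c A,
      ∀ x, algebraMap A B (Λ.lin x) = (augmentation B.toMod).lin x := by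
  obtain ⟨C, -, hC⟩ := hB
  choose lift hlift hliftn using hC
  let Λ : freeOn B.toMod ⟶ self c A := freeLift (N := self c A) (fun b : B.toMod => lift b)
    ⟨C, fun b => hliftn b⟩
  have h : Λ ≫ elemHom (M := B.toMod) (1 : B) = counit B.toMod := by
    refine free_hom_ext fun b => ?_
    have h1 : Λ.lin (freeSingle c A _ b) = lift b := freeLift_single _ _ b
    have h2 : (counit B.toMod).lin (freeSingle c A _ b) = b := freeLift_single _ _ b
    exact (congrArg (elemHom (c := c) (M := B.toMod) (1 : B)).lin h1).trans
      ((elemHom_one_lin B _).trans ((hlift b).trans h2.symm))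
  exact ⟨Λ, fun x => (elemHom_one_lin B _).symm.trans
    (congrArg (fun k : freeOn B.toMod ⟶ B.toMod => k.lin x) h)⟩

theorem exists_resolution_retraction {B : BanAlg c A} (F : Cutoff B.idl)
    (Λ : (resolution B.toMod).X 0 ⟶ self c A)
    (hΛ : ∀ x, algebraMap A B (Λ.lin x) = (augmentation B.toMod).lin x) :
    Nonempty (ApproxRetraction (resolution B.toMod) (resolutionLift B.toMod (1 : B)) Λ.lin F) :=
  exists_approxRetraction B _ (familyProjective_resolution _) (resolution_strictExactAt_succ _)
    (augmentation _) (resolution_strictExactAt_zero _) _ (augmentation_resolutionLift _ _) Λ hΛ F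

section

variable {ι : Type} [Fintype ι] [LinearOrder ι] (B : ι → BanAlg c A)

/-- The family of resolutions of the algebras `B i`. -/
noncomputable abbrev res (i : ι) : ChainComplex (BanMod c A) ℕ := resolution (B i).toMod

/-- The augmentation `⨂ᴸ B i → ⨂ B i`. -/
noncomputable def totAug : totX (res B) 0 ⟶ tensor fun i => (B i).toMod :=
  totProj (res B) 0 (fun _ => 0) ≫ tensorMap fun i => augmentation (B i).toMod

/-- The unit of the complex representing `⨂ᴸ B i`. -/
noncomputable def totUnit : totX (res B) 0 := fun q =>
  tmk fun i => unitAt (res B) (fun i => resolutionLift (B i).toMod (1 : B i)) i (q.1 i)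

theorem totAug_totUnit : (totAug B).lin (totUnit B) = unitTensor B := by
  have h : (totProj (res B) 0 fun _ => 0).lin (totUnit B) =
      tmk fun i => resolutionLift (B i).toMod (1 : B i) := by
    rw [totProj, dif_pos (by simp)]
    rfl
  rw [totAug, comp_lin, h, tensorMap_tmk]
  exact congrArg tmk (funext fun i => augmentation_resolutionLift _ _)

theorem res_totD_comp_totAug : totD (res B) 0 ≫ totAug B = 0 := by
  rw [totAug, ← Category.assoc, totD_proj, Preadditive.sum_comp]
  refine Finset.sum_eq_zero fun i _ => ?_
  have h : tensorD (res B) i (bump (fun _ => 0) i) (fun _ => 0) ≫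
      tensorMap (fun i => augmentation (B i).toMod) = 0 := by
    rw [tensorD, tensorMap_comp]
    refine tensorMap_eq_zero _ i ?_
    rw [if_pos rfl, bump_self]
    exact resolution_d_augmentation (B i).toMod
  rw [Preadditive.zsmul_comp, Category.assoc, h, comp_zero, smul_zero]

variable {B}

theorem exists_totAug_eq (hB : ∀ i, (B i).HasBddLift) : ∃ C : ℝ, 0 ≤ C ∧ ∀ g, ∃ x,
    (totAug B).lin x = g ∧ ‖x‖ ≤ C * ‖g‖ := by
  obtain ⟨C, hC0, hC⟩ := exists_smul_unitTensor hB
  obtain ⟨D, hD0, hD⟩ := (totX (res B) 0).exists_smul_bound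
  refine ⟨D * C * ‖totUnit B‖, by positivity, fun g => ?_⟩
  obtain ⟨a, ha, ha'⟩ := hC g
  refine ⟨a • totUnit B, by rw [map_smul, totAug_totUnit, ha], (hD _ _).trans ?_⟩
  calc D * ‖a‖ * ‖totUnit B‖ ≤ D * (C * ‖g‖) * ‖totUnit B‖ := by gcongr
    _ = _ := by ring

theorem res_strictExactAt_pos (hB : ∀ i, (B i).HasBddLift) (F : ∀ i, Cutoff (B i).idl) (n : ℕ) :
    StrictExactAt (totD (res B) (n + 1)) (totD (res B) n) := by
  choose Λ hΛ using fun i => (hB i).exists_form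
  exact tot_strictExactAt_pos (fun i => (exists_resolution_retraction (F i) (Λ i) (hΛ i)).some) n

theorem res_exact_zero (hB : ∀ i, (B i).HasBddLift) (F : ∀ i, Cutoff (B i).idl) :
    ∃ C : ℝ, 0 ≤ C ∧ ∀ y : totX (res B) 0, (totAug B).lin y = 0 →
      ∃ x, (totD (res B) 0).lin x = y ∧ ‖x‖ ≤ C * ‖y‖ := by
  choose Λ hΛ using fun i => (hB i).exists_form
  obtain ⟨C, hC0, hC⟩ := tot_exact_zero
    (fun i => (exists_resolution_retraction (F i) (Λ i) (hΛ i)).some) (fun i => (Λ i).bdd)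
    (⨆ i, (B i).idl).closure fun a ha ε hε => by
      have h := tendsto_prod_cutoff c F ha
      obtain ⟨e, he⟩ := (Metric.tendsto_nhds.1 h ε hε).exists
      rw [dist_zero_right] at he
      exact ⟨e, he.le⟩
  refine ⟨C, hC0, fun y hy => hC y (mem_closure_of_smul_unitTensor hB ?_)⟩
  -- The augmentation is the linear form followed by the action on the unit tensor, so its kernel
  -- consists of elements whose form annihilates the unit tensor.
  have h : tensorForm _ (fun i => (Λ i).lin) (fun i => (Λ i).bdd) ≫ elemHom (unitTensor B) =
      tensorMap fun i => augmentation (B i).toMod := by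
    refine tensor_hom_ext fun x => ?_
    rw [tensorMap_tmk]
    have h1 := tensorForm_tmk _ (fun i => (Λ i).lin) (fun i => (Λ i).bdd) x
    refine (congrArg (fun a : A => a • unitTensor B) h1).trans
      ((prod_smul_unitTensor _).trans (congrArg tmk (funext fun i => ?_)))
    exact hΛ i _
  rw [← hy]
  exact congrArg (fun k => Hom.lin k ((totProj (res B) 0 fun _ => 0).lin y)) h

theorem res_strictExactAt_zero (hB : ∀ i, (B i).HasBddLift) (F : ∀ i, Cutoff (B i).idl) :
    StrictExactAt (totD (res B) 0) (totAug B) :=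
  strictExactAt_iff.2 ⟨fun x => by rw [← comp_lin, res_totD_comp_totAug, zero_lin],
    res_exact_zero hB F⟩

end

/-! ### Strict exactness of the derived Tate–Čech complex -/

section cech

variable {m : ℕ} {B : Fin m → BanAlg c A}

theorem totIns_totAug {s t : Finset (Fin m)} (hst : s ⊆ t) :
    totIns (res B) (fun i => resolutionLift (B i).toMod (1 : B i)) hst 0 ≫
        totAug (fun i : t => B i) =
      totAug (fun i : s => B i) ≫
        tensorIns hst (M := fun i : t => (B i).toMod) fun i => (1 : B i) := by
  have h1 := totIns_proj (res B) (fun i => resolutionLift (B i).toMod (1 : B i)) hst 0 fun _ => 0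
  have h2 := tensorIns_naturality hst (M := fun i : t => (resolution (B i).toMod).X 0)
    (M' := fun i : t => (B i).toMod) (fun i => resolutionLift (B i).toMod (1 : B i))
    (fun i => (1 : B i)) (fun i => augmentation (B i).toMod)
    (fun i => augmentation (B i).toMod) (fun _ => rfl)
    fun i _ => augmentation_resolutionLift _ _
  refine (congrArg (· ≫ tensorMap fun i : t => augmentation (B i).toMod) h1).trans ?_
  exact congrArg (totProj (fun i : s => res B i) 0 (fun _ => 0) ≫ ·) h2.symm

/-- The complexes `⨂ᴸ_{i ∈ s} B i` are strict resolutions of `⨂_{i ∈ s} B i`. -/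
noncomputable def strictResolution (hB : ∀ i, (B i).HasBddLift) (F : ∀ i, Cutoff (B i).idl) :
    StrictResolution (tensorTotFunctor (fun i => resolution (B i).toMod)
      fun i => resolutionLift (B i).toMod (1 : B i)) (tensorDiagram B) where
  aug s := totAug fun i : s => B i
  naturality f := totIns_totAug (leOfHom f)
  exact_succ s k := by
    have h := res_strictExactAt_pos (B := fun i : s => B i) (fun i => hB i) (fun i => F i) k
    rw [← tensorTot_d, ← tensorTot_d] at h
    exact h
  exact_zero s := by
    have h := res_strictExactAt_zero (B := fun i : s => B i) (fun i => hB i) (fun i => F i)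
    rw [← tensorTot_d] at h
    exact h
  surj s := exists_totAug_eq (B := fun i : s => B i) fun i => hB i

theorem strictExact_derivedTateCech (hB : ∀ i, (B i).HasBddLift) (F : ∀ i, Cutoff (B i).idl)
    (hprod : ∀ a : Fin m → A, (∀ i, a i ∈ (B i).idl) → ∏ i, a i = 0) :
    StrictExact (derivedTateCech B) :=
  (strictResolution hB F).strictExact_cechTotal (fun _ => cech_injective hB F hprod)
    (cech_strictExactAt_succ hB F hprod)

theorem eq_zero_of_strictExact_derivedTateCech (hB : ∀ i, (B i).HasBddLift)
    (F : ∀ i, Cutoff (B i).idl) (h : StrictExact (derivedTateCech B)) {a : A}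
    (ha : ∀ i, a ∈ (B i).idl) : a = 0 := by
  refine eq_zero_of_smul_unitOn_empty hB
    ((strictResolution hB F).eq_zero_of_strictExact_cechTotal h fun i f => ?_)
  refine (map_smul _ a _).trans ((congrArg (a • ·) (map_unitOn B f)).trans ?_)
  exact smul_unitTensor_eq_zero (B := fun j : ({i} : Finset (Fin m)) => B j)
    (i := ⟨i, Finset.mem_singleton_self i⟩) (ha i)

end cech

end BanAlg

/-! ### Homotopy epimorphisms -/

namespace BanMod

variable {c : BanKind} {A : Type u} [NormedCommRing A]

theorem eq_zero_of_isZero {M : BanMod c A} (h : IsZero M) (x : M) : x = 0 := by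
  have h1 := (IsZero.iff_id_eq_zero M).1 h
  exact congrArg (fun k : M ⟶ M => k.lin x) h1

open CochainComplex in
/-- A criterion for the strict exactness of a mapping cone. -/
theorem strictExact_mappingCone {K L : CochainComplex (BanMod c A) ℤ} (φ : K ⟶ L)
    (h : ∀ p : ℤ, ∃ C : ℝ, 0 ≤ C ∧ ∀ (k : K.X (p + 1)) (l : L.X p),
      (K.d (p + 1) (p + 1 + 1)).lin k = 0 → (φ.f (p + 1)).lin k + (L.d p (p + 1)).lin l = 0 →
        ∃ k', (K.d p (p + 1)).lin k' = -k ∧ (φ.f p).lin k' = l ∧ ‖k'‖ ≤ C * (‖k‖ + ‖l‖)) :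
    StrictExact (mappingCone φ) := by
  refine strictExact_cochain_int.2 fun n => strictExactAt_iff.2 ⟨fun x => ?_, ?_⟩
  · rw [← comp_lin, HomologicalComplex.d_comp_d, zero_lin]
  obtain ⟨C, hC0, hC⟩ := h (n + 1)
  let f₁ := (mappingCone.fst φ).1.v (n + 1) (n + 1 + 1) rfl
  let f₂ := (mappingCone.snd φ).v (n + 1) (n + 1) (add_zero _)
  let g := (mappingCone.inl φ).v (n + 1) n (by omega)
  obtain ⟨D₁, hD₁0, hD₁⟩ := exists_nonneg_bound f₁.bdd
  obtain ⟨D₂, hD₂0, hD₂⟩ := exists_nonneg_bound f₂.bdd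
  obtain ⟨D, hD0, hD⟩ := exists_nonneg_bound g.bdd
  refine ⟨D * (C * (D₁ + D₂)), by positivity, fun y hy => ?_⟩
  have h1 : (K.d (n + 1 + 1) (n + 1 + 1 + 1)).lin (f₁.lin y) = 0 := by
    have := congrArg (fun k => Hom.lin k y)
      (mappingCone.d_fst_v φ (n + 1) (n + 1 + 1) (n + 1 + 1 + 1) rfl rfl)
    simp only [comp_lin, neg_lin, hy, map_zero] at this
    exact neg_eq_zero.1 this.symm
  have h2 : (φ.f (n + 1 + 1)).lin (f₁.lin y) + (L.d (n + 1) (n + 1 + 1)).lin (f₂.lin y) = 0 := by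
    have := congrArg (fun k => Hom.lin k y) (mappingCone.d_snd_v φ (n + 1) (n + 1 + 1) rfl)
    simp only [comp_lin, add_lin, hy, map_zero] at this
    exact this.symm
  obtain ⟨k', hk1, hk2, hk3⟩ := hC _ _ h1 h2
  -- The preimage is `(k', 0)`, whose differential in the cone is `(-d k', φ k')`.
  refine ⟨g.lin k', ?_, ?_⟩
  · have h3 : ∀ z z' : (mappingCone φ).X (n + 1), f₁.lin z = f₁.lin z' → f₂.lin z = f₂.lin z' →
        z = z' := by
      intro z z' hz hz'
      have h4 : ∀ z, ((mappingCone.inl φ).v (n + 1 + 1) (n + 1) (by omega)).lin (f₁.lin z) +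
          ((mappingCone.inr φ).f (n + 1)).lin (f₂.lin z) = z := fun z =>
        congrArg (fun k => Hom.lin k z) (mappingCone.id_X φ (n + 1) (n + 1 + 1) rfl)
      rw [← h4 z, hz, hz', h4]
    refine h3 _ _ ?_ ?_
    · have h4 := congrArg (fun k => Hom.lin k (g.lin k'))
        (mappingCone.d_fst_v φ n (n + 1) (n + 1 + 1) rfl rfl)
      have h5 := congrArg (fun k => Hom.lin k k') (mappingCone.inl_v_fst_v φ (n + 1) n rfl)
      simp only [comp_lin, neg_lin, id_lin] at h4 h5
      refine h4.trans ?_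
      rw [h5, hk1, neg_neg]
    · have h4 := congrArg (fun k => Hom.lin k (g.lin k')) (mappingCone.d_snd_v φ n (n + 1) rfl)
      have h5 := congrArg (fun k => Hom.lin k k') (mappingCone.inl_v_fst_v φ (n + 1) n rfl)
      have h6 := congrArg (fun k => Hom.lin k k')
        (mappingCone.inl_v_snd_v φ (n + 1) n (by omega))
      simp only [comp_lin, add_lin, id_lin, zero_lin] at h4 h5 h6
      refine h4.trans ?_
      rw [h5, h6, hk2, map_zero, add_zero]
  · calc ‖g.lin k'‖ ≤ D * (C * (D₁ * ‖y‖ + D₂ * ‖y‖)) :=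
          (hD _).trans (mul_le_mul_of_nonneg_left (hk3.trans (mul_le_mul_of_nonneg_left
            (add_le_add (hD₁ y) (hD₂ y)) hC0)) hD0)
      _ = _ := by ring

open HomologicalComplex in
/-- A strict resolution, seen as a morphism to a complex concentrated in degree zero, is a
quasi-isomorphism. -/
theorem quasiIso_toChMinusMap {K L : ChainComplex (BanMod c A) ℕ} (φ : K ⟶ L)
    (hL : ∀ n, IsZero (L.X (n + 1)))
    (hpos : ∀ n, StrictExactAt (K.d (n + 2) (n + 1)) (K.d (n + 1) n))
    (hzero : StrictExactAt (K.d 1 0) (φ.f 0))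
    (hsurj : ∃ C : ℝ, 0 ≤ C ∧ ∀ b, ∃ x, (φ.f 0).lin x = b ∧ ‖x‖ ≤ C * ‖b‖) :
    quasiIso c A (toChMinusMap φ) := by
  let e := ComplexShape.embeddingDownNat
  have hXpos : ∀ (M : ChainComplex (BanMod c A) ℕ) (p : ℤ), 0 < p → IsZero ((M.extend e).X p) :=
    fun M p hp => isZero_extend_X M e p fun i hi => by
      change -(i : ℤ) = p at hi
      omega
  have hLneg : ∀ p : ℤ, p < 0 → IsZero ((L.extend e).X p) := fun p hp => by
    obtain ⟨n, hn⟩ : ∃ n : ℕ, e.f (n + 1) = p := ⟨(-p - 1).toNat, by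
      change -((((-p - 1).toNat + 1 : ℕ) : ℤ)) = p
      omega⟩
    exact (hL n).of_iso (extendXIso L e hn)
  -- strict exactness in the extended complex
  have key : ∀ (a b : ℕ) (p q : ℤ) (ha : e.f a = p) (hb : e.f b = q)
      (Q : K.X b → Prop) (C : ℝ), 0 ≤ C →
      (∀ x, Q x → ∃ y, (K.d a b).lin y = x ∧ ‖y‖ ≤ C * ‖x‖) →
      ∃ C' : ℝ, 0 ≤ C' ∧ ∀ k : (K.extend e).X q, Q ((extendXIso K e hb).hom.lin k) →
        ∃ k', ((K.extend e).d p q).lin k' = -k ∧ ‖k'‖ ≤ C' * ‖k‖ := by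
    intro a b p q ha hb Q C hC0 hC
    obtain ⟨D, hD0, hD⟩ := exists_nonneg_bound (extendXIso K e ha).inv.bdd
    obtain ⟨T, hT0, hT⟩ := exists_nonneg_bound (extendXIso K e hb).hom.bdd
    refine ⟨D * (C * T), by positivity, fun k hk => ?_⟩
    obtain ⟨y, hy, hy'⟩ := hC _ hk
    refine ⟨-(extendXIso K e ha).inv.lin y, ?_, ?_⟩
    · rw [map_neg, extend_d_eq K e ha hb, comp_lin, comp_lin, ← comp_lin _ (extendXIso K e ha).hom,
        Iso.inv_hom_id, id_lin, hy, ← comp_lin, Iso.hom_inv_id, id_lin]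
    · rw [norm_neg, mul_assoc, mul_assoc]
      exact (hD y).trans (mul_le_mul_of_nonneg_left
        (hy'.trans (mul_le_mul_of_nonneg_left (hT k) hC0)) hD0)
  refine strictExact_mappingCone (K := K.extend e) (L := L.extend e) (extendMap φ e) fun p => ?_
  -- In negative degrees `L` vanishes and exactness of the resolution is used, including its
  -- augmentation if `p = -1`. In degree zero the component in `K` vanishes and surjectivity is
  -- used; beyond that both components are zero.
  rcases lt_trichotomy p 0 with hp | rfl | hp
  · have hl : ∀ l : (L.extend e).X p, l = 0 := eq_zero_of_isZero (hLneg p hp)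
    obtain ⟨n, hn⟩ : ∃ n : ℕ, e.f n = p + 1 := ⟨(-p - 1).toNat, by
      change -(((-p - 1).toNat : ℤ)) = p + 1
      omega⟩
    have hn' : e.f (n + 1) = p := by
      change -((n + 1 : ℕ) : ℤ) = p
      change -(n : ℤ) = p + 1 at hn
      push_cast
      omega
    suffices ∃ C : ℝ, 0 ≤ C ∧ ∀ k : (K.extend e).X (p + 1),
        ((K.extend e).d (p + 1) (p + 1 + 1)).lin k = 0 → ((extendMap φ e).f (p + 1)).lin k = 0 →
          ∃ k', ((K.extend e).d p (p + 1)).lin k' = -k ∧ ‖k'‖ ≤ C * ‖k‖ by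
      obtain ⟨C, hC0, hC⟩ := this
      refine ⟨C, hC0, fun k l hk hkl => ?_⟩
      obtain ⟨k', h1, h2⟩ := hC k hk (by simpa [hl l] using hkl)
      refine ⟨k', h1, (hl _).trans (hl l).symm, ?_⟩
      rwa [hl l, norm_zero, add_zero]
    cases n with
    | zero =>
      obtain ⟨-, C, hC0, hC⟩ := strictExactAt_iff.1 hzero
      obtain ⟨C', hC'0, hC'⟩ := key 1 0 p (p + 1) hn' hn (fun x => (φ.f 0).lin x = 0) C hC0 hC
      refine ⟨C', hC'0, fun k _ hk => hC' k ?_⟩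
      rw [extendMap_f φ e hn, comp_lin, comp_lin] at hk
      have := congrArg (extendXIso L e hn).hom.lin hk
      rwa [← comp_lin, Iso.inv_hom_id, id_lin, map_zero] at this
    | succ n =>
      obtain ⟨-, C, hC0, hC⟩ := strictExactAt_iff.1 (hpos n)
      obtain ⟨C', hC'0, hC'⟩ := key (n + 2) (n + 1) p (p + 1) hn' hn
        (fun x => (K.d (n + 1) n).lin x = 0) C hC0 hC
      refine ⟨C', hC'0, fun k hk _ => hC' k ?_⟩
      have hn'' : e.f n = p + 1 + 1 := by
        change -(n : ℤ) = _
        change -((n + 1 : ℕ) : ℤ) = p + 1 at hn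
        push_cast at hn
        omega
      rw [extend_d_eq K e hn hn'', comp_lin, comp_lin] at hk
      have := congrArg (extendXIso K e hn'').hom.lin hk
      rwa [← comp_lin, Iso.inv_hom_id, id_lin, map_zero] at this
  · obtain ⟨C, hC0, hC⟩ := hsurj
    have h0 : e.f 0 = 0 := rfl
    obtain ⟨D, hD0, hD⟩ := exists_nonneg_bound (extendXIso K e h0).inv.bdd
    obtain ⟨T, hT0, hT⟩ := exists_nonneg_bound (extendXIso L e h0).hom.bdd
    refine ⟨D * (C * T), by positivity, fun k l _ _ => ?_⟩
    have hk : ∀ k : (K.extend e).X (0 + 1), k = 0 := eq_zero_of_isZero (hXpos K _ (by omega))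
    obtain ⟨x, hx, hx'⟩ := hC ((extendXIso L e h0).hom.lin l)
    refine ⟨(extendXIso K e h0).inv.lin x, (hk _).trans (hk _).symm, ?_, ?_⟩
    · rw [extendMap_f φ e h0, comp_lin, comp_lin, ← comp_lin _ (extendXIso K e h0).hom,
        Iso.inv_hom_id, id_lin, hx, ← comp_lin, Iso.hom_inv_id, id_lin]
    · rw [hk k, norm_zero, zero_add, mul_assoc, mul_assoc]
      exact (hD x).trans (mul_le_mul_of_nonneg_left
        (hx'.trans (mul_le_mul_of_nonneg_left (hT l) hC0)) hD0)
  · refine ⟨0, le_rfl, fun k l _ _ => ⟨0, ?_, ?_, by simp⟩⟩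
    · rw [eq_zero_of_isZero (hXpos K _ (by omega)) k, map_zero, neg_zero]
    · rw [eq_zero_of_isZero (hXpos L _ hp) l, map_zero]

end BanMod

namespace BanAlg

open BanMod

variable {c : BanKind} {A : Type u} [NormedCommRing A] [CompleteSpace A] [IsBanObj c A]
  {B : BanAlg c A}

theorem mulHom_unitTensor (a : A) :
    B.mulHom.lin (a • unitTensor fun _ : Fin 2 => B) = algebraMap A B a := by
  have h : B.mulHom.lin (unitTensor fun _ : Fin 2 => B) = (1 : B) := by
    refine (tensorLift_tmk _ _ _).trans ?_
    change ∏ _ : Fin 2, (1 : B) = 1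
    exact Finset.prod_const_one
  rw [map_smul, h]
  exact (Algebra.algebraMap_eq_smul_one (A := B) a).symm

/-- The structure morphism of an algebra with bounded lifts and cutoffs is a homotopy
epimorphism. -/
theorem isHomotopyEpi (hB : B.HasBddLift) (F : Cutoff B.idl) : B.IsHomotopyEpi := by
  refine MorphismProperty.Q_inverts (quasiIso c A) _ (quasiIso_toChMinusMap _ (fun n => ?_)
    (fun n => ?_) ?_ ?_)
  · exact HomologicalComplex.isZero_single_obj_X _ _ _ _ (Nat.succ_ne_zero n)
  · have h := res_strictExactAt_pos (B := fun _ : Fin 2 => B) (fun _ => hB) (fun _ => F) n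
    rw [← tensorTot_d, ← tensorTot_d] at h
    exact h
  all_goals
    have hf : B.derivedMul.f 0 = B.derivedMulZero :=
      ChainComplex.toSingle₀Equiv_symm_apply_f_zero _ _
    rw [hf]
  · have hex := strictExactAt_iff.1
      (res_strictExactAt_zero (B := fun _ : Fin 2 => B) (fun _ => hB) (fun _ => F))
    suffices h : StrictExactAt (totD (res fun _ : Fin 2 => B) 0)
        (totAug (fun _ : Fin 2 => B) ≫ B.mulHom) by
      rw [← tensorTot_d] at h
      exact h
    obtain ⟨C, hC0, hC⟩ := hex.2
    refine strictExactAt_iff.2 ⟨fun x => by rw [comp_lin, hex.1, map_zero], C, hC0,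
      fun y hy => hC y ?_⟩
    -- Multiplication is injective on `B ⊗ B`: an element of its kernel is `a` times the unit tensor
    -- with `a` in the kernel of `A → B`, hence zero. Composing with it does not enlarge the kernel
    -- of the augmentation.
    obtain ⟨D, -, hD⟩ := exists_smul_unitTensor (B := fun _ : Fin 2 => B) fun _ => hB
    obtain ⟨a, ha, -⟩ := hD ((totAug fun _ : Fin 2 => B).lin y)
    rw [comp_lin, ← ha, mulHom_unitTensor] at hy
    rw [← ha]
    exact smul_unitTensor_eq_zero (B := fun _ : Fin 2 => B) (i := 0) hy
  · suffices h : ∃ C : ℝ, 0 ≤ C ∧ ∀ b : B, ∃ x,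
        (totAug (fun _ : Fin 2 => B) ≫ B.mulHom).lin x = b ∧ ‖x‖ ≤ C * ‖b‖ from h
    obtain ⟨C, hC0, hC⟩ := hB
    obtain ⟨D, hD0, hD⟩ := (totX (res fun _ : Fin 2 => B) 0).exists_smul_bound
    refine ⟨D * C * ‖totUnit fun _ : Fin 2 => B‖, by positivity, fun b => ?_⟩
    obtain ⟨a, ha, ha'⟩ := hC b
    refine ⟨a • totUnit fun _ : Fin 2 => B, ?_, (hD _ _).trans ?_⟩
    · rw [comp_lin, map_smul, totAug_totUnit, mulHom_unitTensor, ha]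
    · calc D * ‖a‖ * ‖totUnit fun _ : Fin 2 => B‖ ≤
          D * (C * ‖b‖) * ‖totUnit fun _ : Fin 2 => B‖ := by gcongr
        _ = _ := by ring

end BanAlg

/-! ### Algebras of continuous functions -/

/-- Closed sets can be separated from the complements of their neighbourhoods by functions which
define (generalized) convex combinations. -/
def UniformlySeparated (X R : Type*) [TopologicalSpace X] [NormedField R] : Prop :=
  ∀ K U : Set X, IsClosed K → IsOpen U → K ⊆ U → ∃ e : C(X, R), (∀ x ∈ K, e x = 0) ∧
    (∀ x, x ∉ U → e x = 1) ∧ ∀ x v w, ‖e x * v + (1 - e x) * w‖ ≤ max ‖v‖ ‖w‖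

/-- A Urysohn function with values in `[0, 1]`, carried to `R` by an isometric embedding of `ℝ`. -/
theorem uniformlySeparated_of_real {X R : Type*} [TopologicalSpace X] [CompactSpace X]
    [T2Space X] [NormedField R] (j : ℝ →+* R) (hj : ∀ r, ‖j r‖ = |r|) : UniformlySeparated X R := by
  intro K U hK hU hKU
  obtain ⟨g, hg0, hg1, hg⟩ := exists_continuous_zero_one_of_isClosed hK hU.isClosed_compl
    (Set.disjoint_compl_right_iff_subset.2 hKU)
  have hjc : Continuous j := (AddMonoidHomClass.isometry_of_norm j hj).continuous
  refine ⟨⟨fun x => j (g x), hjc.comp g.continuous⟩, fun x hx => ?_, fun x hx => ?_,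
    fun x v w => ?_⟩
  · simp [hg0 hx]
  · simp [hg1 (show x ∈ Uᶜ from hx)]
  · change ‖j (g x) * v + (1 - j (g x)) * w‖ ≤ _
    have h0 := (hg x).1
    have h1 := (hg x).2
    have h2 : (1 : R) - j (g x) = j (1 - g x) := by rw [map_sub, map_one]
    rw [h2]
    refine (norm_add_le _ _).trans ?_
    rw [norm_mul, norm_mul, hj, hj, abs_of_nonneg h0, abs_of_nonneg (sub_nonneg.2 h1)]
    calc g x * ‖v‖ + (1 - g x) * ‖w‖ ≤
        g x * max ‖v‖ ‖w‖ + (1 - g x) * max ‖v‖ ‖w‖ := by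
          have := sub_nonneg.2 h1
          gcongr
          · exact le_max_left _ _
          · exact le_max_right _ _
      _ = max ‖v‖ ‖w‖ := by ring

/-- A clopen set between `K` and `U` gives a function with values `0` and `1`, so at each point the
combination is one of `v` and `w`. No property of the norm of `R` is needed. -/
theorem uniformlySeparated_of_totallyDisconnected {X R : Type*} [TopologicalSpace X]
    [CompactSpace X] [T2Space X] [TotallyDisconnectedSpace X] [NormedField R] :
    UniformlySeparated X R := by
  intro K U hK hU hKU
  obtain ⟨V, hV, hKV, hVU⟩ := exists_clopen_of_closed_subset_open hK hU hKU
  refine ⟨1 - (LocallyConstant.charFn R hV : C(X, R)), fun x hx => ?_, fun x hx => ?_,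
    fun x v w => ?_⟩
  · have := (LocallyConstant.charFn_eq_one R x hV).2 (hKV hx)
    simp [this]
  · have := (LocallyConstant.charFn_eq_zero R x hV).2 fun h => hx (hVU h)
    simp [this]
  · by_cases hx : x ∈ V
    · have := (LocallyConstant.charFn_eq_one R x hV).2 hx
      simp [this]
    · have := (LocallyConstant.charFn_eq_zero R x hV).2 hx
      simp [this]

theorem IsAdmissibleTriple.uniformlySeparated {c : BanKind} {R : Type u} [NormedField R]
    {X : CompHaus.{u}} (h : IsAdmissibleTriple c R X) : UniformlySeparated X R := by
  cases c with
  | arch =>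
    rcases h.1 with ⟨e, he⟩ | ⟨e, he⟩
    · refine uniformlySeparated_of_real e.symm.toRingHom fun r => ?_
      have := he.norm_map_of_map_zero (map_zero e) (e.symm r)
      rw [RingEquiv.apply_symm_apply] at this
      exact this.symm
    · refine uniformlySeparated_of_real (e.symm.toRingHom.comp Complex.ofRealHom) fun r => ?_
      have := he.norm_map_of_map_zero (map_zero e) (e.symm (r : ℂ))
      rw [RingEquiv.apply_symm_apply, Complex.norm_real] at this
      exact this.symm
  | nonarch =>
    have := h.2 rfl
    exact uniformlySeparated_of_totallyDisconnected

namespace UniformlySeparated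

theorem norm_le_one {R : Type*} [NormedField R] {a : R}
    (h : ∀ v w, ‖a * v + (1 - a) * w‖ ≤ max ‖v‖ ‖w‖) : ‖1 - a‖ ≤ 1 := by
  simpa using h 0 1

/-- Functions on a compact subspace can be approximated by restrictions of functions of the same
norm. -/
theorem exists_approx {X Y R : Type*} [TopologicalSpace X] [CompactSpace X] [T2Space X]
    [TopologicalSpace Y] [CompactSpace Y] [NormedField R] (h : UniformlySeparated X R) {j : Y → X}
    (hj : IsClosedEmbedding j) (f : C(Y, R)) {ε : ℝ} (hε : 0 < ε) :
    ∃ g : C(X, R), ‖g‖ ≤ ‖f‖ ∧ ∀ y, ‖f y - g (j y)‖ ≤ ε := by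
  classical
  have hV : ∀ y, ∃ V : Set X, IsOpen V ∧ j y ∈ V ∧ ∀ z, j z ∈ V → ‖f z - f y‖ ≤ ε := by
    intro y
    obtain ⟨V, hV, hV'⟩ := hj.isInducing.isOpen_iff.1
      ((Metric.isOpen_ball (x := f y) (ε := ε)).preimage f.continuous)
    refine ⟨V, hV, ?_, fun z hz => ?_⟩
    · change y ∈ j ⁻¹' V
      rw [hV']
      exact Metric.mem_ball_self hε
    · have hz : z ∈ j ⁻¹' V := hz
      rw [hV'] at hz
      rw [← dist_eq_norm]
      exact (Metric.mem_ball.1 hz).le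
  choose V hVo hVj hVf using hV
  have hN : ∀ y, ∃ N ∈ 𝓝 (j y), IsClosed N ∧ N ⊆ V y := fun y =>
    exists_mem_nhds_isClosed_subset ((hVo y).mem_nhds (hVj y))
  choose N hN hNc hNV using hN
  obtain ⟨t, ht⟩ := CompactSpace.elim_nhds_subcover (fun y => j ⁻¹' N y)
    fun y => hj.continuous.continuousAt (hN y)
  -- The approximation is built up over a finite cover, and the intermediate statements concern the
  -- part covered so far.
  suffices ∃ g : C(X, R), ‖g‖ ≤ ‖f‖ ∧ ∀ y, (∃ k ∈ t, j y ∈ N k) → ‖f y - g (j y)‖ ≤ ε by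
    obtain ⟨g, hg, hg'⟩ := this
    refine ⟨g, hg, fun y => hg' y ?_⟩
    have : y ∈ ⋃ k ∈ t, j ⁻¹' N k := by rw [ht]; trivial
    simpa using this
  clear ht
  induction t using Finset.induction_on with
  | empty => exact ⟨0, by simp, by simp⟩
  | insert k t hk ih =>
    obtain ⟨g, hg, hg'⟩ := ih
    obtain ⟨e, he0, he1, he⟩ := h (N k) (V k) (hNc k) (hVo k) (hNV k)
    -- The new function is `f k` on `N k`, is the old one outside `V k`, and in between is a
    -- combination that increases neither the norm nor the error.
    refine ⟨e * g + (1 - e) * ContinuousMap.const X (f k), ?_, fun y hy => ?_⟩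
    · refine (ContinuousMap.norm_le _ (norm_nonneg f)).2 fun x => (he x _ _).trans ?_
      exact max_le ((g.norm_coe_le_norm x).trans hg) (f.norm_coe_le_norm k)
    · have h1 : f y - (e * g + (1 - e) * ContinuousMap.const X (f k)) (j y) =
          e (j y) * (f y - g (j y)) + (1 - e (j y)) * (f y - f k) := by
        change f y - (e (j y) * g (j y) + (1 - e (j y)) * f k) = _
        ring
      rw [h1]
      by_cases hyk : j y ∈ N k
      · rw [he0 _ hyk, zero_mul, zero_add, sub_zero, one_mul]
        exact hVf k y (hNV k hyk)
      · have h2 : ‖f y - g (j y)‖ ≤ ε := by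
          refine hg' y ?_
          obtain ⟨l, hl, hyl⟩ := hy
          rcases Finset.mem_insert.1 hl with rfl | hl
          · exact (hyk hyl).elim
          · exact ⟨l, hl, hyl⟩
        by_cases hyV : j y ∈ V k
        · exact (he _ _ _).trans (max_le h2 (hVf k y hyV))
        · rwa [he1 _ hyV, sub_self, zero_mul, add_zero, one_mul]

end UniformlySeparated

/-! ### Bounded lifts and cutoffs for algebras of continuous functions -/

section functionAlgebra

open BanAlg BanMod

variable {c : BanKind} {R : Type u} [NormedField R] [CompleteSpace R] [IsBanObj c R]
  {X : CompHaus.{u}}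

theorem mem_idl_functionAlgebra {Y : Over X} {a : C(X, R)} :
    a ∈ (functionAlgebra c R Y).idl ↔ ∀ y : Y.left, a (Y.hom y) = 0 :=
  ⟨fun h y => congrArg (fun f : C(Y.left, R) => f y) h,
    fun h => ContinuousMap.ext (f := a.comp (Y.hom.hom.hom : C(Y.left, X))) (g := 0) h⟩

/-- A form of Tietze's theorem: approximate extensions do not increase the norm, and successive
approximation turns them into exact ones at the price of a factor `2`. -/
theorem hasBddLift_functionAlgebra (h : UniformlySeparated X R) {Y : Over X}
    (hY : IsClosedEmbedding Y.hom) : (functionAlgebra c R Y).HasBddLift := by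
  refine ⟨2 * 1, by norm_num, fun b => ?_⟩
  let φ := elemHom (c := c) (M := (functionAlgebra c R Y).toMod) (1 : functionAlgebra c R Y)
  have key : ∀ y ∈ (⊤ : AddSubgroup (functionAlgebra c R Y).toMod), ∀ ε > 0, ∃ x,
      ‖x‖ ≤ 1 * ‖y‖ ∧ ‖y - φ.lin x‖ ≤ ε ∧ y - φ.lin x ∈ (⊤ : AddSubgroup _) := by
    intro y _ ε hε
    obtain ⟨g, hg, hg'⟩ := h.exists_approx hY (show C(Y.left, R) from y) hε
    refine ⟨g, hg.trans_eq (one_mul _).symm, ?_, trivial⟩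
    have h1 : φ.lin g = g.comp (Y.hom.hom.hom : C(Y.left, X)) := elemHom_one_lin _ g
    rw [h1]
    exact (ContinuousMap.norm_le ((show C(Y.left, R) from y) -
      g.comp (Y.hom.hom.hom : C(Y.left, X))) hε.le).2 hg'
  obtain ⟨a, ha, ha'⟩ := exists_preimage_of_approx φ ⊤ zero_le_one key (y := b) trivial
  exact ⟨a, (elemHom_one_lin (functionAlgebra c R Y) _).symm.trans ha, ha'⟩

/-- The net is indexed by the neighbourhoods `s` of the closed set `K`. Its members are `1` on `K`,
vanish outside `s` and have norm at most `1`; a function that vanishes on `K` is small on small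
neighbourhoods of `K`. -/
theorem nonempty_cutoff_functionAlgebra (h : UniformlySeparated X R) {Y : Over X}
    (hY : IsClosedEmbedding Y.hom) : Nonempty (Cutoff (functionAlgebra c R Y).idl) := by
  let K : Set X := Set.range Y.hom
  let E : Type u := {s : Set X // s ∈ 𝓝ˢ K}
  have hE : ∀ s : E, ∃ e : C(X, R), (∀ x ∈ K, e x = 0) ∧ (∀ x, x ∉ s.1 → e x = 1) ∧
      ∀ x, ‖1 - e x‖ ≤ 1 := by
    intro s
    obtain ⟨e, h0, h1, h2⟩ := h K (interior s.1) hY.isClosed_range isOpen_interior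
      (subset_interior_iff_mem_nhdsSet.2 s.2)
    exact ⟨e, h0, fun x hx => h1 x fun hx' => hx (interior_subset hx'),
      fun x => UniformlySeparated.norm_le_one (h2 x)⟩
  choose e he0 he1 he using hE
  have hne : (comap (Subtype.val : E → Set X) (𝓝ˢ K).smallSets).NeBot := by
    refine comap_neBot fun t ht => ?_
    obtain ⟨s, hs, hst⟩ := eventually_smallSets.1 ht
    exact ⟨⟨s, hs⟩, hst s subset_rfl⟩
  refine ⟨{
    E := E
    l := comap Subtype.val (𝓝ˢ K).smallSets
    f := fun s => 1 - e s
    one_sub_mem := fun s => ?_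
    bdd := ⟨1, fun s => (ContinuousMap.norm_le _ zero_le_one).2 (he s)⟩
    tendsto := fun t ht => ?_ }⟩
  · rw [sub_sub_cancel]
    exact mem_idl_functionAlgebra.2 fun y => he0 s _ ⟨y, rfl⟩
  · rw [mem_idl_functionAlgebra] at ht
    refine Metric.tendsto_nhds.2 fun ε hε => ?_
    have hW : {x : X | ‖t x‖ < ε / 2} ∈ 𝓝ˢ K := by
      refine (isOpen_lt t.continuous.norm continuous_const).mem_nhdsSet.2 ?_
      rintro _ ⟨y, rfl⟩
      change ‖t (Y.hom y)‖ < ε / 2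
      rw [ht y, norm_zero]
      positivity
    filter_upwards [tendsto_comap.eventually (eventually_smallSets_subset.2 hW)] with s hs
    rw [dist_zero_right]
    refine lt_of_le_of_lt ((ContinuousMap.norm_le _ (by positivity : 0 ≤ ε / 2)).2 fun x => ?_)
      (half_lt_self hε)
    change ‖(1 - e s x) * t x‖ ≤ ε / 2
    by_cases hx : x ∈ s.1
    · rw [norm_mul]
      exact (mul_le_of_le_one_left (norm_nonneg _) (he s x)).trans (hs hx).le
    · rw [he1 s x hx, sub_self, zero_mul, norm_zero]
      positivity

end functionAlgebra

/-! ### Comparison of the notions of covers -/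

namespace BanAlg

theorem HasBddLift.epi_structureHom {c : BanKind} {A R : Type u} [NormedCommRing A]
    [NormedCommRing R] [Algebra R A] [IsBoundedSMul R A] [CompleteSpace A] [IsBanObj c A]
    {B : BanAlg c A} (hB : B.HasBddLift) : Epi (B.structureHom R) where
  left_cancellation {Z} f g hfg := by
    refine Hom.ext (AlgHom.ext fun b => ?_)
    obtain ⟨C, -, hC⟩ := hB
    obtain ⟨a, rfl, -⟩ := hC b
    exact congrArg (fun k : base R c A ⟶ Z => k.algHom a) hfg

end BanAlg

/-- The unit of a reflection is an isomorphism on objects of the reflective subcategory. -/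
theorem isIso_iota {c : BanKind} {X : CompHaus.{u}}
    (h : c = .nonarch → TotallyDisconnectedSpace X) : IsIso ((iota.{u} c).app X) := by
  cases c with
  | arch => exact inferInstanceAs (IsIso (𝟙 X))
  | nonarch =>
    have := h rfl
    exact Functor.essImage.unit_isIso (i := profiniteToCompHaus)
      ⟨Profinite.of X, ⟨Iso.refl _⟩⟩

/-- A closed subspace of a totally disconnected space is totally disconnected, so naturality of
`iota` identifies `β φ` with `φ`. -/
theorem isCEmbedding_of_isClosedEmbedding {c : BanKind} {Y X : CompHaus.{u}} {φ : Y ⟶ X}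
    (hX : c = .nonarch → TotallyDisconnectedSpace X) (hφ : IsClosedEmbedding φ) :
    IsCEmbedding c φ := by
  have hY : c = .nonarch → TotallyDisconnectedSpace Y := fun hc => by
    have := hX hc
    exact ⟨hφ.isEmbedding.isTotallyDisconnected
      (isTotallyDisconnected_of_totallyDisconnectedSpace _)⟩
  have h1 := isIso_iota hX
  have h2 := isIso_iota hY
  have h3 : (betaFunctor.{u} c).map φ = inv ((iota c).app Y) ≫ φ ≫ (iota c).app X := by
    rw [IsIso.eq_inv_comp]
    exact ((iota c).naturality φ).symm
  rw [IsCEmbedding, h3]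
  have hemb : ∀ {Z W : CompHaus.{u}} (f : Z ⟶ W) [IsIso f], IsEmbedding f := fun f _ =>
    (CompHausLike.homeoOfIso (asIso f)).isEmbedding
  exact ((hemb _).comp hφ.isEmbedding).comp (hemb _)

/-- The finite covering condition is the hub. It implies both kinds of acyclicity through bounded
lifts and cutoffs; conversely either kind makes the restriction to finitely many members of the
family injective. -/
theorem mainTheorem2 (c : BanKind) (R : Type u) [NormedField R] [CompleteSpace R] [IsBanObj c R]
    (X : CompHaus.{u}) (hX : IsAdmissibleTriple c R X)
    (S : Set (Over X)) (hS : ∀ Y ∈ S, Topology.IsClosedEmbedding Y.hom) :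
    List.TFAE
      [IsCCover c X S,
       ∃ S₀ ⊆ S, S₀.Finite ∧ (⋃ Y ∈ S₀, Set.range Y.hom) = Set.univ,
       BanAlg.IsNonDerivedCover R (functionAlgebra c R '' S),
       BanAlg.IsDerivedCover (functionAlgebra c R '' S)] := by
  have hsep := hX.uniformlySeparated
  have hlift : ∀ B ∈ functionAlgebra c R '' S, B.HasBddLift := by
    rintro _ ⟨Y, hY, rfl⟩
    exact hasBddLift_functionAlgebra hsep (hS Y hY)
  have hcut : ∀ B ∈ functionAlgebra c R '' S, Nonempty (BanMod.Cutoff B.idl) := by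
    rintro _ ⟨Y, hY, rfl⟩
    exact nonempty_cutoff_functionAlgebra hsep (hS Y hY)
  -- a family with injective restriction map covers
  have hcover : ∀ (m : ℕ) (B : Fin m → BanAlg c C(X, R)), (∀ i, B i ∈ functionAlgebra c R '' S) →
      (∀ a, (∀ i, a ∈ (B i).idl) → a = 0) →
      ∃ S₀ ⊆ S, S₀.Finite ∧ (⋃ Y ∈ S₀, Set.range Y.hom) = Set.univ := by
    intro m B hB hinj
    choose Y hYS hYB using hB
    refine ⟨Set.range Y, Set.range_subset_iff.2 hYS, Set.finite_range Y, ?_⟩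
    rw [Set.biUnion_range, Set.eq_univ_iff_forall]
    by_contra! hx
    obtain ⟨x, hx⟩ := hx
    have : T1Space X := T2Space.t1Space
    -- A function that vanishes on the finite, hence closed, union and equals `1` at the missed
    -- point.
    obtain ⟨e, he0, he1, -⟩ := hsep (⋃ i, Set.range (Y i).hom) {x}ᶜ
      (isClosed_iUnion_of_finite fun i => (hS _ (hYS i)).isClosed_range) isOpen_compl_singleton
      (Set.subset_compl_singleton_iff.2 hx)
    have h0 : e = 0 := hinj e fun i => by
      rw [← hYB i]
      exact mem_idl_functionAlgebra.2 fun y => he0 _ (Set.mem_iUnion.2 ⟨i, y, rfl⟩)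
    have h1 := he1 x (by simp)
    rw [h0] at h1
    exact zero_ne_one h1
  -- a finite cover gives rise to a finite family of algebras
  have hfam : (∃ S₀ ⊆ S, S₀.Finite ∧ (⋃ Y ∈ S₀, Set.range Y.hom) = Set.univ) →
      ∃ (m : ℕ) (B : Fin m → BanAlg c C(X, R)), Function.Injective B ∧
        (∀ i, B i ∈ functionAlgebra c R '' S) ∧
        ∀ a : Fin m → C(X, R), (∀ i, a i ∈ (B i).idl) → ∏ i, a i = 0 := by
    rintro ⟨S₀, hS₀, hfin, huniv⟩
    have := (hfin.image (functionAlgebra c R)).to_subtype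
    -- The algebras, rather than the spaces, are enumerated, so that the family is injective even if
    -- different members of `S₀` give the same algebra.
    let ε := Finite.equivFin (functionAlgebra c R '' S₀)
    refine ⟨_, fun i => (ε.symm i).1, Subtype.val_injective.comp ε.symm.injective,
      fun i => Set.image_mono hS₀ (ε.symm i).2, fun a ha => ?_⟩
    ext x
    obtain ⟨Y, hY, y, hy⟩ : ∃ Y ∈ S₀, x ∈ Set.range Y.hom := by
      have : x ∈ ⋃ Y ∈ S₀, Set.range Y.hom := by rw [huniv]; trivial
      simpa using this
    have h1 := ha (ε ⟨_, Y, hY, rfl⟩)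
    simp only [Equiv.symm_apply_apply, mem_idl_functionAlgebra] at h1
    rw [ContinuousMap.coe_prod, Finset.prod_apply]
    -- Every point lies in some member of the cover, and the factor belonging to that member
    -- vanishes there.
    refine Finset.prod_eq_zero (Finset.mem_univ (ε ⟨_, Y, hY, rfl⟩)) ?_
    rw [← hy]
    exact h1 y
  tfae_have 1 ↔ 2 := by
    have hiso := isIso_iota hX.2
    have hbij : Function.Bijective ((iota c).app X) :=
      (CompHausLike.homeoOfIso (asIso ((iota c).app X))).bijective
    refine ⟨fun h => ?_, ?_⟩
    · obtain ⟨-, S₀, hS₀, hfin, hcov⟩ := h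
      refine ⟨S₀, hS₀, hfin, Set.eq_univ_of_forall fun x => ?_⟩
      obtain ⟨Y, hY, y, hy⟩ := hcov ((iota c).app X x)
      exact Set.mem_biUnion hY ⟨y, hbij.1 hy⟩
    · rintro ⟨S₀, hS₀, hfin, hcov⟩
      refine ⟨fun Y hY => isCEmbedding_of_isClosedEmbedding hX.2 (hS Y hY), S₀, hS₀, hfin,
        fun z => ?_⟩
      obtain ⟨x, rfl⟩ := hbij.2 z
      have : x ∈ ⋃ Y ∈ S₀, Set.range Y.hom := by rw [hcov]; trivial
      obtain ⟨Y, hY, y, rfl⟩ := Set.mem_iUnion₂.1 this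
      exact ⟨Y, hY, y, rfl⟩
  tfae_have 2 → 3 := by
    intro h
    obtain ⟨m, B, hBi, hBS, hprod⟩ := hfam h
    have F := fun i => (hcut _ (hBS i)).some
    exact ⟨fun B hB => (hlift B hB).epi_structureHom, m, B, hBi, hBS,
      BanAlg.strictExact_tateCech (fun i => hlift _ (hBS i)) F hprod⟩
  tfae_have 2 → 4 := by
    intro h
    obtain ⟨m, B, hBi, hBS, hprod⟩ := hfam h
    have F := fun i => (hcut _ (hBS i)).some
    exact ⟨fun B hB => BanAlg.isHomotopyEpi (hlift B hB) (hcut B hB).some, m, B, hBi, hBS,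
      BanAlg.strictExact_derivedTateCech (fun i => hlift _ (hBS i)) F hprod⟩
  tfae_have 3 → 2 := by
    rintro ⟨-, m, B, -, hBS, hex⟩
    exact hcover m B hBS fun a ha =>
      BanAlg.eq_zero_of_strictExact_tateCech (fun i => hlift _ (hBS i)) hex ha
  tfae_have 4 → 2 := by
    rintro ⟨-, m, B, -, hBS, hex⟩
    have F := fun i => (hcut _ (hBS i)).some
    exact hcover m B hBS fun a ha =>
      BanAlg.eq_zero_of_strictExact_derivedTateCech (fun i => hlift _ (hBS i)) F hex ha
  tfae_finish
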